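/- Let $M$ be a smooth (Hausdorff) Riemannian manifold of dimension $n\ge 1$ with metric $g=(\,\cdot\mid\cdot\,)$ and Christoffel symbols $\Gamma^k_{ij}$ of its metric connection. Let $\mathbf F$ be a force field, i.e. an assignment of a vector $\mathbf F(p,\mathbf v)\in T_pM$ to every $(p,\mathbf v)\in TM$, smooth at all $(p,\mathbf v)$ with $\mathbf v\ne 0$. Consider the Newtonian dynamical system, in local coordinates, $$\ddot x^k+\sum_{i,j}\Gamma^k_{ij}\dot x^i\dot x^j=F^k(x,\dot x),\qquad k=1,\dots,n. \tag{1}$$ *Blow-ups.* For $p_0\in M$ let $\sigma\subset T_{p_0}M$ be the unit sphere. For $\nu_0>0$ and $T>0$, a blow-up of $p_0$ on $[0,T)$ with initial speed $\nu_0$ is a smooth map $f:\sigma\times[0,T)\to M$, $f_t=f(\cdot,t)$, such that for every $q\in\sigma$ the curve $t\mapsto f_t(q)$ is a trajectory of (1) with nowhere vanishing velocity, starting at $p_0$ with velocity $\nu_0 q$, and such that for $0<t<T$ the map $f_t$ is a smooth embedding, so that $S_t=f_t(\sigma)$ is a smooth hypersurface. The blow-up is normal if for all $0<t<T$ and $q\in\sigma$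 the velocity of the trajectory at $f_t(q)$ is orthogonal to the tangent space of $S_t$ at $f_t(q)$. The system (1) admits normal blow-up of points if for every $p_0\in M$ and every $\nu_0>0$ there are $T>0$ and a normal blow-up of $p_0$ on $[0,T)$ with initial speed $\nu_0$. *Weak normality equations.* Put $v=|\mathbf v|$, $N^i=v^i/v$, $N_i=\sum_j g_{ij}N^j$, $P^i_k=\delta^i_k-N^iN_k$, $F_i=\sum_j g_{ij}F^j$, and, in local coordinates $(x,v)$ of $TM$, $\tilde\nabla_i=\partial/\partial v^i$ and $$\nabla_iF_j=\frac{\partial F_j}{\partial x^i}-\sum_{a,b}v^a\,\Gamma^b_{ia}\frac{\partial F_j}{\partial v^b}-\sum_a\Gamma^a_{ij}F_a .$$ The weak normality equations are, for $k=1,\dots,n$, $$\sum_i\Big(v^{-1}F_i+\tilde\nabla_i\Big(\sum_jN^jF_j\Big)\Big)P^i_k=0,$$ $$\sum_{i,j}\big(\nabla_iF_j+\nabla_jF_i-2v^{-2}F_iF_j\big)N^jP^i_k+\sum_{i,j}\Big(\frac{F^j\tilde\nabla_jF_i}{v}-\sum_r\frac{N^rN^j\tilde\nabla_jF_r}{v}F_i\Big)P^i_k=0.$$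 **Theorem 4.2.** The system (1) admits normal blow-up of points if and only if its force field satisfies the weak normality equations at every point $(p,\mathbf v)$ of $TM$ with $\mathbf v\neq0$. Moreover, in that case every blow-up of a point with initial speed $\nu_0>0$, on any interval $[0,T)$, is normal. -/

import Mathlib

open scoped Manifold ContDiff Topology Bundle

/-- The coordinate space `ℝⁿ`. -/
abbrev Coord (n : ℕ) : Type := EuclideanSpace ℝ (Fin n)

instance tangentSpaceFinrankFact {d : ℕ} {M : Type*} [TopologicalSpace M]
    [ChartedSpace (Coord (d + 1)) M] (p : M) :
    Fact (Module.finrank ℝ (TangentSpace (𝓡 (d + 1)) p) = d + 1) :=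
  ⟨finrank_euclideanSpace_fin⟩

noncomputable section

namespace Newtonian

/-- The partial derivative `∂h/∂xⁱ` of a function of `n` real coordinates. -/
def pd {n : ℕ} (i : Fin n) (h : Coord n → ℝ) (x : Coord n) : ℝ :=
  fderiv ℝ h x (EuclideanSpace.single i 1)

section LocalCoordinates

variable {n : ℕ} {M : Type*} [TopologicalSpace M] [ChartedSpace (Coord n) M]

/-- A force field: a vector `F(p, v) ∈ T_pM` for every `(p, v) ∈ TM`. -/
abbrev ForceField (n : ℕ) (M : Type*) [TopologicalSpace M] [ChartedSpace (Coord n) M] :=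
  ∀ p : M, TangentSpace (𝓡 n) p → TangentSpace (𝓡 n) p

/-- The force field is smooth at all `(p, v)` with `v ≠ 0` (no regularity is needed at `v = 0`). -/
def ForceField.IsSmooth [IsManifold (𝓡 n) ∞ M] (F : ForceField n M) : Prop :=
  ContMDiffOn (𝓡 n).tangent (𝓡 n).tangent ∞
    (fun X : TangentBundle (𝓡 n) M ↦ (⟨X.proj, F X.proj X.snd⟩ : TangentBundle (𝓡 n) M))
    {X | X.snd ≠ 0}

/-- The tangent vector `∑ vⁱ ∂/∂xⁱ` at the point with coordinates `x` in the chart `e`. -/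
def ofCoords (e : OpenPartialHomeomorph M (Coord n)) (x v : Coord n) :
    TangentSpace (𝓡 n) (e.symm x) :=
  mfderiv (𝓡 n) (𝓡 n) e.symm x v

/-- The component vector `(Fᵏ(x, v))ₖ` of the force field in the chart `e`. -/
def forceUp (F : ForceField n M) (e : OpenPartialHomeomorph M (Coord n)) (x v : Coord n) :
    Coord n :=
  mfderiv (𝓡 n) (𝓡 n) e (e.symm x) (F (e.symm x) (ofCoords e x v))

/-- The velocity vector of a curve `γ` defined on the interval `J`. -/
def velocity (n : ℕ) {M : Type*} [TopologicalSpace M] [ChartedSpace (Coord n) M] (γ : ℝ → M) (J : Set ℝ)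
    (t : ℝ) : TangentSpace (𝓡 n) (γ t) :=
  mfderivWithin 𝓘(ℝ, ℝ) (𝓡 n) γ J t (1 : ℝ)

variable [Bundle.RiemannianBundle (fun p : M ↦ TangentSpace (𝓡 n) p)]

/-- The metric components `g_{ij}`. -/
def metric (e : OpenPartialHomeomorph M (Coord n)) (i j : Fin n) (x : Coord n) : ℝ :=
  inner ℝ (ofCoords e x (EuclideanSpace.single i 1)) (ofCoords e x (EuclideanSpace.single j 1))

/-- The inverse metric components `g^{ij}`. -/
def metricInv (e : OpenPartialHomeomorph M (Coord n)) (i j : Fin n) (x : Coord n) : ℝ :=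
  (Matrix.of fun a b ↦ metric e a b x)⁻¹ i j

/-- The Christoffel symbols `Γᵏ_{ij}` of the metric connection. -/
def christoffel (e : OpenPartialHomeomorph M (Coord n)) (k i j : Fin n) (x : Coord n) : ℝ :=
  (1 / 2) * ∑ r, metricInv e k r x *
    (pd i (metric e r j) x + pd j (metric e i r) x - pd r (metric e i j) x)

/-- Lowering an index: `w_i = ∑ⱼ g_{ij} wʲ`. -/
def lower (e : OpenPartialHomeomorph M (Coord n)) (x w : Coord n) (i : Fin n) : ℝ :=
  ∑ j, metric e i j x * w j

/-- The speed `v = |v|`. -/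
def speed (e : OpenPartialHomeomorph M (Coord n)) (x v : Coord n) : ℝ :=
  √(∑ i, ∑ j, metric e i j x * v i * v j)

/-- The unit vector `N = v / |v|`, contravariant components. -/
def unitUp (e : OpenPartialHomeomorph M (Coord n)) (x v : Coord n) : Coord n :=
  (speed e x v)⁻¹ • v

/-- The orthogonal projector `Pⁱ_k = δⁱ_k - Nⁱ N_k` onto the hyperplane perpendicular to `v`. -/
def proj (e : OpenPartialHomeomorph M (Coord n)) (x v : Coord n) (i k : Fin n) : ℝ :=
  (if i = k then 1 else 0) - unitUp e x v i * lower e x (unitUp e x v) k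

/-- The covariant components `F_i(x, v)` of the force field. -/
def forceDown (F : ForceField n M) (e : OpenPartialHomeomorph M (Coord n)) (i : Fin n)
    (x v : Coord n) : ℝ :=
  lower e x (forceUp F e x v) i

/-- The velocity gradient `∇̃_i X_j = ∂X_j/∂vⁱ` of one component `X_j(x, v)` of an extended
tensor field (of the field itself if it is a scalar). -/
def velGrad (i : Fin n) (X : Coord n → Coord n → ℝ) (x v : Coord n) : ℝ :=
  pd i (fun w ↦ X x w) v

/-- The spatial gradient of the extended covector field `F_j`:
`∇_i F_j = ∂F_j/∂xⁱ - ∑ vᵃ Γᵇ_{ia} ∂F_j/∂vᵇ - ∑ Γᵃ_{ij} F_a`. -/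
def spatialGrad (F : ForceField n M) (e : OpenPartialHomeomorph M (Coord n)) (i j : Fin n)
    (x v : Coord n) : ℝ :=
  pd i (fun y ↦ forceDown F e j y v) x
    - ∑ a, ∑ b, v a * christoffel e b i a x * velGrad b (forceDown F e j) x v
    - ∑ a, christoffel e a i j x * forceDown F e a x v

/-- The weak normality equations at the point with coordinates `x` and the velocity with
components `v`, for the free index `k`. -/
def WeakNormalityAt (F : ForceField n M) (e : OpenPartialHomeomorph M (Coord n))
    (x v : Coord n) (k : Fin n) : Prop :=
  let s := speed e x v
  let N := unitUp e x v
  let Fd := fun i ↦ forceDown F e i x v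
  let Fu := forceUp F e x v
  (∑ i, (s⁻¹ * Fd i
      + velGrad i (fun y w ↦ ∑ j, unitUp e y w j * forceDown F e j y w) x v) * proj e x v i k = 0)
  ∧ (∑ i, ∑ j, (spatialGrad F e i j x v + spatialGrad F e j i x v
        - 2 * (s ^ 2)⁻¹ * Fd i * Fd j) * N j * proj e x v i k
    + ∑ i, ∑ j, (Fu j * velGrad j (forceDown F e i) x v / s
        - ∑ r, N r * N j * velGrad j (forceDown F e r) x v / s * Fd i) * proj e x v i k = 0)

/-- The force field satisfies the weak normality equations at all `(p, v) ∈ TM` with `v ≠ 0`, in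
all local coordinates. -/
def SatisfiesWeakNormality (F : ForceField n M) : Prop :=
  ∀ e ∈ atlas (Coord n) M, ∀ x ∈ e.target, ∀ v : Coord n, v ≠ 0 →
    ∀ k, WeakNormalityAt F e x v k

/-- `γ` is a trajectory on `J` of the Newtonian dynamical system with force field `F`: in all local
coordinates `ẍᵏ + ∑ Γᵏ_{ij} ẋⁱ ẋʲ = Fᵏ(x, ẋ)`. -/
def IsTrajectoryOn (F : ForceField n M) (γ : ℝ → M) (J : Set ℝ) : Prop :=
  ContMDiffOn 𝓘(ℝ, ℝ) (𝓡 n) 2 γ J ∧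
  ∀ e ∈ atlas (Coord n) M, ∀ t ∈ J, γ t ∈ e.source → ∀ k,
    let x : ℝ → Coord n := fun s ↦ e (γ s)
    let x' : ℝ → Coord n := derivWithin x J
    derivWithin x' J t k + ∑ i, ∑ j, christoffel e k i j (x t) * x' t i * x' t j
      = forceUp F e (x t) (x' t) k

end LocalCoordinates

section BlowUp

variable {d : ℕ} {M : Type*} [TopologicalSpace M] [ChartedSpace (Coord (d + 1)) M]
  [Bundle.RiemannianBundle (fun p : M ↦ TangentSpace (𝓡 (d + 1)) p)]

/-- The unit sphere `σ` of the tangent space `T_pM`. -/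
abbrev UnitSphere (d : ℕ) {M : Type*} [TopologicalSpace M] [ChartedSpace (Coord (d + 1)) M]
    [Bundle.RiemannianBundle (fun p : M ↦ TangentSpace (𝓡 (d + 1)) p)] (p : M) : Type :=
  Metric.sphere (0 : TangentSpace (𝓡 (d + 1)) p) 1

/-- `f` is the blow-up, for `0 ≤ t < T`, of the point `p₀` with initial speed `ν₀`: the curve
`f q` is the trajectory leaving `p₀` with velocity `ν₀ q`, where `q` runs over the whole unit
sphere of `T_{p₀}M`, and for `0 < t < T` the map `f_t = f · t` is a smooth embedding of the sphere,
so that `S_t = f_t(σ)` is a smooth hypersurface. -/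
structure IsBlowUp (F : ForceField (d + 1) M) (p₀ : M) (ν₀ T : ℝ)
    (f : UnitSphere d p₀ → ℝ → M) : Prop where
  smooth : ContMDiffOn ((𝓡 d).prod 𝓘(ℝ, ℝ)) (𝓡 (d + 1)) ∞
    (fun z : UnitSphere d p₀ × ℝ ↦ f z.1 z.2) (Set.univ ×ˢ Set.Ico 0 T)
  trajectory : ∀ q, IsTrajectoryOn F (f q) (Set.Ico 0 T)
  initial : ∀ q, (⟨f q 0, velocity (d + 1) (f q) (Set.Ico 0 T) 0⟩ : TangentBundle (𝓡 (d + 1)) M)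
    = ⟨p₀, ν₀ • (q : TangentSpace (𝓡 (d + 1)) p₀)⟩
  velocity_ne_zero : ∀ q, ∀ t ∈ Set.Ico 0 T, velocity (d + 1) (f q) (Set.Ico 0 T) t ≠ 0
  isEmbedding : ∀ t ∈ Set.Ioo 0 T, Topology.IsEmbedding (fun q ↦ f q t)
  immersion : ∀ t ∈ Set.Ioo 0 T, ∀ q,
    Function.Injective (mfderiv (𝓡 d) (𝓡 (d + 1)) (fun q' ↦ f q' t) q)

/-- The blow-up is normal: for `0 < t < T` the velocity of each trajectory is orthogonal to the
hypersurface `S_t`, whose tangent space at `f_t(q)` is the range of the differential of `f_t`. -/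
def IsNormal {p₀ : M} (T : ℝ) (f : UnitSphere d p₀ → ℝ → M) : Prop :=
  ∀ t ∈ Set.Ioo 0 T, ∀ (q : UnitSphere d p₀) (ξ : TangentSpace (𝓡 d) q),
    inner ℝ (velocity (d + 1) (f q) (Set.Ico 0 T) t : TangentSpace (𝓡 (d + 1)) (f q t))
      (mfderiv (𝓡 d) (𝓡 (d + 1)) (fun q' ↦ f q' t) q ξ) = 0

/-- The Newtonian dynamical system admits normal blow-up of points: for every `p₀` and every
`ν₀ > 0`, the trajectories leaving `p₀` with speed `ν₀` in all directions determine, for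
sufficiently small `t > 0`, a normal blow-up of `p₀`. -/
def AdmitsNormalBlowUp (F : ForceField (d + 1) M) : Prop :=
  ∀ (p₀ : M) (ν₀ : ℝ), 0 < ν₀ → ∃ T > 0, ∃ f : UnitSphere d p₀ → ℝ → M,
    IsBlowUp F p₀ ν₀ T f ∧ IsNormal T f

/-- Every blow-up with positive initial speed is normal for as long as it lasts. -/
def EveryBlowUpNormal (F : ForceField (d + 1) M) : Prop :=
  ∀ (p₀ : M) (ν₀ : ℝ), 0 < ν₀ → ∀ (T : ℝ) (f : UnitSphere d p₀ → ℝ → M),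
    IsBlowUp F p₀ ν₀ T f → IsNormal T f

end BlowUp

end Newtonian

end

/-! Fix a blow-up f, a point q of the sphere and a tangent vector ξ of the sphere at q. Along the
trajectory of q let v be the velocity, τ the derivative of f_t along ξ, and φ = g(v, τ). Normality
means that every such φ vanishes. Write F(z) for g(F, z), τ' for the coordinate derivative of τ, and
∇τ = τ' + Γ(v, τ). By (1), φ' = F(τ) + g(v, ∇τ), and g(v, ∇τ) is the ξ-derivative of the kinetic
energy |v|²/2, whose time derivative is F(v). Exchanging the two derivatives gives φ'' = d/dt F(τ) +
∂_ξ(F(v)), with no curvature term (`hasFDerivWithinAt_pairing`). This is a linear form in τ plus the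
form A(τ'), where A(z) = 2F(z) + (∂_v F · z)(v) is `normalityForm₁`.

The first weak normality equation says that A vanishes on v^⊥, that is A = λ g(v, ·). Then φ'' =
B(τ) + λφ' with B = `normalityForm₂`, and the second equation says that B vanishes on v^⊥, that is B
= μ g(v, ·) (`weakNormality_iff`). Hence φ'' = μφ + λφ'. All trajectories leave the same point, so
τ(0) = 0, and τ'(0) = ν₀ξ is orthogonal to v(0) = ν₀q. So φ(0) = φ'(0) = 0, and φ vanishes
identically (`IsBlowUp.isNormal`).

Conversely, let φ vanish for all ξ. At t = 0 the identity φ'' = 0 reads A(ν₀ξ) = 0, where ν₀ξ is any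
vector orthogonal to the initial velocity; as the initial state is arbitrary, the first equation
holds everywhere. Now B(τ(t)) = 0 for small t, and division by t gives B(τ'(0)) = 0 in the limit,
which is the second equation (`IsBlowUp.normality_initial`).

Blow-ups exist for every smooth force (`Newtonian.exists_isBlowUp`). The flow depends smoothly on
the initial data, by the implicit function theorem for the Picard operator. In a chart, two
trajectories from p₀ with initial velocities u, u' differ at time t by t(u - u') up to half that
size. For small t > 0 this makes f_t an injective immersion of a compact sphere into a Hausdorff
manifold, hence an embedding. -/

noncomputable section

set_option synthInstance.maxHeartbeats 400000

/-! ### Superposition operators on spaces of continuous maps -/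

namespace SmoothFlow

open ContinuousMap unitInterval

universe u

variable {X : Type*} {E G : Type u} [TopologicalSpace X] [CompactSpace X]
  [NormedAddCommGroup E] [NormedSpace ℝ E] [NormedAddCommGroup G] [NormedSpace ℝ G]

/-- Pointwise application of a continuous family of operators to a continuous family of vectors. -/
def pointwiseApply (X : Type*) (E G : Type u) [TopologicalSpace X] [CompactSpace X]
    [NormedAddCommGroup E] [NormedSpace ℝ E] [NormedAddCommGroup G] [NormedSpace ℝ G] :
    C(X, E →L[ℝ] G) →L[ℝ] C(X, E) →L[ℝ] C(X, G) :=
  LinearMap.mkContinuous₂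
    (LinearMap.mk₂ ℝ
      (fun (A : C(X, E →L[ℝ] G)) (h : C(X, E)) ↦
        (⟨fun x ↦ A x (h x), A.continuous.clm_apply h.continuous⟩ : C(X, G)))
      (fun _ _ _ ↦ by ext; simp) (fun _ _ _ ↦ by ext; simp)
      (fun _ _ _ ↦ by ext; simp) (fun _ _ _ ↦ by ext; simp)) 1 (by
    intro A h
    rw [ContinuousMap.norm_le _ (by positivity)]
    intro x
    simp only [LinearMap.mk₂_apply, ContinuousMap.coe_mk, one_mul]
    exact (A x).le_of_opNorm_le_of_le (A.norm_coe_le_norm x) (h.norm_coe_le_norm x))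

@[simp] lemma pointwiseApply_apply (A : C(X, E →L[ℝ] G)) (h : C(X, E)) (x : X) :
    pointwiseApply X E G A h x = A x (h x) := rfl

lemma norm_pointwiseApply_le (A : C(X, E →L[ℝ] G)) {C : ℝ} (hC : 0 ≤ C) (hA : ∀ x, ‖A x‖ ≤ C) :
    ‖pointwiseApply X E G A‖ ≤ C := by
  refine ContinuousLinearMap.opNorm_le_bound _ hC fun h ↦ ?_
  rw [ContinuousMap.norm_le _ (by positivity)]
  exact fun x ↦ (A x).le_of_opNorm_le_of_le (hA x) (h.norm_coe_le_norm x)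

/-- The superposition operator `α ↦ f ∘ α`. -/
def superpose (X : Type*) [TopologicalSpace X] (f : C(E, G)) : C(X, E) → C(X, G) :=
  fun α ↦ f.comp α

/-- The remainder must be small uniformly in x. Continuity of `superpose X f'` at α in the sup norm
gives one δ for all x, and the mean value inequality on each ball around α x does the rest. -/
lemma hasFDerivAt_superpose {f : C(E, G)} (f' : C(E, E →L[ℝ] G))
    (hf : ∀ x, HasFDerivAt f (f' x) x) (α : C(X, E)) :
    HasFDerivAt (superpose X f) (pointwiseApply X E G (f'.comp α)) α := by
  rw [hasFDerivAt_iff_isLittleO_nhds_zero, Asymptotics.isLittleO_iff]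
  intro c hc
  have hcont : Continuous (superpose X f') := ContinuousMap.continuous_postcomp f'
  obtain ⟨δ, hδ, hball⟩ := Metric.continuousAt_iff.1 (hcont.continuousAt (x := α)) c hc
  filter_upwards [Metric.ball_mem_nhds (0 : C(X, E)) hδ] with h hh
  rw [ContinuousMap.norm_le _ (by positivity)]
  intro x
  have hbound : ∀ y ∈ Metric.ball (α x) δ, ‖f' y - f' (α x)‖ ≤ c := by
    intro y hy
    -- Adding a constant map moves α x to y at a sup distance of only ‖y - α x‖.
    have h1 : dist (α + ContinuousMap.const X (y - α x)) α < δ := by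
      rw [dist_eq_norm, add_sub_cancel_left]
      refine lt_of_le_of_lt ((ContinuousMap.norm_le _ (norm_nonneg (y - α x))).2 fun z ↦ ?_)
        (mem_ball_iff_norm.1 hy)
      simp
    have h2 := (ContinuousMap.norm_coe_le_norm _ x).trans
      (by rw [← dist_eq_norm]; exact (hball h1).le :
        ‖superpose X f' (α + ContinuousMap.const X (y - α x)) - superpose X f' α‖ ≤ c)
    simpa [superpose] using h2
  have hhx : ‖h x‖ < δ := (h.norm_coe_le_norm x).trans_lt (mem_ball_zero_iff.1 hh)
  have key := (convex_ball (α x) δ).norm_image_sub_le_of_norm_hasFDerivWithin_le'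
    (fun y _ ↦ (hf y).hasFDerivWithinAt) hbound (Metric.mem_ball_self hδ)
    (y := α x + h x) (by simpa using hhx)
  simp only [add_sub_cancel_left] at key
  refine (le_of_eq ?_).trans (key.trans (by gcongr; exact h.norm_coe_le_norm x))
  simp [superpose]

/-- Up to a fixed bounded bilinear map, the derivative of superposition with f is superposition with
f'. The induction therefore lets the target vary, from G to `E →L[ℝ] G`; a common universe for E and
G keeps this possible. -/
lemma contDiff_superpose_nat (n : ℕ) : ∀ {G : Type u} [NormedAddCommGroup G] [NormedSpace ℝ G]
    (f : C(E, G)), ContDiff ℝ n f → ContDiff ℝ n (superpose X f) := by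
  induction n with
  | zero =>
    intro G _ _ f _
    rw [Nat.cast_zero, contDiff_zero]
    exact ContinuousMap.continuous_postcomp f
  | succ n ih =>
    intro G _ _ f hf
    rw [Nat.cast_succ, contDiff_succ_iff_hasFDerivAt] at hf ⊢
    obtain ⟨f', hf', hd⟩ := hf
    refine ⟨fun α ↦ pointwiseApply X E G (superpose X ⟨f', hf'.continuous⟩ α), ?_,
      hasFDerivAt_superpose ⟨f', hf'.continuous⟩ hd⟩
    exact (pointwiseApply X E G).contDiff.comp (ih ⟨f', hf'.continuous⟩ hf')

end SmoothFlow

/-! ### Smooth dependence of the Picard fixed point -/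

namespace SmoothFlow

open ContinuousMap unitInterval

universe u

variable {E : Type u} [NormedAddCommGroup E]

lemma continuous_projIcc_comp (α : C(I, E)) :
    Continuous fun s : ℝ ↦ α (Set.projIcc 0 1 zero_le_one s) :=
  α.continuous.comp continuous_projIcc

variable [NormedSpace ℝ E]

/-- The primitive `s ↦ ∫₀ˢ α` on the unit interval. -/
def primitive (E : Type u) [NormedAddCommGroup E] [NormedSpace ℝ E] : C(I, E) →L[ℝ] C(I, E) :=
  LinearMap.mkContinuous
    { toFun := fun α ↦ ⟨fun s : I ↦ ∫ r in (0 : ℝ)..s, α (Set.projIcc 0 1 zero_le_one r),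
        (intervalIntegral.continuous_primitive
          (fun _ _ ↦ (continuous_projIcc_comp α).intervalIntegrable _ _) 0).comp
          continuous_subtype_val⟩
      map_add' := fun α β ↦ by
        ext s
        simpa using intervalIntegral.integral_add
          ((continuous_projIcc_comp α).intervalIntegrable _ _)
          ((continuous_projIcc_comp β).intervalIntegrable _ _)
      map_smul' := fun c α ↦ by ext s; simp } 1 (by
    intro α
    rw [ContinuousMap.norm_le _ (by positivity)]
    intro s
    have h := intervalIntegral.norm_integral_le_of_norm_le_const
      (a := (0 : ℝ)) (b := s) (f := fun r ↦ α (Set.projIcc 0 1 zero_le_one r)) (C := ‖α‖)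
      (fun r _ ↦ α.norm_coe_le_norm _)
    refine h.trans ?_
    rw [sub_zero, abs_of_nonneg s.2.1, one_mul]
    exact mul_le_of_le_one_right (norm_nonneg _) s.2.2)

lemma norm_primitive_apply_le (α : C(I, E)) : ‖primitive E α‖ ≤ ‖α‖ := by
  simpa using (primitive E).le_of_opNorm_le (LinearMap.mkContinuous_norm_le _ zero_le_one _) α

/-- The Picard operator of the autonomous equation `x' = f x`, in rescaled time. -/
def picard (f : C(E, E)) (p : E × ℝ) (α : C(I, E)) : C(I, E) :=
  ContinuousMap.const I p.1 + p.2 • primitive E (f.comp α)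

lemma contDiff_picard {f : C(E, E)} (hf : ContDiff ℝ ∞ f) :
    ContDiff ℝ ∞ fun u : (E × ℝ) × C(I, E) ↦ picard f u.1 u.2 := by
  have h1 : ContDiff ℝ ∞ (superpose I f) :=
    contDiff_infty.2 fun n ↦ contDiff_superpose_nat n f (hf.of_le (by exact_mod_cast le_top))
  have h2 : ContDiff ℝ ∞ fun u : (E × ℝ) × C(I, E) ↦ ContinuousMap.const I u.1.1 :=
    (ContinuousLinearMap.const ℝ I : E →L[ℝ] C(I, E)).contDiff.comp (contDiff_fst.comp contDiff_fst)
  exact h2.add ((contDiff_snd.comp contDiff_fst).smul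
    ((primitive E).contDiff.comp (h1.comp contDiff_snd)))

/-- Serves twice: z = z' gives the contraction property, and z ≠ z' the comparison of two orbits in
`norm_flow_sub_sub_le`. -/
lemma norm_picard_sub_le {f : C(E, E)} {L : NNReal} (hL : LipschitzWith L f) (z z' : E) (t : ℝ)
    (α β : C(I, E)) :
    ‖picard f (z, t) α - picard f (z', t) β - ContinuousMap.const I (z - z')‖ ≤
      |t| * L * ‖α - β‖ := by
  have h : picard f (z, t) α - picard f (z', t) β - ContinuousMap.const I (z - z') =
      t • primitive E (f.comp α - f.comp β) := by
    rw [map_sub, smul_sub]; ext s; simp [picard]; abel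
  rw [h, norm_smul, Real.norm_eq_abs, mul_assoc]
  gcongr
  refine (norm_primitive_apply_le _).trans ?_
  rw [ContinuousMap.norm_le _ (by positivity)]
  intro s
  exact (hL.norm_sub_le _ _).trans (by gcongr; exact (α - β).norm_coe_le_norm s)

variable {f : C(E, E)} {L : NNReal}

lemma contracting_picard (hL : LipschitzWith L f) {p : E × ℝ} (hp : |p.2| * L < 1) :
    ContractingWith ⟨|p.2| * L, by positivity⟩ (picard f p) := by
  refine ⟨hp, LipschitzWith.of_dist_le_mul fun α β ↦ ?_⟩
  have := norm_picard_sub_le hL p.1 p.1 p.2 α β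
  rw [dist_eq_norm, dist_eq_norm]
  have h0 : ContinuousMap.const I (p.1 - p.1) = (0 : C(I, E)) := by ext; simp
  rwa [h0, sub_zero] at this

variable [CompleteSpace E]

lemma exists_picard_fixedPoint (hL : LipschitzWith L f) {p : E × ℝ} (hp : |p.2| * L < 1) :
    ∃ α : C(I, E), picard f p α = α :=
  ⟨_, (contracting_picard hL hp).fixedPoint_isFixedPt⟩

open Classical in
/-- The solution of `x' = t • f x`, `x 0 = z` on the unit interval, where `p = (z, t)`. -/
def solution (_hL : LipschitzWith L f) (p : E × ℝ) : C(I, E) :=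
  if h : ∃ α : C(I, E), picard f p α = α then h.choose else 0

lemma picard_solution (hL : LipschitzWith L f) {p : E × ℝ} (hp : |p.2| * L < 1) :
    picard f p (solution hL p) = solution hL p := by
  rw [solution, dif_pos (exists_picard_fixedPoint hL hp)]
  exact (exists_picard_fixedPoint hL hp).choose_spec

lemma eq_solution (hL : LipschitzWith L f) {p : E × ℝ} (hp : |p.2| * L < 1)
    {α : C(I, E)} (hα : picard f p α = α) :
    α = solution hL p :=
  (contracting_picard hL hp).fixedPoint_unique' hα (picard_solution hL hp)

/-- Implicit function theorem for Ψ(p, α) = α - `picard f p α`. The implicit function consists of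
Picard fixed points, so by uniqueness it is the solution near p. -/
lemma contDiffAt_solution (hL : LipschitzWith L f) (hf : ContDiff ℝ ∞ f) {p : E × ℝ}
    (hp : |p.2| * L < 1) :
    ContDiffAt ℝ ∞ (solution hL) p := by
  set Ψ : (E × ℝ) × C(I, E) → C(I, E) := fun u ↦ u.2 - picard f u.1 u.2 with hΨ
  have hΨc : ContDiff ℝ ∞ Ψ := contDiff_snd.sub (contDiff_picard hf)
  set u : (E × ℝ) × C(I, E) := (p, solution hL p)
  have hinv : (fderiv ℝ Ψ u ∘L .inr ℝ (E × ℝ) C(I, E)).IsInvertible := by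
    have hd : HasFDerivAt (picard f p) (p.2 • (primitive E ∘L pointwiseApply I E E
        (ContinuousMap.comp ⟨fderiv ℝ f, hf.continuous_fderiv (by simp)⟩ (solution hL p))))
        (solution hL p) := by
      have := (hasFDerivAt_superpose (X := I) (f := f)
        ⟨fderiv ℝ f, hf.continuous_fderiv (by simp)⟩
        (fun x ↦ (hf.differentiable (by simp) x).hasFDerivAt) (solution hL p))
      exact ((((primitive E).hasFDerivAt).comp _ this).const_smul p.2).const_add _
    have hn : ‖p.2 • (primitive E ∘L pointwiseApply I E E
        (ContinuousMap.comp ⟨fderiv ℝ f, hf.continuous_fderiv (by simp)⟩ (solution hL p)))‖ < 1 := by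
      refine lt_of_le_of_lt (ContinuousLinearMap.opNorm_le_bound _ (by positivity) fun h ↦ ?_) hp
      have h2 := norm_pointwiseApply_le
        (ContinuousMap.comp ⟨fderiv ℝ f, hf.continuous_fderiv (by simp)⟩ (solution hL p)) L.2
        (fun x ↦ norm_fderiv_le_of_lipschitz ℝ hL)
      rw [_root_.smul_apply, norm_smul, Real.norm_eq_abs, mul_assoc]
      exact mul_le_mul_of_nonneg_left
        ((norm_primitive_apply_le _).trans (ContinuousLinearMap.le_of_opNorm_le _ h2 h))
        (abs_nonneg _)
    -- The partial derivative of Ψ in α is the identity minus an operator of norm at most |t| L < 1,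
    -- hence invertible by the Neumann series.
    obtain ⟨w, hw⟩ := isUnit_one_sub_of_norm_lt_one (R := C(I, E) →L[ℝ] C(I, E)) hn
    have h3 : fderiv ℝ Ψ u ∘L .inr ℝ (E × ℝ) C(I, E) = (1 : C(I, E) →L[ℝ] C(I, E)) -
        p.2 • (primitive E ∘L pointwiseApply I E E
        (ContinuousMap.comp ⟨fderiv ℝ f, hf.continuous_fderiv (by simp)⟩ (solution hL p))) := by
      have h4 : HasFDerivAt (fun α : C(I, E) ↦ Ψ (p, α))
          (fderiv ℝ Ψ u ∘L .inr ℝ (E × ℝ) C(I, E)) (solution hL p) :=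
        ((hΨc.differentiable (by simp) u).hasFDerivAt).comp (solution hL p)
          (hasFDerivAt_prodMk_right p (solution hL p))
      exact h4.unique ((hasFDerivAt_id _).sub hd)
    rw [h3, ← hw]
    exact ⟨ContinuousLinearEquiv.unitsEquiv ℝ C(I, E) w, rfl⟩
  have hat : ContDiffAt ℝ ∞ Ψ u := hΨc.contDiffAt
  have hg := hat.contDiffAt_implicitFunction (by simp) hinv
  refine hg.congr_of_eventuallyEq ?_
  have hopen : ∀ᶠ q : E × ℝ in 𝓝 p, |q.2| * L < 1 :=
    ((continuous_snd.abs.mul continuous_const).continuousAt).eventually_lt_const hp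
  have hu0 : Ψ u = 0 := by simp only [hΨ, u]; rw [picard_solution hL hp, sub_self]
  filter_upwards [hat.eventually_apply_implicitFunction (by simp) hinv, hopen] with q hq hq'
  rw [hu0] at hq
  exact (eq_solution hL hq' (sub_eq_zero.1 hq).symm).symm

end SmoothFlow

/-! ### The local flow of a smooth Lipschitz vector field -/

namespace SmoothFlow

open ContinuousMap unitInterval

universe u

variable {E : Type u} [NormedAddCommGroup E] [NormedSpace ℝ E] [CompleteSpace E]
  {f : C(E, E)} {L : NNReal}

/-- The time-`t` flow of `z` along `f`, for `p = (z, t)` with `|t| * L < 1`. -/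
def flow (hL : LipschitzWith L f) (p : E × ℝ) : E := solution hL p 1

lemma contDiffAt_flow (hL : LipschitzWith L f) (hf : ContDiff ℝ ∞ f) {p : E × ℝ}
    (hp : |p.2| * L < 1) : ContDiffAt ℝ ∞ (flow hL) p :=
  (ContinuousMap.evalCLM ℝ (1 : I) : C(I, E) →L[ℝ] E).contDiff.contDiffAt.comp p
    (contDiffAt_solution hL hf hp)

lemma solution_apply (hL : LipschitzWith L f) {p : E × ℝ} (hp : |p.2| * L < 1) (s : I) :
    solution hL p s =
      p.1 + p.2 • ∫ r in (0 : ℝ)..s, f (solution hL p (Set.projIcc 0 1 zero_le_one r)) := by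
  conv_lhs => rw [← picard_solution hL hp]
  rfl

lemma abs_mul_lt_of_mem {s t a : ℝ} (hs : s ∈ I) (ha : 0 ≤ a) (h : |t| * a < 1) :
    |t * s| * a < 1 := by
  refine lt_of_le_of_lt ?_ h
  rw [abs_mul, abs_of_nonneg hs.1]
  exact mul_le_mul_of_nonneg_right (mul_le_of_le_one_right (abs_nonneg t) hs.2) ha

/-- Each time t has its own fixed point on the unit interval. Slowing down the curve for t by the
factor s gives a fixed point for the time t * s, so uniqueness glues these curves into one orbit,
whose integral equation follows. -/
lemma flow_mul (hL : LipschitzWith L f) {z : E} {t : ℝ} (ht : |t| * L < 1) (s : I) :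
    flow hL (z, t * s) = solution hL (z, t) s := by
  set α := solution hL (z, t) with hα
  let β : C(I, E) := ⟨fun r ↦ α (s * r), α.continuous.comp (continuous_const.mul continuous_id)⟩
  have hβ : picard f (z, t * s) β = β := by
    ext r
    change z + (t * s) • (∫ u in (0 : ℝ)..r, f (α (s * Set.projIcc 0 1 zero_le_one u))) =
      α (s * r)
    rw [hα, solution_apply hL ht, ← hα, mul_smul]
    congr 2
    have h1 : ∫ u in (0 : ℝ)..r, f (α (s * Set.projIcc 0 1 zero_le_one u)) =
        ∫ u in (0 : ℝ)..r, f (α (Set.projIcc 0 1 zero_le_one ((s : ℝ) * u))) := by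
      refine intervalIntegral.integral_congr fun u hu ↦ ?_
      rw [Set.uIcc_of_le r.2.1] at hu
      have hu1 : u ∈ I := ⟨hu.1, hu.2.trans r.2.2⟩
      have hsu : (s : ℝ) * u ∈ I := unitInterval.mul_mem s.2 hu1
      rw [Set.projIcc_of_mem _ hu1, Set.projIcc_of_mem _ hsu]
      rfl
    rw [h1, intervalIntegral.smul_integral_comp_mul_left
      (fun u ↦ f (α (Set.projIcc 0 1 zero_le_one u))) (s : ℝ)]
    simp
  have h := eq_solution hL (p := (z, t * s)) (abs_mul_lt_of_mem s.2 L.2 ht) hβ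
  rw [flow, ← h]
  change α (s * 1) = α s
  rw [mul_one]

lemma flow_eq_integral (hL : LipschitzWith L f) {z : E} {t : ℝ} (ht : |t| * L < 1) :
    flow hL (z, t) = z + ∫ u in (0 : ℝ)..t, f (flow hL (z, u)) := by
  rw [flow, solution_apply hL ht]
  have h1 : ∫ r in (0 : ℝ)..(1 : I), f (solution hL (z, t) (Set.projIcc 0 1 zero_le_one r)) =
      ∫ r in (0 : ℝ)..1, f (flow hL (z, t * r)) := by
    refine intervalIntegral.integral_congr fun r hr ↦ ?_
    have hr' : r ∈ I := by simpa [Set.uIcc_of_le (zero_le_one (α := ℝ))] using hr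
    rw [Set.projIcc_of_mem _ hr', ← flow_mul hL ht ⟨r, hr'⟩]
  rw [h1, intervalIntegral.smul_integral_comp_mul_left (fun u ↦ f (flow hL (z, u))) t]
  simp

lemma flow_zero (hL : LipschitzWith L f) (z : E) : flow hL (z, 0) = z := by
  rw [flow_eq_integral hL (by simp)]; simp

lemma hasDerivAt_flow (hL : LipschitzWith L f) (hf : ContDiff ℝ ∞ f) {z : E} {t : ℝ}
    (ht : |t| * L < 1) : HasDerivAt (fun s ↦ flow hL (z, s)) (f (flow hL (z, t))) t := by
  have hopen : ∀ᶠ s : ℝ in 𝓝 t, |s| * L < 1 :=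
    ((continuous_abs.mul continuous_const).continuousAt).eventually_lt_const ht
  have hcont : ∀ s : ℝ, |s| * L < 1 → ContinuousAt (fun u ↦ f (flow hL (z, u))) s := fun s hs ↦
    f.continuous.continuousAt.comp
      ((contDiffAt_flow hL hf (p := (z, s)) hs).continuousAt.comp
        (Continuous.prodMk_right z).continuousAt)
  have hmem : ∀ s ∈ Set.uIcc 0 t, |s| * (L : ℝ) < 1 := by
    intro s hs
    refine lt_of_le_of_lt (mul_le_mul_of_nonneg_right ?_ L.2) ht
    rcases Set.mem_uIcc.1 hs with h | h
    · rw [abs_of_nonneg h.1, abs_of_nonneg (h.1.trans h.2)]; exact h.2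
    · rw [abs_of_nonpos h.2, abs_of_nonpos (h.1.trans h.2)]; linarith [h.1]
  have hint : IntervalIntegrable (fun u ↦ f (flow hL (z, u))) MeasureTheory.volume 0 t :=
    ContinuousOn.intervalIntegrable fun s hs ↦ (hcont s (hmem s hs)).continuousWithinAt
  have hmeas : StronglyMeasurableAtFilter (fun u ↦ f (flow hL (z, u))) (𝓝 t) :=
    ContinuousOn.stronglyMeasurableAtFilter
      (isOpen_lt (continuous_abs.mul continuous_const) continuous_const :
        IsOpen {s : ℝ | |s| * (L : ℝ) < 1})
      (fun s hs ↦ (hcont s hs).continuousWithinAt) t ht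
  have h := (intervalIntegral.integral_hasDerivAt_right hint hmeas (hcont t ht)).const_add z
  exact h.congr_of_eventuallyEq (hopen.mono fun s hs ↦ flow_eq_integral hL hs)

/-- Two solutions differ by the constant z - z' up to |t| L ‖α - β‖. As |t| L ≤ 1/2, this error is
absorbed and gives ‖α - β‖ ≤ 2 ‖z - z'‖, which is inserted once more. -/
lemma norm_flow_sub_sub_le (hL : LipschitzWith L f) (z z' : E) {t : ℝ} (ht : |t| * L ≤ 1 / 2) :
    ‖flow hL (z, t) - flow hL (z', t) - (z - z')‖ ≤ 2 * |t| * L * ‖z - z'‖ := by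
  have ht' : |t| * L < 1 := by linarith
  set α := solution hL (z, t) with hα
  set β := solution hL (z', t) with hβ
  have h1 : ‖α - β - ContinuousMap.const I (z - z')‖ ≤ |t| * L * ‖α - β‖ := by
    have := norm_picard_sub_le hL z z' t α β
    rwa [hα, hβ, picard_solution hL (p := (z, t)) ht', picard_solution hL (p := (z', t)) ht'] at this
  have h2 : ‖α - β‖ ≤ 2 * ‖z - z'‖ := by
    have h3 : ‖α - β‖ ≤ ‖α - β - ContinuousMap.const I (z - z')‖ +
        ‖(ContinuousMap.const I (z - z') : C(I, E))‖ := by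
      simpa using norm_add_le (α - β - ContinuousMap.const I (z - z'))
        (ContinuousMap.const I (z - z'))
    have h4 : ‖(ContinuousMap.const I (z - z') : C(I, E))‖ ≤ ‖z - z'‖ :=
      (ContinuousMap.norm_le _ (norm_nonneg _)).2 fun _ ↦ le_rfl
    nlinarith [norm_nonneg (α - β)]
  calc ‖flow hL (z, t) - flow hL (z', t) - (z - z')‖
      = ‖(α - β - ContinuousMap.const I (z - z')) 1‖ := rfl
    _ ≤ |t| * L * ‖α - β‖ := (ContinuousMap.norm_coe_le_norm _ _).trans h1
    _ ≤ |t| * L * (2 * ‖z - z'‖) := by gcongr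
    _ = 2 * |t| * L * ‖z - z'‖ := by ring

/-- A smooth Lipschitz vector field has a smooth flow for small times, which is close to the
identity in the Lipschitz sense. -/
theorem exists_flow {f : E → E} (hf : ContDiff ℝ ∞ f) {L : NNReal} (hL : LipschitzWith L f) :
    ∃ ε > 0, ∃ C > 0, ∃ Φ : E × ℝ → E, (∀ z, Φ (z, 0) = z) ∧
      ContDiffOn ℝ ∞ Φ (Set.univ ×ˢ Set.Ioo (-ε) ε) ∧
      (∀ z, ∀ t ∈ Set.Ioo (-ε) ε, HasDerivAt (fun s ↦ Φ (z, s)) (f (Φ (z, t))) t) ∧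
      ∀ z z', ∀ t ∈ Set.Ioo (-ε) ε, ‖Φ (z, t) - Φ (z', t) - (z - z')‖ ≤ C * |t| * ‖z - z'‖ := by
  let f' : C(E, E) := ⟨f, hf.continuous⟩
  have hL' : LipschitzWith L f' := hL
  have hε : ∀ t ∈ Set.Ioo (-(1 / (2 * ((L : ℝ) + 1)))) (1 / (2 * ((L : ℝ) + 1))),
      |t| * L ≤ 1 / 2 := by
    intro t ht
    have h1 := (abs_lt.2 ht).le
    have hL0 : (0 : ℝ) ≤ L := L.2
    rw [le_div_iff₀ (by positivity)] at h1
    nlinarith [abs_nonneg t]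
  -- The time bound gives |t| L ≤ 1/2; the summands 1 keep both constants meaningful and positive
  -- when L = 0.
  refine ⟨1 / (2 * ((L : ℝ) + 1)), by positivity, 2 * L + 1, by positivity, flow hL',
    flow_zero hL', fun p hp ↦ ?_, fun z t ht ↦ ?_, fun z z' t ht ↦ ?_⟩
  · exact (contDiffAt_flow hL' hf ((hε _ hp.2).trans_lt (by norm_num))).contDiffWithinAt
  · exact hasDerivAt_flow hL' hf ((hε _ ht).trans_lt (by norm_num))
  · refine (norm_flow_sub_sub_le hL' z z' (hε _ ht)).trans ?_
    have := abs_nonneg t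
    have h1 : 2 * |t| * L ≤ (2 * L + 1) * |t| := by nlinarith
    gcongr

end SmoothFlow

/-! ### Metric and force in a chart -/

namespace Newtonian

section Linearity

variable {n : ℕ} {M : Type*} [TopologicalSpace M] [ChartedSpace (Coord n) M]

lemma ofCoords_add (e : OpenPartialHomeomorph M (Coord n)) (x u w : Coord n) :
    ofCoords e x (u + w) = ofCoords e x u + ofCoords e x w :=
  map_add (mfderiv (𝓡 n) (𝓡 n) e.symm x) u w

lemma ofCoords_smul (e : OpenPartialHomeomorph M (Coord n)) (x : Coord n) (c : ℝ) (u : Coord n) :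
    ofCoords e x (c • u) = c • ofCoords e x u :=
  map_smul (mfderiv (𝓡 n) (𝓡 n) e.symm x) c u

variable [Bundle.RiemannianBundle (fun p : M ↦ TangentSpace (𝓡 n) p)]

/-- The metric in the chart `e` as a bilinear form on the coordinate space. -/
def metricForm (e : OpenPartialHomeomorph M (Coord n)) (x : Coord n) :
    Coord n →L[ℝ] Coord n →L[ℝ] ℝ :=
  (LinearMap.mk₂ ℝ
    (fun u w : Coord n ↦ inner ℝ (ofCoords e x u) (ofCoords e x w))
    (fun _ _ _ ↦ by rw [ofCoords_add, inner_add_left])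
    (fun _ _ _ ↦ by rw [ofCoords_smul, real_inner_smul_left, smul_eq_mul])
    (fun _ _ _ ↦ by rw [ofCoords_add, inner_add_right])
    (fun _ _ _ ↦ by rw [ofCoords_smul, real_inner_smul_right, smul_eq_mul])
    ).toContinuousBilinearMap

lemma metricForm_apply (e : OpenPartialHomeomorph M (Coord n)) (x u w : Coord n) :
    metricForm e x u w = inner ℝ (ofCoords e x u) (ofCoords e x w) := rfl

lemma metricForm_comm (e : OpenPartialHomeomorph M (Coord n)) (x u w : Coord n) :
    metricForm e x u w = metricForm e x w u := by
  simp only [metricForm_apply, real_inner_comm]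

end Linearity

section Charts

variable {n : ℕ} {M : Type*} [TopologicalSpace M] [ChartedSpace (Coord n) M]
  [IsManifold (𝓡 n) ∞ M] {e : OpenPartialHomeomorph M (Coord n)}

lemma mdifferentiable_of_mem_atlas (he : e ∈ atlas (Coord n) M) :
    e.MDifferentiable (𝓡 n) (𝓡 n) :=
  haveI : IsManifold (𝓡 n) 1 M := IsManifold.of_le (n := ∞) (by simp)
  _root_.mdifferentiable_of_mem_atlas he

lemma ofCoords_mfderiv (he : e ∈ atlas (Coord n) M) {x : Coord n} (hx : x ∈ e.target)
    (w : TangentSpace (𝓡 n) (e.symm x)) :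
    ofCoords e x (mfderiv (𝓡 n) (𝓡 n) e (e.symm x) w) = w := by
  have h := (mdifferentiable_of_mem_atlas he).symm_comp_deriv (e.map_target hx)
  rw [e.right_inv hx] at h
  exact DFunLike.congr_fun h w

lemma mfderiv_ofCoords (he : e ∈ atlas (Coord n) M) {x : Coord n} (hx : x ∈ e.target)
    (u : Coord n) : mfderiv (𝓡 n) (𝓡 n) e (e.symm x) (ofCoords e x u) = u :=
  DFunLike.congr_fun ((mdifferentiable_of_mem_atlas he).comp_symm_deriv hx) u

lemma ofCoords_ne_zero (he : e ∈ atlas (Coord n) M) {x : Coord n} (hx : x ∈ e.target)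
    {u : Coord n} (hu : u ≠ 0) : ofCoords e x u ≠ 0 := by
  intro h
  have := mfderiv_ofCoords he hx u
  rw [h, map_zero] at this
  exact hu this.symm

lemma ofCoords_forceUp (F : ForceField n M) (he : e ∈ atlas (Coord n) M) {x : Coord n}
    (hx : x ∈ e.target) (v : Coord n) :
    ofCoords e x (forceUp F e x v) = F (e.symm x) (ofCoords e x v) :=
  ofCoords_mfderiv he hx _

/-- The map is the tangent map of the inverse chart. With `contMDiffOn_toCoords` it carries
smoothness statements from the tangent bundle to the coordinate phase space. -/
lemma contMDiffOn_ofCoords (he : e ∈ atlas (Coord n) M) :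
    ContMDiffOn 𝓘(ℝ, Coord n × Coord n) (𝓡 n).tangent ∞
      (fun z : Coord n × Coord n ↦
        (⟨e.symm z.1, ofCoords e z.1 z.2⟩ : TangentBundle (𝓡 n) M)) (e.target ×ˢ Set.univ) := by
  have h1 : ContMDiffOn (𝓡 n) (𝓡 n) ∞ e.symm e.target :=
    contMDiffOn_symm_of_mem_maximalAtlas (IsManifold.subset_maximalAtlas he)
  have h2 := h1.contMDiffOn_tangentMapWithin (m := ∞) (by simp) e.open_target.uniqueMDiffOn
  have h3 : ContMDiff 𝓘(ℝ, Coord n × Coord n) (𝓡 n).tangent ∞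
      (fun z : Coord n × Coord n ↦ (⟨z.1, z.2⟩ : TangentBundle (𝓡 n) (Coord n))) := by
    intro z
    refine Bundle.contMDiffAt_totalSpace.2 ⟨contDiff_fst.contMDiff z, ?_⟩
    refine ((contDiff_snd (n := ∞) (𝕜 := ℝ) (E := Coord n) (F := Coord n)).contMDiff
      z).congr_of_eventuallyEq (.of_forall fun y ↦ ?_)
    exact congrArg Prod.snd (trivializationAt_model_space_apply (I := 𝓡 n)
      (⟨y.1, y.2⟩ : TangentBundle (𝓡 n) (Coord n)) z.1)
  refine (h2.comp h3.contMDiffOn (s := e.target ×ˢ Set.univ) fun z hz ↦ hz.1).congr fun z hz ↦ ?_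
  change _ = tangentMapWithin (𝓡 n) (𝓡 n) e.symm e.target ⟨z.1, z.2⟩
  rw [tangentMapWithin, mfderivWithin_of_isOpen e.open_target hz.1]
  rfl

lemma contMDiffOn_toCoords (he : e ∈ atlas (Coord n) M) :
    ContMDiffOn (𝓡 n).tangent (𝓡 n) ∞
      (fun X : TangentBundle (𝓡 n) M ↦ (mfderiv (𝓡 n) (𝓡 n) e X.proj X.snd : Coord n))
      {X | X.proj ∈ e.source} := by
  have h1 : ContMDiffOn (𝓡 n) (𝓡 n) ∞ e e.source :=
    contMDiffOn_of_mem_maximalAtlas (IsManifold.subset_maximalAtlas he)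
  have h2 := h1.contMDiffOn_tangentMapWithin (m := ∞) (by simp) e.open_source.uniqueMDiffOn
  have h3 : ContMDiff (𝓡 n).tangent (𝓡 n) ∞
      (fun X : TangentBundle (𝓡 n) (Coord n) ↦ (X.snd : Coord n)) :=
    contMDiff_snd_tangentBundle_modelSpace (Coord n) (𝓡 n)
  refine (h3.comp_contMDiffOn h2).congr fun X hX ↦ ?_
  change _ = (tangentMapWithin (𝓡 n) (𝓡 n) e e.source X).snd
  rw [tangentMapWithin, mfderivWithin_of_isOpen e.open_source hX]

lemma contDiffOn_forceUp {F : ForceField n M} (hF : F.IsSmooth) (he : e ∈ atlas (Coord n) M) :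
    ContDiffOn ℝ ∞ (fun z : Coord n × Coord n ↦ forceUp F e z.1 z.2)
      (e.target ×ˢ {v | v ≠ 0}) := by
  rw [← contMDiffOn_iff_contDiffOn]
  have h1 := (contMDiffOn_ofCoords he).mono
    (Set.prod_mono_right (s := e.target) (Set.subset_univ {v | v ≠ 0}))
  have hF' : ContMDiffOn (𝓡 n).tangent (𝓡 n).tangent ∞
    (fun X : TangentBundle (𝓡 n) M ↦ (⟨X.proj, F X.proj X.snd⟩ : TangentBundle (𝓡 n) M))
    {X | X.snd ≠ 0} := hF
  have h2 := hF'.comp h1 fun z hz ↦ ofCoords_ne_zero he hz.1 hz.2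
  exact (contMDiffOn_toCoords he).comp h2 fun z hz ↦ e.map_target hz.1

variable [Bundle.RiemannianBundle (fun p : M ↦ TangentSpace (𝓡 n) p)]

lemma metricForm_pos (he : e ∈ atlas (Coord n) M) {x : Coord n} (hx : x ∈ e.target)
    {u : Coord n} (hu : u ≠ 0) : 0 < metricForm e x u u := by
  rw [metricForm_apply, real_inner_self_pos]
  exact ofCoords_ne_zero he hx hu

lemma contDiffOn_metricForm
    [IsContMDiffRiemannianBundle (𝓡 n) ∞ (Coord n) (fun p : M ↦ TangentSpace (𝓡 n) p)]
    (he : e ∈ atlas (Coord n) M) : ContDiffOn ℝ ∞ (metricForm e) e.target := by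
  rw [contDiffOn_clm_apply]
  intro u
  rw [contDiffOn_clm_apply]
  intro w
  have h : ∀ u : Coord n, ContMDiffOn (𝓡 n) (𝓡 n).tangent ∞
      (fun x : Coord n ↦ (⟨e.symm x, ofCoords e x u⟩ : TangentBundle (𝓡 n) M)) e.target :=
    fun u ↦ (contMDiffOn_ofCoords he).comp
      (contDiff_prodMk_left u).contMDiff.contMDiffOn fun x hx ↦ ⟨hx, trivial⟩
  rw [← contMDiffOn_iff_contDiffOn]
  exact (h u).inner_bundle (h w)

end Charts
end Newtonian

/-! ### Christoffel symbols and Koszul's formula -/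

namespace Newtonian

section Invariant

variable {n : ℕ}

lemma sum_smul_single (u : Coord n) : ∑ i, u i • (EuclideanSpace.single i (1 : ℝ)) = u := by
  simpa using (EuclideanSpace.basisFun (Fin n) ℝ).sum_repr u

lemma map_eq_sum {G : Type*} [NormedAddCommGroup G] [NormedSpace ℝ G]
    (A : Coord n →L[ℝ] G) (u : Coord n) :
    A u = ∑ i, u i • A (EuclideanSpace.single i 1) := by
  conv_lhs => rw [← sum_smul_single u]
  simp

lemma map_eq_sum₃ (D : Coord n →L[ℝ] Coord n →L[ℝ] Coord n →L[ℝ] ℝ) (u w z : Coord n) :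
    D u w z = ∑ i, u i * D (EuclideanSpace.single i 1) w z := by
  conv_lhs => rw [← sum_smul_single u]
  simp

variable {M : Type*} [TopologicalSpace M] [ChartedSpace (Coord n) M]
variable [Bundle.RiemannianBundle (fun p : M ↦ TangentSpace (𝓡 n) p)]

lemma metric_eq (e : OpenPartialHomeomorph M (Coord n)) (i j : Fin n) (x : Coord n) :
    metric e i j x =
      metricForm e x (EuclideanSpace.single i 1) (EuclideanSpace.single j 1) := rfl

lemma lower_eq (e : OpenPartialHomeomorph M (Coord n)) (x w : Coord n) (i : Fin n) :
    lower e x w i = metricForm e x w (EuclideanSpace.single i 1) := by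
  rw [metricForm_comm, map_eq_sum _ w]
  simp [lower, metric_eq, mul_comm]

lemma speed_eq (e : OpenPartialHomeomorph M (Coord n)) (x v : Coord n) :
    speed e x v = √(metricForm e x v v) := by
  rw [speed, map_eq_sum (metricForm e x) v]
  congr 1
  simp only [_root_.sum_apply, _root_.smul_apply, smul_eq_mul]
  refine Finset.sum_congr rfl fun i _ ↦ ?_
  rw [map_eq_sum _ v, Finset.mul_sum]
  refine Finset.sum_congr rfl fun j _ ↦ ?_
  rw [metric_eq, smul_eq_mul]; ring

/-- The covector `z ↦ g(F, z)` obtained from the force field in the chart `e`. -/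
def forceForm (F : ForceField n M) (e : OpenPartialHomeomorph M (Coord n))
    (z : Coord n × Coord n) : Coord n →L[ℝ] ℝ :=
  metricForm e z.1 (forceUp F e z.1 z.2)

lemma forceDown_eq (F : ForceField n M) (e : OpenPartialHomeomorph M (Coord n)) (i : Fin n)
    (x v : Coord n) : forceDown F e i x v = forceForm F e (x, v) (EuclideanSpace.single i 1) :=
  lower_eq e x _ i

/-- The vector with components `∑ Γᵏ_{ij} uⁱ wʲ`. -/
def christoffelVec (e : OpenPartialHomeomorph M (Coord n)) (x u w : Coord n) : Coord n :=
  WithLp.toLp 2 fun k ↦ ∑ i, ∑ j, christoffel e k i j x * u i * w j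

/-- The matrix of the metric is invertible. -/
lemma metric_mul_metricInv [IsManifold (𝓡 n) ∞ M] {e : OpenPartialHomeomorph M (Coord n)}
    (he : e ∈ atlas (Coord n) M) {x : Coord n} (hx : x ∈ e.target) (r s : Fin n) :
    ∑ k, metric e r k x * metricInv e k s x = if r = s then 1 else 0 := by
  set G : Matrix (Fin n) (Fin n) ℝ := Matrix.of fun a b ↦ metric e a b x
  have hdet : IsUnit G.det := by
    rw [isUnit_iff_ne_zero]
    intro h0
    obtain ⟨w, hw, hGw⟩ := Matrix.exists_mulVec_eq_zero_iff.2 h0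
    have hw' : (WithLp.toLp 2 w : Coord n) ≠ 0 := fun h ↦ hw (by simpa using h)
    have hpos := metricForm_pos he hx hw'
    have h1 : ∀ i, metricForm e x (WithLp.toLp 2 w) (EuclideanSpace.single i 1) = 0 := by
      intro i
      rw [← lower_eq]
      exact congrFun hGw i
    rw [map_eq_sum (metricForm e x (WithLp.toLp 2 w))] at hpos
    simp [h1] at hpos
  have := congrFun (congrFun (Matrix.mul_nonsing_inv G hdet) r) s
  rwa [Matrix.mul_apply, Matrix.one_apply] at this

section Smooth

variable [IsManifold (𝓡 n) ∞ M] {e : OpenPartialHomeomorph M (Coord n)}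

lemma lower_christoffel (he : e ∈ atlas (Coord n) M) {x : Coord n} (hx : x ∈ e.target)
    (i j r : Fin n) : ∑ k, metric e r k x * christoffel e k i j x =
      (1 / 2) * (pd i (metric e r j) x + pd j (metric e i r) x - pd r (metric e i j) x) := by
  have h : ∀ k, metric e r k x * christoffel e k i j x = ∑ s, (1 / 2) *
      (pd i (metric e s j) x + pd j (metric e i s) x - pd s (metric e i j) x) *
        (metric e r k x * metricInv e k s x) := by
    intro k
    rw [christoffel, Finset.mul_sum, Finset.mul_sum]
    exact Finset.sum_congr rfl fun s _ ↦ by ring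
  simp only [h]
  rw [Finset.sum_comm]
  simp only [← Finset.mul_sum, metric_mul_metricInv he hx]
  simp

/-- Nondegeneracy of g: vector identities can be tested by pairing, which makes Koszul's formula
usable without the inverse matrix. -/
lemma metricForm_ext (he : e ∈ atlas (Coord n) M) {x : Coord n} (hx : x ∈ e.target)
    {u w : Coord n} (h : ∀ z, metricForm e x u z = metricForm e x w z) : u = w := by
  by_contra huw
  have := metricForm_pos he hx (sub_ne_zero.2 huw)
  rw [map_sub (metricForm e x), _root_.sub_apply, h, sub_self] at this
  exact lt_irrefl _ this

variable [IsContMDiffRiemannianBundle (𝓡 n) ∞ (Coord n) (fun p : M ↦ TangentSpace (𝓡 n) p)]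

lemma hasFDerivAt_metricForm (he : e ∈ atlas (Coord n) M) {x : Coord n} (hx : x ∈ e.target) :
    HasFDerivAt (metricForm e) (fderiv ℝ (metricForm e) x) x :=
  (((contDiffOn_metricForm he).contDiffAt (e.open_target.mem_nhds hx)).differentiableAt
    (by simp)).hasFDerivAt

lemma hasFDerivAt_metricForm_apply (he : e ∈ atlas (Coord n) M) {x : Coord n}
    (hx : x ∈ e.target) (u w : Coord n) :
    HasFDerivAt (fun y ↦ metricForm e y u w)
      (((fderiv ℝ (metricForm e) x).flip u).flip w) x := by
  have h1 := (hasFDerivAt_metricForm he hx).clm_apply (hasFDerivAt_const u x)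
  have h2 := h1.clm_apply (hasFDerivAt_const w x)
  refine h2.congr_fderiv ?_
  ext z
  simp

lemma fderiv_metricForm_comm (he : e ∈ atlas (Coord n) M) {x : Coord n} (hx : x ∈ e.target)
    (z u w : Coord n) :
    fderiv ℝ (metricForm e) x z u w = fderiv ℝ (metricForm e) x z w u := by
  have h1 := hasFDerivAt_metricForm_apply he hx u w
  have h2 := hasFDerivAt_metricForm_apply he hx w u
  simp only [metricForm_comm e _ u w] at h1
  exact DFunLike.congr_fun (h1.unique h2) z

lemma pd_metric (he : e ∈ atlas (Coord n) M) {x : Coord n} (hx : x ∈ e.target) (i j k : Fin n) :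
    pd k (metric e i j) x = fderiv ℝ (metricForm e) x (EuclideanSpace.single k 1)
      (EuclideanSpace.single i 1) (EuclideanSpace.single j 1) := by
  have h := (hasFDerivAt_metricForm_apply he hx (EuclideanSpace.single i 1)
    (EuclideanSpace.single j 1)).fderiv
  exact DFunLike.congr_fun h _

/-- Koszul's formula in a chart. -/
lemma metricForm_christoffelVec (he : e ∈ atlas (Coord n) M) {x : Coord n} (hx : x ∈ e.target)
    (u w z : Coord n) : metricForm e x (christoffelVec e x u w) z =
      (1 / 2) * (fderiv ℝ (metricForm e) x u w z + fderiv ℝ (metricForm e) x w u z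
        - fderiv ℝ (metricForm e) x z u w) := by
  set D := fderiv ℝ (metricForm e) x with hD
  -- Both sides are linear in z, so basis vectors suffice; there the three Koszul terms become
  -- double sums over the components of u and w.
  have key : ∀ r, metricForm e x (christoffelVec e x u w) (EuclideanSpace.single r 1) =
      (1 / 2) * (D u w (EuclideanSpace.single r 1) + D w u (EuclideanSpace.single r 1)
        - D (EuclideanSpace.single r 1) u w) := by
    intro r
    have e1 : D u w (EuclideanSpace.single r 1) =
        ∑ i, ∑ j, u i * w j * pd i (metric e r j) x := by
      rw [map_eq_sum₃ D u]
      refine Finset.sum_congr rfl fun i _ ↦ ?_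
      rw [map_eq_sum (D _) w]
      simp only [_root_.sum_apply, _root_.smul_apply, smul_eq_mul, Finset.mul_sum]
      refine Finset.sum_congr rfl fun j _ ↦ ?_
      rw [pd_metric he hx, fderiv_metricForm_comm he hx]; ring
    have e2 : D w u (EuclideanSpace.single r 1) =
        ∑ i, ∑ j, u i * w j * pd j (metric e i r) x := by
      rw [Finset.sum_comm, map_eq_sum₃ D w]
      refine Finset.sum_congr rfl fun j _ ↦ ?_
      rw [map_eq_sum (D _) u]
      simp only [_root_.sum_apply, _root_.smul_apply, smul_eq_mul, Finset.mul_sum]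
      refine Finset.sum_congr rfl fun i _ ↦ ?_
      rw [pd_metric he hx]; ring
    have e3 : D (EuclideanSpace.single r 1) u w =
        ∑ i, ∑ j, u i * w j * pd r (metric e i j) x := by
      rw [map_eq_sum (D _) u]
      simp only [_root_.sum_apply, _root_.smul_apply, smul_eq_mul]
      refine Finset.sum_congr rfl fun i _ ↦ ?_
      rw [map_eq_sum _ w]
      simp only [smul_eq_mul, Finset.mul_sum]
      refine Finset.sum_congr rfl fun j _ ↦ ?_
      rw [pd_metric he hx]; ring
    rw [e1, e2, e3, ← lower_eq, lower, ← Finset.sum_add_distrib, ← Finset.sum_sub_distrib,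
      Finset.mul_sum]
    simp only [christoffelVec, Finset.mul_sum]
    rw [Finset.sum_comm]
    refine Finset.sum_congr rfl fun i _ ↦ ?_
    rw [Finset.sum_comm, ← Finset.sum_add_distrib, ← Finset.sum_sub_distrib, Finset.mul_sum]
    refine Finset.sum_congr rfl fun j _ ↦ ?_
    have h : ∀ k, metric e r k x * (christoffel e k i j x * u i * w j) =
        (u i * w j) * (metric e r k x * christoffel e k i j x) := fun k ↦ by ring
    simp only [h, ← Finset.mul_sum, lower_christoffel he hx]
    ring
  rw [map_eq_sum _ z]
  simp only [key]
  rw [map_eq_sum (D u w) z, map_eq_sum (D w u) z, map_eq_sum₃ D z]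
  simp only [smul_eq_mul]
  rw [← Finset.sum_add_distrib, ← Finset.sum_sub_distrib, Finset.mul_sum]
  exact Finset.sum_congr rfl fun r _ ↦ by ring

lemma christoffelVec_comm (he : e ∈ atlas (Coord n) M) {x : Coord n} (hx : x ∈ e.target)
    (u w : Coord n) : christoffelVec e x u w = christoffelVec e x w u := by
  refine metricForm_ext he hx fun z ↦ ?_
  rw [metricForm_christoffelVec he hx, metricForm_christoffelVec he hx,
    fderiv_metricForm_comm he hx z u w]
  ring

end Smooth

end Invariant
end Newtonian

/-! ### The weak normality equations in invariant form -/

namespace Newtonian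

lemma isOpen_phase {n : ℕ} {M : Type*} [TopologicalSpace M]
    (e : OpenPartialHomeomorph M (Coord n)) : IsOpen (e.target ×ˢ {v : Coord n | v ≠ 0}) :=
  e.open_target.prod isOpen_ne

lemma linearMap_eq_sum {n : ℕ} (A : Coord n →ₗ[ℝ] ℝ) (u : Coord n) :
    A u = ∑ i, u i * A (EuclideanSpace.single i 1) := by
  conv_lhs => rw [← sum_smul_single u]
  simp

section WeakNormality

variable {n : ℕ} {M : Type*} [TopologicalSpace M] [ChartedSpace (Coord n) M]

variable [Bundle.RiemannianBundle (fun p : M ↦ TangentSpace (𝓡 n) p)]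

/-- The covector whose restriction to `v^⊥` is the first weak normality expression, times `|v|`. -/
def normalityForm₁ (F : ForceField n M) (e : OpenPartialHomeomorph M (Coord n)) (x v z : Coord n) :
    ℝ :=
  2 * forceForm F e (x, v) z + fderiv ℝ (forceForm F e) (x, v) (0, z) v

/-- The factor `λ` for which `normalityForm₁ = λ g(v, ·)` under the first weak normality equation. -/
def normalityFactor (F : ForceField n M) (e : OpenPartialHomeomorph M (Coord n)) (x v : Coord n) :
    ℝ :=
  normalityForm₁ F e x v v / metricForm e x v v

/-- The coordinate acceleration `Fᵏ - ∑ Γᵏ_{ij} vⁱ vʲ` of the Newtonian dynamical system. -/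
def acceleration (F : ForceField n M) (e : OpenPartialHomeomorph M (Coord n)) (x v : Coord n) :
    Coord n :=
  forceUp F e x v - christoffelVec e x v v

/-- The coefficient of the variation in the second derivative of its pairing with the velocity. -/
def variationForm (F : ForceField n M) (e : OpenPartialHomeomorph M (Coord n)) (x v z : Coord n) :
    ℝ :=
  fderiv ℝ (forceForm F e) (x, v) (z, 0) v + fderiv ℝ (forceForm F e) (x, v) (v, 0) z
    + fderiv ℝ (forceForm F e) (x, v) (0, acceleration F e x v) z

/-- The covector whose restriction to `v^⊥` is the second weak normality expression, times `|v|`. -/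
def normalityForm₂ (F : ForceField n M) (e : OpenPartialHomeomorph M (Coord n)) (x v z : Coord n) :
    ℝ :=
  variationForm F e x v z - normalityForm₁ F e x v (christoffelVec e x v z)
    - normalityFactor F e x v * forceForm F e (x, v) z

/-- The invariant form of the spatial gradient of the force covector. -/
def spatialForm (F : ForceField n M) (e : OpenPartialHomeomorph M (Coord n)) (x v u w : Coord n) :
    ℝ :=
  fderiv ℝ (forceForm F e) (x, v) (u, 0) w
    - fderiv ℝ (forceForm F e) (x, v) (0, christoffelVec e x u v) w
    - forceForm F e (x, v) (christoffelVec e x u w)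

lemma christoffelVec_single_left (e : OpenPartialHomeomorph M (Coord n)) (x w : Coord n)
    (i k : Fin n) : christoffelVec e x (EuclideanSpace.single i 1) w k =
      ∑ j, christoffel e k i j x * w j := by
  simp only [christoffelVec, PiLp.single_apply]
  rw [Finset.sum_eq_single i (fun b _ hb ↦ by simp [hb]) (by simp)]
  simp

lemma christoffelVec_add_left (e : OpenPartialHomeomorph M (Coord n)) (x u u' w : Coord n) :
    christoffelVec e x (u + u') w = christoffelVec e x u w + christoffelVec e x u' w := by
  ext k
  simp only [christoffelVec, PiLp.add_apply, mul_add, add_mul, Finset.sum_add_distrib]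

lemma christoffelVec_smul_left (e : OpenPartialHomeomorph M (Coord n)) (x u w : Coord n) (c : ℝ) :
    christoffelVec e x (c • u) w = c • christoffelVec e x u w := by
  ext k
  simp only [christoffelVec, PiLp.smul_apply, smul_eq_mul, Finset.mul_sum]
  exact Finset.sum_congr rfl fun i _ ↦ Finset.sum_congr rfl fun j _ ↦ by ring

lemma christoffelVec_add_right (e : OpenPartialHomeomorph M (Coord n)) (x u w w' : Coord n) :
    christoffelVec e x u (w + w') = christoffelVec e x u w + christoffelVec e x u w' := by
  ext k
  simp only [christoffelVec, PiLp.add_apply, mul_add, Finset.sum_add_distrib]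

lemma christoffelVec_smul_right (e : OpenPartialHomeomorph M (Coord n)) (x u w : Coord n) (c : ℝ) :
    christoffelVec e x u (c • w) = c • christoffelVec e x u w := by
  ext k
  simp only [christoffelVec, PiLp.smul_apply, smul_eq_mul, Finset.mul_sum]
  exact Finset.sum_congr rfl fun i _ ↦ Finset.sum_congr rfl fun j _ ↦ by ring

/-- Contracting a functional with the projector `P` detects its restriction to `v^⊥`. -/
lemma forall_sum_proj_eq_zero_iff [IsManifold (𝓡 n) ∞ M] {e : OpenPartialHomeomorph M (Coord n)}
    (he : e ∈ atlas (Coord n) M) {x v : Coord n} (hx : x ∈ e.target) (hv : v ≠ 0)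
    (X : Coord n →ₗ[ℝ] ℝ) :
    (∀ k, ∑ i, X (EuclideanSpace.single i 1) * proj e x v i k = 0) ↔
      ∀ z, metricForm e x v z = 0 → X z = 0 := by
  have hs : 0 < metricForm e x v v := metricForm_pos he hx hv
  set N := unitUp e x v with hN
  have hNv : N = (speed e x v)⁻¹ • v := rfl
  -- Contraction with the k-th column of P evaluates X on the orthogonal projection of the k-th
  -- basis vector to v^⊥.
  have key : ∀ k, ∑ i, X (EuclideanSpace.single i 1) * proj e x v i k =
      X (EuclideanSpace.single k 1 - metricForm e x N (EuclideanSpace.single k 1) • N) := by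
    intro k
    have h1 : X N = ∑ i, N i * X (EuclideanSpace.single i 1) := by
      conv_lhs => rw [← sum_smul_single N]
      simp
    rw [map_sub, map_smul, h1]
    simp only [proj, mul_sub, Finset.sum_sub_distrib, ← hN, lower_eq, smul_eq_mul, Finset.mul_sum]
    congr 1
    · simp
    · exact Finset.sum_congr rfl fun i _ ↦ by ring
  have hNz : ∀ z, metricForm e x N z = (speed e x v)⁻¹ * metricForm e x v z := by
    intro z; rw [hNv, map_smul]; rfl
  constructor
  · intro h z hz
    have h2 : X z = metricForm e x N z * X N := by
      conv_lhs => rw [← sum_smul_single z]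
      rw [map_eq_sum (metricForm e x N) z, map_sum, Finset.sum_mul]
      refine Finset.sum_congr rfl fun k _ ↦ ?_
      have h3 := h k
      rw [key, map_sub, map_smul, sub_eq_zero, smul_eq_mul] at h3
      rw [map_smul, h3, smul_eq_mul, smul_eq_mul, mul_assoc]
    rw [h2, hNz, hz]; simp
  · intro h k
    rw [key]
    apply h
    rw [map_sub, map_smul, hNz, hNv, map_smul, speed_eq, smul_eq_mul, smul_eq_mul]
    have : √(metricForm e x v v) ≠ 0 := (Real.sqrt_pos.2 hs).ne'
    field_simp
    rw [Real.sq_sqrt hs.le]; ring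

variable {F : ForceField n M} {e : OpenPartialHomeomorph M (Coord n)}

lemma fderiv_forceForm_add_snd (u w : Coord n) (z : Coord n × Coord n) :
    fderiv ℝ (forceForm F e) z (0, u + w) =
      fderiv ℝ (forceForm F e) z (0, u) + fderiv ℝ (forceForm F e) z (0, w) := by
  rw [← map_add]; simp

lemma fderiv_forceForm_smul_snd (c : ℝ) (u : Coord n) (z : Coord n × Coord n) :
    fderiv ℝ (forceForm F e) z (0, c • u) = c • fderiv ℝ (forceForm F e) z (0, u) := by
  rw [← map_smul]; simp

lemma fderiv_forceForm_add_fst (u w : Coord n) (z : Coord n × Coord n) :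
    fderiv ℝ (forceForm F e) z (u + w, 0) =
      fderiv ℝ (forceForm F e) z (u, 0) + fderiv ℝ (forceForm F e) z (w, 0) := by
  rw [← map_add]; simp

lemma fderiv_forceForm_smul_fst (c : ℝ) (u : Coord n) (z : Coord n × Coord n) :
    fderiv ℝ (forceForm F e) z (c • u, 0) = c • fderiv ℝ (forceForm F e) z (u, 0) := by
  rw [← map_smul]; simp

/-- `spatialForm` as a bilinear form. -/
def spatialBilin (F : ForceField n M) (e : OpenPartialHomeomorph M (Coord n)) (x v : Coord n) :
    Coord n →ₗ[ℝ] Coord n →ₗ[ℝ] ℝ :=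
  LinearMap.mk₂ ℝ (spatialForm F e x v)
    (fun u u' w ↦ by
      simp only [spatialForm, christoffelVec_add_left, fderiv_forceForm_add_fst,
        fderiv_forceForm_add_snd, map_add, _root_.add_apply]
      ring)
    (fun c u w ↦ by
      simp only [spatialForm, christoffelVec_smul_left, fderiv_forceForm_smul_fst,
        fderiv_forceForm_smul_snd, map_smul, _root_.smul_apply, smul_eq_mul]
      ring)
    (fun u w w' ↦ by
      simp only [spatialForm, christoffelVec_add_right, map_add]
      ring)
    (fun c u w ↦ by
      simp only [spatialForm, christoffelVec_smul_right, map_smul, smul_eq_mul]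
      ring)

/-- The second weak normality expression as a linear functional, before projecting. -/
def normalityLin₂ (F : ForceField n M) (e : OpenPartialHomeomorph M (Coord n)) (x v : Coord n) :
    Coord n →ₗ[ℝ] ℝ :=
  (spatialBilin F e x v).flip v + spatialBilin F e x v v
    + (fderiv ℝ (forceForm F e) (x, v) (0, forceUp F e x v) : Coord n →ₗ[ℝ] ℝ)
    - normalityFactor F e x v • (forceForm F e (x, v) : Coord n →ₗ[ℝ] ℝ)

section Smooth

variable [IsManifold (𝓡 n) ∞ M]
  [IsContMDiffRiemannianBundle (𝓡 n) ∞ (Coord n) (fun p : M ↦ TangentSpace (𝓡 n) p)]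

lemma contDiffOn_forceForm (hF : F.IsSmooth) (he : e ∈ atlas (Coord n) M) :
    ContDiffOn ℝ ∞ (forceForm F e) (e.target ×ˢ {v | v ≠ 0}) :=
  (((contDiffOn_metricForm he).comp contDiff_fst.contDiffOn fun _ hz ↦ hz.1).clm_apply
    (contDiffOn_forceUp hF he))

lemma hasFDerivAt_forceForm (hF : F.IsSmooth) (he : e ∈ atlas (Coord n) M) {x v : Coord n}
    (hx : x ∈ e.target) (hv : v ≠ 0) :
    HasFDerivAt (forceForm F e) (fderiv ℝ (forceForm F e) (x, v)) (x, v) :=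
  (((contDiffOn_forceForm hF he).contDiffAt
    ((isOpen_phase e).mem_nhds (Set.mk_mem_prod hx hv))).differentiableAt (by simp)).hasFDerivAt

lemma velGrad_forceDown (hF : F.IsSmooth) (he : e ∈ atlas (Coord n) M) {x v : Coord n}
    (hx : x ∈ e.target) (hv : v ≠ 0) (i j : Fin n) :
    velGrad i (forceDown F e j) x v = fderiv ℝ (forceForm F e) (x, v)
      (0, EuclideanSpace.single i 1) (EuclideanSpace.single j 1) := by
  have h := (((hasFDerivAt_forceForm hF he hx hv).comp v (hasFDerivAt_prodMk_right x v)).clm_apply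
    (hasFDerivAt_const (EuclideanSpace.single j (1 : ℝ) : Coord n) v)).fderiv
  simp only [velGrad, pd, forceDown_eq]
  refine (DFunLike.congr_fun h _).trans ?_
  simp

lemma pd_forceDown (hF : F.IsSmooth) (he : e ∈ atlas (Coord n) M) {x v : Coord n}
    (hx : x ∈ e.target) (hv : v ≠ 0) (i j : Fin n) :
    pd i (fun y ↦ forceDown F e j y v) x = fderiv ℝ (forceForm F e) (x, v)
      (EuclideanSpace.single i 1, 0) (EuclideanSpace.single j 1) := by
  have h := ((HasFDerivAt.comp (g := forceForm F e) (f := fun y ↦ (y, v)) x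
    (hasFDerivAt_forceForm hF he hx hv) (hasFDerivAt_prodMk_left x v)).clm_apply
    (hasFDerivAt_const (EuclideanSpace.single j (1 : ℝ) : Coord n) x)).fderiv
  simp only [pd, forceDown_eq]
  refine (DFunLike.congr_fun h _).trans ?_
  simp

lemma spatialGrad_eq (hF : F.IsSmooth) (he : e ∈ atlas (Coord n) M) {x v : Coord n}
    (hx : x ∈ e.target) (hv : v ≠ 0) (i j : Fin n) :
    spatialGrad F e i j x v =
      spatialForm F e x v (EuclideanSpace.single i 1) (EuclideanSpace.single j 1) := by
  rw [spatialGrad, spatialForm, pd_forceDown hF he hx hv]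
  congr 1
  · congr 1
    have h : fderiv ℝ (forceForm F e) (x, v)
        (0, christoffelVec e x (EuclideanSpace.single i 1) v) (EuclideanSpace.single j 1) =
        (((fderiv ℝ (forceForm F e) (x, v)).comp (.inr ℝ (Coord n) (Coord n))).flip
          (EuclideanSpace.single j 1)) (christoffelVec e x (EuclideanSpace.single i 1) v) := by
      simp
    rw [h, map_eq_sum, Finset.sum_comm]
    refine Finset.sum_congr rfl fun b _ ↦ ?_
    rw [christoffelVec_single_left, smul_eq_mul, Finset.sum_mul]
    refine Finset.sum_congr rfl fun a _ ↦ ?_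
    rw [velGrad_forceDown hF he hx hv]
    simp only [ContinuousLinearMap.flip_apply, ContinuousLinearMap.comp_apply,
      ContinuousLinearMap.inr_apply]
    ring
  · rw [map_eq_sum]
    refine Finset.sum_congr rfl fun a _ ↦ ?_
    rw [forceDown_eq, christoffelVec_single_left]
    simp

/-- The Christoffel parts of the acceleration and of `normalityForm₁ (Γ(v, z))` are exactly the
corrections that turn the partial derivatives of F in the directions z and v into covariant ones.
Symmetry of Γ is needed. -/
lemma normalityForm₂_eq (he : e ∈ atlas (Coord n) M) {x : Coord n} (hx : x ∈ e.target)
    (v z : Coord n) : normalityForm₂ F e x v z =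
      spatialForm F e x v z v + spatialForm F e x v v z
        + fderiv ℝ (forceForm F e) (x, v) (0, forceUp F e x v) z
        - normalityFactor F e x v * forceForm F e (x, v) z := by
  have h : fderiv ℝ (forceForm F e) (x, v) (0, acceleration F e x v) =
      fderiv ℝ (forceForm F e) (x, v) (0, forceUp F e x v) -
        fderiv ℝ (forceForm F e) (x, v) (0, christoffelVec e x v v) := by
    rw [← map_sub]; simp [acceleration]
  simp only [normalityForm₂, variationForm, spatialForm, normalityForm₁, h, _root_.sub_apply]
  rw [christoffelVec_comm he hx z v]
  ring

lemma normalityLin₂_apply (he : e ∈ atlas (Coord n) M) {x : Coord n} (hx : x ∈ e.target)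
    (v z : Coord n) : normalityLin₂ F e x v z = normalityForm₂ F e x v z :=
  (normalityForm₂_eq he hx v z).symm

/-- Only the direction of this differential matters: it is a multiple of g(v, ·), so it disappears
on v^⊥, and the factor can stay unspecified. -/
lemma hasFDerivAt_inv_sqrt_metricForm (he : e ∈ atlas (Coord n) M) {x v : Coord n}
    (hx : x ∈ e.target) (hv : v ≠ 0) :
    ∃ c : ℝ, HasFDerivAt (fun w ↦ (√(metricForm e x w w))⁻¹) (c • metricForm e x v) v := by
  have hs : 0 < metricForm e x v v := metricForm_pos he hx hv
  have h1 : HasFDerivAt (fun w ↦ metricForm e x w w) ((2 : ℝ) • metricForm e x v) v := by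
    refine ((metricForm e x).hasFDerivAt.clm_apply (hasFDerivAt_id v)).congr_fderiv ?_
    ext z
    simp [metricForm_comm e x z v]
    ring
  have h2 := (hasDerivAt_inv (Real.sqrt_pos.2 hs).ne').comp_hasFDerivAt v (h1.sqrt hs.ne')
  refine ⟨-(√(metricForm e x v v) ^ 2)⁻¹ * (1 / (2 * √(metricForm e x v v)) * 2),
    h2.congr_fderiv ?_⟩
  rw [smul_smul, smul_smul, mul_assoc]

/-- On v^⊥ the normalizing factor 1/|w| acts as a constant, so only F(x, w)(w) is differentiated.
The product rule yields a term F(z), which together with the explicit F(z)/|v| of the first equation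
makes the factor 2 in `normalityForm₁`. -/
lemma fderiv_forceForm_unitUp (hF : F.IsSmooth) (he : e ∈ atlas (Coord n) M) {x v : Coord n}
    (hx : x ∈ e.target) (hv : v ≠ 0) {z : Coord n} (hz : metricForm e x v z = 0) :
    fderiv ℝ (fun w ↦ ∑ j, unitUp e x w j * forceDown F e j x w) v z =
      (speed e x v)⁻¹ * (fderiv ℝ (forceForm F e) (x, v) (0, z) v + forceForm F e (x, v) z) := by
  obtain ⟨c, hc⟩ := hasFDerivAt_inv_sqrt_metricForm he hx hv
  have h0 : (fun w ↦ ∑ j, unitUp e x w j * forceDown F e j x w) =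
      fun w ↦ (√(metricForm e x w w))⁻¹ * forceForm F e (x, w) w := by
    funext w
    rw [map_eq_sum (forceForm F e (x, w)) w, Finset.mul_sum]
    refine Finset.sum_congr rfl fun j _ ↦ ?_
    rw [unitUp, speed_eq, forceDown_eq, PiLp.smul_apply, smul_eq_mul, smul_eq_mul, mul_assoc]
  have h1 := hc.mul (((hasFDerivAt_forceForm hF he hx hv).comp v
    (hasFDerivAt_prodMk_right x v)).clm_apply (hasFDerivAt_id v))
  rw [h0, speed_eq]
  refine (DFunLike.congr_fun h1.fderiv z).trans ?_
  simp [hz]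
  ring

/-- The two terms proportional to F_i carry the coefficients -2 F(v)/|v|³ and -(∂_v F · v)(v)/|v|³,
which add up to -λ/|v| with λ = `normalityFactor`. The rest is linear expansion in the basis. -/
lemma sum_normality₂ (hF : F.IsSmooth) (he : e ∈ atlas (Coord n) M) {x v : Coord n}
    (hx : x ∈ e.target) (hv : v ≠ 0) (i : Fin n) :
    ∑ j, (spatialGrad F e i j x v + spatialGrad F e j i x v
        - 2 * (speed e x v ^ 2)⁻¹ * forceDown F e i x v * forceDown F e j x v) * unitUp e x v j
      + ∑ j, (forceUp F e x v j * velGrad j (forceDown F e i) x v / speed e x v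
        - ∑ r, unitUp e x v r * unitUp e x v j * velGrad j (forceDown F e r) x v / speed e x v
          * forceDown F e i x v) =
      (speed e x v)⁻¹ * normalityLin₂ F e x v (EuclideanSpace.single i 1) := by
  have hs0 : 0 < metricForm e x v v := metricForm_pos he hx hv
  have hs : 0 < speed e x v := by rw [speed_eq]; exact Real.sqrt_pos.2 hs0
  have hsq : metricForm e x v v = speed e x v ^ 2 := by rw [speed_eq, Real.sq_sqrt hs0.le]
  set s := speed e x v with hs_def
  set b : Fin n → Coord n := fun i ↦ EuclideanSpace.single i 1
  set Θ := fderiv ℝ (forceForm F e) (x, v) with hΘ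
  have hN : ∀ j, unitUp e x v j = s⁻¹ * v j := fun j ↦ rfl
  have E1 : spatialForm F e x v (b i) v = ∑ j, v j * spatialForm F e x v (b i) (b j) :=
    linearMap_eq_sum (spatialBilin F e x v (b i)) v
  have E2 : spatialForm F e x v v (b i) = ∑ j, v j * spatialForm F e x v (b j) (b i) :=
    linearMap_eq_sum ((spatialBilin F e x v).flip (b i)) v
  have E3 : forceForm F e (x, v) v = ∑ j, v j * forceForm F e (x, v) (b j) := map_eq_sum _ v
  have E4 : ∀ u w : Coord n, Θ (0, u) w = ∑ j, u j * Θ (0, b j) w := by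
    intro u w
    have h : Θ (0, u) w = ((Θ.comp (.inr ℝ (Coord n) (Coord n))).flip w) u := by simp
    rw [h, map_eq_sum]
    simp [b]
  have E5 : Θ (0, v) v = ∑ j, ∑ r, v r * v j * Θ (0, b j) (b r) := by
    rw [E4]
    refine Finset.sum_congr rfl fun j _ ↦ ?_
    rw [map_eq_sum (Θ (0, b j)) v, Finset.mul_sum]
    exact Finset.sum_congr rfl fun r _ ↦ by rw [smul_eq_mul]; ring
  have R : normalityLin₂ F e x v (b i) = spatialForm F e x v (b i) v + spatialForm F e x v v (b i)
      + Θ (0, forceUp F e x v) (b i)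
      - (2 * forceForm F e (x, v) v + Θ (0, v) v) / s ^ 2 * forceForm F e (x, v) (b i) := by
    rw [← hsq]; rfl
  have S1 : ∑ j, (spatialGrad F e i j x v + spatialGrad F e j i x v
        - 2 * (s ^ 2)⁻¹ * forceDown F e i x v * forceDown F e j x v) * unitUp e x v j =
      s⁻¹ * (spatialForm F e x v (b i) v + spatialForm F e x v v (b i))
        - 2 * (s ^ 2)⁻¹ * s⁻¹ * forceForm F e (x, v) (b i) * forceForm F e (x, v) v := by
    rw [E1, E2, E3, ← Finset.sum_add_distrib, Finset.mul_sum, Finset.mul_sum,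
      ← Finset.sum_sub_distrib]
    refine Finset.sum_congr rfl fun j _ ↦ ?_
    rw [spatialGrad_eq hF he hx hv, spatialGrad_eq hF he hx hv, hN, forceDown_eq, forceDown_eq]
    ring
  have S2 : ∑ j, (forceUp F e x v j * velGrad j (forceDown F e i) x v / s
        - ∑ r, unitUp e x v r * unitUp e x v j * velGrad j (forceDown F e r) x v / s
          * forceDown F e i x v) =
      s⁻¹ * Θ (0, forceUp F e x v) (b i)
        - s⁻¹ * s⁻¹ * s⁻¹ * forceForm F e (x, v) (b i) * Θ (0, v) v := by
    rw [E4 (forceUp F e x v), E5, Finset.mul_sum, Finset.mul_sum, ← Finset.sum_sub_distrib]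
    refine Finset.sum_congr rfl fun j _ ↦ ?_
    rw [velGrad_forceDown hF he hx hv, Finset.mul_sum]
    congr 1
    · rw [div_eq_inv_mul]
    · refine Finset.sum_congr rfl fun r _ ↦ ?_
      rw [velGrad_forceDown hF he hx hv, hN, hN, forceDown_eq]
      ring
  rw [S1, S2, R]
  field_simp
  ring

/-- The weak normality equations in invariant form. -/
theorem weakNormality_iff (hF : F.IsSmooth) (he : e ∈ atlas (Coord n) M) {x v : Coord n}
    (hx : x ∈ e.target) (hv : v ≠ 0) :
    (∀ k, WeakNormalityAt F e x v k) ↔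
      (∀ z, metricForm e x v z = 0 → normalityForm₁ F e x v z = 0) ∧
      (∀ z, metricForm e x v z = 0 → normalityForm₂ F e x v z = 0) := by
  have hs0 : 0 < metricForm e x v v := metricForm_pos he hx hv
  have hs : 0 < speed e x v := by rw [speed_eq]; exact Real.sqrt_pos.2 hs0
  have hsq : speed e x v ^ 2 = metricForm e x v v := by rw [speed_eq, Real.sq_sqrt hs0.le]
  simp only [WeakNormalityAt, forall_and]
  refine and_congr ?_ ?_
  · have h := forall_sum_proj_eq_zero_iff he hx hv
      ((speed e x v)⁻¹ • (forceForm F e (x, v) : Coord n →ₗ[ℝ] ℝ) +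
        (fderiv ℝ (fun w ↦ ∑ j, unitUp e x w j * forceDown F e j x w) v : Coord n →ₗ[ℝ] ℝ))
    refine Iff.trans (Eq.to_iff ?_) (h.trans (forall₂_congr fun z hz ↦ ?_))
    · refine forall_congr fun k ↦ ?_
      congr 1
      refine Finset.sum_congr rfl fun i _ ↦ ?_
      rw [forceDown_eq]
      rfl
    · change (speed e x v)⁻¹ * forceForm F e (x, v) z + fderiv ℝ _ v z = 0 ↔ _
      rw [fderiv_forceForm_unitUp hF he hx hv hz, ← mul_add, mul_eq_zero, normalityForm₁]
      simp only [inv_eq_zero, hs.ne', false_or]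
      constructor <;> intro h <;> linarith
  · have h := forall_sum_proj_eq_zero_iff he hx hv ((speed e x v)⁻¹ • normalityLin₂ F e x v)
    refine Iff.trans (Eq.to_iff ?_) (h.trans (forall₂_congr fun z hz ↦ ?_))
    · refine forall_congr fun k ↦ ?_
      congr 1
      rw [← Finset.sum_add_distrib]
      refine Finset.sum_congr rfl fun i _ ↦ ?_
      change _ = (speed e x v)⁻¹ * normalityLin₂ F e x v (EuclideanSpace.single i 1) * _
      rw [← sum_normality₂ hF he hx hv, add_mul, Finset.sum_mul, Finset.sum_mul]
    · change (speed e x v)⁻¹ * normalityLin₂ F e x v z = 0 ↔ _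
      rw [normalityLin₂_apply he hx, mul_eq_zero]
      simp [hs.ne']

end Smooth

end WeakNormality
end Newtonian

/-! ### First and second time derivatives of the pairing -/

namespace Newtonian

section Partial

variable {D E : Type*} [NormedAddCommGroup D] [NormedSpace ℝ D]
  [NormedAddCommGroup E] [NormedSpace ℝ E] {Y : D → E} {Ω : Set D}

lemma contDiffOn_partial (hΩ : UniqueDiffOn ℝ Ω) (hY : ContDiffOn ℝ ∞ Y Ω) (a : D) :
    ContDiffOn ℝ ∞ (fun q ↦ fderivWithin ℝ Y Ω q a) Ω :=
  (hY.fderivWithin hΩ (m := ∞) (by simp)).clm_apply contDiffOn_const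

lemma hasFDerivWithinAt_of_contDiffOn (hY : ContDiffOn ℝ ∞ Y Ω) {p : D} (hp : p ∈ Ω) :
    HasFDerivWithinAt Y (fderivWithin ℝ Y Ω p) Ω p :=
  ((hY p hp).differentiableWithinAt (by simp)).hasFDerivWithinAt

/-- Ω is a strip that may contain its edge t = 0, where the Cauchy data are read; second derivatives
remain symmetric there because the interior of Ω accumulates at the edge. -/
lemma fderivWithin_partial_comm (hΩ : UniqueDiffOn ℝ Ω) (hcl : Ω ⊆ closure (interior Ω))
    (hY : ContDiffOn ℝ ∞ Y Ω) {p : D} (hp : p ∈ Ω) (a b : D) :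
    fderivWithin ℝ (fun q ↦ fderivWithin ℝ Y Ω q a) Ω p b =
      fderivWithin ℝ (fun q ↦ fderivWithin ℝ Y Ω q b) Ω p a := by
  have hs := (hY p hp).isSymmSndFDerivWithinAt
    (by simp only [minSmoothness_of_isRCLikeNormedField]; exact ENat.LEInfty.out) hΩ (hcl hp) hp
  have hd := hasFDerivWithinAt_of_contDiffOn (hY.fderivWithin hΩ (m := ∞) (by simp)) hp
  have h : ∀ a b, fderivWithin ℝ (fun q ↦ fderivWithin ℝ Y Ω q a) Ω p b =
      fderivWithin ℝ (fderivWithin ℝ Y Ω) Ω p b a := by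
    intro a b
    have := (hd.clm_apply (hasFDerivWithinAt_const a p Ω)).fderivWithin (hΩ p hp)
    rw [this]; simp
  rw [h, h]
  exact hs b a

end Partial

lemma fderiv_forceForm_pair {n : ℕ} {M : Type*} [TopologicalSpace M] [ChartedSpace (Coord n) M]
    [Bundle.RiemannianBundle (fun p : M ↦ TangentSpace (𝓡 n) p)]
    {e : OpenPartialHomeomorph M (Coord n)} {F : ForceField n M} (p : Coord n × Coord n) (u w : Coord n) :
    fderiv ℝ (forceForm F e) p (u, w) =
      fderiv ℝ (forceForm F e) p (u, 0) + fderiv ℝ (forceForm F e) p (0, w) := by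
  rw [← map_add]; simp

section Variation

variable {n : ℕ} {M : Type*} [TopologicalSpace M] [ChartedSpace (Coord n) M]
  [IsManifold (𝓡 n) ∞ M] [Bundle.RiemannianBundle (fun p : M ↦ TangentSpace (𝓡 n) p)]
  [IsContMDiffRiemannianBundle (𝓡 n) ∞ (Coord n) (fun p : M ↦ TangentSpace (𝓡 n) p)]
  {e : OpenPartialHomeomorph M (Coord n)} {F : ForceField n M}

lemma hasFDerivWithinAt_metricForm_comp {D : Type*} [NormedAddCommGroup D] [NormedSpace ℝ D]
    (he : e ∈ atlas (Coord n) M) {Ω : Set D} {p : D}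
    {Y U W : D → Coord n} {Y' U' W' : D →L[ℝ] Coord n} (hYp : Y p ∈ e.target)
    (hY : HasFDerivWithinAt Y Y' Ω p) (hU : HasFDerivWithinAt U U' Ω p)
    (hW : HasFDerivWithinAt W W' Ω p) :
    ∃ A : D →L[ℝ] ℝ, HasFDerivWithinAt (fun q ↦ metricForm e (Y q) (U q) (W q)) A Ω p ∧
      ∀ a, A a = fderiv ℝ (metricForm e) (Y p) (Y' a) (U p) (W p)
        + metricForm e (Y p) (U' a) (W p) + metricForm e (Y p) (U p) (W' a) := by
  have h0 : HasFDerivWithinAt (fun q ↦ metricForm e (Y q))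
      ((fderiv ℝ (metricForm e) (Y p)).comp Y') Ω p :=
    HasFDerivAt.comp_hasFDerivWithinAt (g := metricForm e) (f := Y) p
      (hasFDerivAt_metricForm he hYp) hY
  have h1 := h0.clm_apply hU
  refine ⟨_, h1.clm_apply hW, fun a ↦ ?_⟩
  simp
  ring

lemma hasFDerivWithinAt_forceForm_comp {D : Type*} [NormedAddCommGroup D] [NormedSpace ℝ D]
    (hF : F.IsSmooth) (he : e ∈ atlas (Coord n) M) {Ω : Set D} {p : D}
    {Y U W : D → Coord n} {Y' U' W' : D →L[ℝ] Coord n} (hYp : Y p ∈ e.target) (hUp : U p ≠ 0)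
    (hY : HasFDerivWithinAt Y Y' Ω p) (hU : HasFDerivWithinAt U U' Ω p)
    (hW : HasFDerivWithinAt W W' Ω p) :
    ∃ A : D →L[ℝ] ℝ, HasFDerivWithinAt (fun q ↦ forceForm F e (Y q, U q) (W q)) A Ω p ∧
      ∀ a, A a = fderiv ℝ (forceForm F e) (Y p, U p) (Y' a, U' a) (W p)
        + forceForm F e (Y p, U p) (W' a) := by
  have h0 : HasFDerivWithinAt (fun q ↦ forceForm F e (Y q, U q))
      ((fderiv ℝ (forceForm F e) (Y p, U p)).comp (Y'.prod U')) Ω p :=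
    HasFDerivAt.comp_hasFDerivWithinAt (g := forceForm F e) (f := fun q ↦ (Y q, U q)) p
      (hasFDerivAt_forceForm hF he hYp hUp) (hY.prodMk hU)
  refine ⟨_, h0.clm_apply hW, fun a ↦ ?_⟩
  simp
  ring

lemma metricForm_acceleration (he : e ∈ atlas (Coord n) M) {x : Coord n} (hx : x ∈ e.target)
    (v z : Coord n) : metricForm e x (acceleration F e x v) z = forceForm F e (x, v) z
      - fderiv ℝ (metricForm e) x v v z + (1 / 2) * fderiv ℝ (metricForm e) x z v v := by
  rw [acceleration, map_sub, _root_.sub_apply, metricForm_christoffelVec he hx]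
  simp only [forceForm]
  ring

/-- Two Koszul terms cancel by symmetry of g. What remains is the part of the derivative of g(v,
v)/2 along z that comes from the metric. -/
lemma metricForm_christoffelVec_self (he : e ∈ atlas (Coord n) M) {x : Coord n}
    (hx : x ∈ e.target) (v z : Coord n) :
    metricForm e x v (christoffelVec e x v z) = (1 / 2) * fderiv ℝ (metricForm e) x z v v := by
  rw [metricForm_comm, metricForm_christoffelVec he hx, fderiv_metricForm_comm he hx v z v]
  ring

/-- The derivative of the pairing `g(v, τ)` of the velocity with a variation `τ` along a trajectory,
expressed through the coordinate derivative `τ'` of the variation. -/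
def pairingRate (F : ForceField n M) (e : OpenPartialHomeomorph M (Coord n))
    (x v τ τ' : Coord n) : ℝ :=
  forceForm F e (x, v) τ + metricForm e x v (τ' + christoffelVec e x v τ)

/-- Along a two-parameter family of trajectories, the pairing `φ` of the velocity with the variation
satisfies `φ' = pairingRate` and `φ'' = variationForm τ + normalityForm₁ τ'`. -/
theorem hasFDerivWithinAt_pairing (hF : F.IsSmooth) (he : e ∈ atlas (Coord n) M)
    {D : Type*} [NormedAddCommGroup D] [NormedSpace ℝ D] {Ω : Set D}
    (hΩ : UniqueDiffOn ℝ Ω) (hcl : Ω ⊆ closure (interior Ω)) {Y V τ τ' : D → Coord n} {a b : D}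
    (hY : ContDiffOn ℝ ∞ Y Ω) (hYt : ∀ q ∈ Ω, Y q ∈ e.target)
    (hV : ∀ q, V q = fderivWithin ℝ Y Ω q a) (hτ : ∀ q, τ q = fderivWithin ℝ Y Ω q b)
    (hτ' : ∀ q, τ' q = fderivWithin ℝ V Ω q b) (hV0 : ∀ q ∈ Ω, V q ≠ 0)
    (hacc : ∀ q ∈ Ω, fderivWithin ℝ V Ω q a = acceleration F e (Y q) (V q)) {p : D} (hp : p ∈ Ω) :
    (∃ A : D →L[ℝ] ℝ, HasFDerivWithinAt (fun q ↦ metricForm e (Y q) (V q) (τ q)) A Ω p ∧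
      A a = pairingRate F e (Y p) (V p) (τ p) (τ' p)) ∧
    (∃ A : D →L[ℝ] ℝ, HasFDerivWithinAt
        (fun q ↦ pairingRate F e (Y q) (V q) (τ q) (τ' q)) A Ω p ∧
      A a = variationForm F e (Y p) (V p) (τ p) + normalityForm₁ F e (Y p) (V p) (τ' p)) := by
  obtain rfl : V = fun q ↦ fderivWithin ℝ Y Ω q a := funext hV
  obtain rfl : τ = fun q ↦ fderivWithin ℝ Y Ω q b := funext hτ
  set V : D → Coord n := fun q ↦ fderivWithin ℝ Y Ω q a with hVdef
  set τ : D → Coord n := fun q ↦ fderivWithin ℝ Y Ω q b with hτdef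
  have hVc : ContDiffOn ℝ ∞ V Ω := contDiffOn_partial hΩ hY a
  have hτc : ContDiffOn ℝ ∞ τ Ω := contDiffOn_partial hΩ hY b
  have dY : ∀ q ∈ Ω, HasFDerivWithinAt Y (fderivWithin ℝ Y Ω q) Ω q :=
    fun q hq ↦ hasFDerivWithinAt_of_contDiffOn hY hq
  have dV : ∀ q ∈ Ω, HasFDerivWithinAt V (fderivWithin ℝ V Ω q) Ω q :=
    fun q hq ↦ hasFDerivWithinAt_of_contDiffOn hVc hq
  have dτ : ∀ q ∈ Ω, HasFDerivWithinAt τ (fderivWithin ℝ τ Ω q) Ω q :=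
    fun q hq ↦ hasFDerivWithinAt_of_contDiffOn hτc hq
  have hcomm : ∀ q ∈ Ω, fderivWithin ℝ τ Ω q a = τ' q := fun q hq ↦ by
    rw [hτ' q]; exact fderivWithin_partial_comm hΩ hcl hY hq b a
  -- The kinetic energy. Its derivative along b is the term g(V, τ' + Γ(V, τ)) of `pairingRate`, and
  -- its derivative along a is the power F(V). This spares differentiating the Christoffel symbols.
  set K : D → ℝ := fun q ↦ (1 / 2) * metricForm e (Y q) (V q) (V q) with hK
  have hKc : ContDiffOn ℝ ∞ K Ω :=
    contDiffOn_const.mul ((((contDiffOn_metricForm he).comp hY hYt).clm_apply hVc).clm_apply hVc)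
  have hKd : ∀ q ∈ Ω, ∀ w, fderivWithin ℝ K Ω q w =
      (1 / 2) * fderiv ℝ (metricForm e) (Y q) (fderivWithin ℝ Y Ω q w) (V q) (V q)
        + metricForm e (Y q) (V q) (fderivWithin ℝ V Ω q w) := by
    intro q hq w
    obtain ⟨A, hA, hA'⟩ := hasFDerivWithinAt_metricForm_comp he (hYt q hq) (dY q hq) (dV q hq)
      (dV q hq)
    rw [(hA.const_mul (1 / 2)).fderivWithin (hΩ q hq), _root_.smul_apply, hA',
      metricForm_comm e (Y q) (fderivWithin ℝ V Ω q w), smul_eq_mul]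
    ring
  have hKa : ∀ q ∈ Ω, fderivWithin ℝ K Ω q a = forceForm F e (Y q, V q) (V q) := by
    intro q hq
    rw [hKd q hq, hacc q hq, metricForm_comm, metricForm_acceleration he (hYt q hq)]
    simp only [hVdef]
    ring
  have hrate : ∀ q ∈ Ω, pairingRate F e (Y q) (V q) (τ q) (τ' q) =
      forceForm F e (Y q, V q) (τ q) + fderivWithin ℝ K Ω q b := by
    intro q hq
    rw [pairingRate, map_add, metricForm_christoffelVec_self he (hYt q hq), hKd q hq, hτ' q]
    ring
  refine ⟨?_, ?_⟩
  · obtain ⟨A, hA, hA'⟩ := hasFDerivWithinAt_metricForm_comp he (hYt p hp) (dY p hp) (dV p hp)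
      (dτ p hp)
    refine ⟨A, hA, ?_⟩
    rw [hA', hacc p hp, hcomm p hp, metricForm_acceleration he (hYt p hp), pairingRate, map_add,
      metricForm_christoffelVec_self he (hYt p hp)]
    simp only [hVdef]
    ring
  · obtain ⟨A, hA, hA'⟩ := hasFDerivWithinAt_forceForm_comp hF he (hYt p hp) (hV0 p hp) (dY p hp)
      (dV p hp) (dτ p hp)
    obtain ⟨B, hB, hB'⟩ := hasFDerivWithinAt_forceForm_comp hF he (hYt p hp) (hV0 p hp) (dY p hp)
      (dV p hp) (dV p hp)
    have hKb := hasFDerivWithinAt_of_contDiffOn (contDiffOn_partial hΩ hKc b) hp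
    refine ⟨_, (hA.add hKb).congr (fun q hq ↦ hrate q hq) (hrate p hp), ?_⟩
    -- The decisive exchange: the time derivative of ∂_b K is the b-derivative of the power.
    have hKab : fderivWithin ℝ (fun q ↦ fderivWithin ℝ K Ω q b) Ω p a = B b := by
      rw [fderivWithin_partial_comm hΩ hcl hKc hp b a,
        fderivWithin_congr (fun q hq ↦ hKa q hq) (hKa p hp), hB.fderivWithin (hΩ p hp)]
    rw [_root_.add_apply, hKab, hA', hB', hacc p hp, hcomm p hp, variationForm, normalityForm₁,
      fderiv_forceForm_pair, fderiv_forceForm_pair _ _ (fderivWithin ℝ V Ω p b), ← hτ' p]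
    simp only [hVdef, hτdef, _root_.add_apply]
    ring

end Variation
end Newtonian

/-! ### Regularity of the coefficients and the linear equation for the pairing -/

namespace Newtonian

lemma contDiffOn_fderiv_apply {E H P : Type*} [NormedAddCommGroup E] [NormedSpace ℝ E]
    [NormedAddCommGroup H] [NormedSpace ℝ H] [NormedAddCommGroup P] [NormedSpace ℝ P] {g : E → H}
    {s : Set E} {S : Set P} (hg : ContDiffOn ℝ ∞ g s) (hs : IsOpen s) {x u : P → E}
    (hx : ContDiffOn ℝ ∞ x S) (hu : ContDiffOn ℝ ∞ u S) (hxs : Set.MapsTo x S s) :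
    ContDiffOn ℝ ∞ (fun p ↦ fderiv ℝ g (x p) (u p)) S :=
  (ContDiffOn.comp (g := fderiv ℝ g) (f := x) (hg.fderiv_of_isOpen hs (by simp)) hx
    hxs).clm_apply hu

lemma continuousOn_fderiv_apply {E H P : Type*} [NormedAddCommGroup E] [NormedSpace ℝ E]
    [NormedAddCommGroup H] [NormedSpace ℝ H] [TopologicalSpace P] {g : E → H}
    {s : Set E} {S : Set P} (hg : ContDiffOn ℝ ∞ g s) (hs : IsOpen s) {x u : P → E}
    (hx : ContinuousOn x S) (hu : ContinuousOn u S) (hxs : Set.MapsTo x S s) :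
    ContinuousOn (fun p ↦ fderiv ℝ g (x p) (u p)) S :=
  (ContinuousOn.comp (g := fderiv ℝ g) (f := x) (hg.continuousOn_fderiv_of_isOpen hs (by simp)) hx
    hxs).clm_apply hu

section Regularity

variable {n : ℕ} {M : Type*} [TopologicalSpace M] [ChartedSpace (Coord n) M]
  [Bundle.RiemannianBundle (fun p : M ↦ TangentSpace (𝓡 n) p)]
  {e : OpenPartialHomeomorph M (Coord n)} {F : ForceField n M}

lemma isInvertible_metricForm [IsManifold (𝓡 n) ∞ M] (he : e ∈ atlas (Coord n) M) {x : Coord n}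
    (hx : x ∈ e.target) : (metricForm e x).IsInvertible := by
  have hinj : Function.Injective (metricForm e x).toLinearMap := fun u w h ↦
    metricForm_ext he hx fun z ↦ DFunLike.congr_fun h z
  have hdim : Module.finrank ℝ (Coord n) = Module.finrank ℝ (Coord n →L[ℝ] ℝ) := by
    rw [← (LinearMap.toContinuousLinearMap (𝕜 := ℝ) (E := Coord n) (F' := ℝ)).finrank_eq,
      Module.finrank_linearMap, Module.finrank_self, mul_one]
  refine ⟨(LinearEquiv.ofInjectiveOfFinrankEq (metricForm e x).toLinearMap hinj
    hdim).toContinuousLinearEquiv, ?_⟩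
  ext u
  rfl

lemma inverse_metricForm_apply [IsManifold (𝓡 n) ∞ M] (he : e ∈ atlas (Coord n) M) {x : Coord n}
    (hx : x ∈ e.target) (u : Coord n) : (metricForm e x).inverse (metricForm e x u) = u :=
  (isInvertible_metricForm he hx).inverse_apply_self u

variable [IsManifold (𝓡 n) ∞ M]
  [IsContMDiffRiemannianBundle (𝓡 n) ∞ (Coord n) (fun p : M ↦ TangentSpace (𝓡 n) p)]

lemma contDiffOn_inverse_metricForm (he : e ∈ atlas (Coord n) M) :
    ContDiffOn ℝ ∞ (fun x ↦ (metricForm e x).inverse) e.target := fun x hx ↦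
  ((isInvertible_metricForm he hx).contDiffAt_map_inverse.comp x
    ((contDiffOn_metricForm he).contDiffAt (e.open_target.mem_nhds hx))).contDiffWithinAt

/-- By Koszul's formula the covector g(Γ(u, w), ·) is smooth; applying the smooth inverse of g gives
Γ(u, w) itself. -/
lemma contDiffOn_christoffelVec (he : e ∈ atlas (Coord n) M) :
    ContDiffOn ℝ ∞ (fun y : Coord n × Coord n × Coord n ↦ christoffelVec e y.1 y.2.1 y.2.2)
      (e.target ×ˢ Set.univ) := by
  have hg : ContDiffOn ℝ ∞ (fun y : Coord n × Coord n × Coord n ↦ (metricForm e y.1).inverse)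
      (e.target ×ˢ Set.univ) :=
    (contDiffOn_inverse_metricForm he).comp contDiff_fst.contDiffOn fun _ hy ↦ hy.1
  have hu : ContDiffOn ℝ ∞ (fun y : Coord n × Coord n × Coord n ↦ y.2.1)
      (e.target ×ˢ Set.univ) := (contDiff_fst.comp contDiff_snd).contDiffOn
  have hw : ContDiffOn ℝ ∞ (fun y : Coord n × Coord n × Coord n ↦ y.2.2)
      (e.target ×ˢ Set.univ) := (contDiff_snd.comp contDiff_snd).contDiffOn
  have hK : ContDiffOn ℝ ∞ (fun y : Coord n × Coord n × Coord n ↦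
      metricForm e y.1 (christoffelVec e y.1 y.2.1 y.2.2)) (e.target ×ˢ Set.univ) := by
    rw [contDiffOn_clm_apply]
    intro z
    refine ContDiffOn.congr (f := fun y : Coord n × Coord n × Coord n ↦
      (1 / 2) * (fderiv ℝ (metricForm e) y.1 y.2.1 y.2.2 z
        + fderiv ℝ (metricForm e) y.1 y.2.2 y.2.1 z
        - fderiv ℝ (metricForm e) y.1 z y.2.1 y.2.2)) ?_
      fun y hy ↦ metricForm_christoffelVec he hy.1 y.2.1 y.2.2 z
    have hz : ContDiffOn ℝ ∞ (fun _ : Coord n × Coord n × Coord n ↦ z) (e.target ×ˢ Set.univ) :=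
      contDiffOn_const
    have hx : ContDiffOn ℝ ∞ (fun y : Coord n × Coord n × Coord n ↦ y.1)
      (e.target ×ˢ Set.univ) := contDiff_fst.contDiffOn
    have hD := contDiffOn_metricForm he
    have ht : Set.MapsTo (fun y : Coord n × Coord n × Coord n ↦ y.1) (e.target ×ˢ Set.univ)
      e.target := fun y hy ↦ hy.1
    have h {u w : Coord n × Coord n × Coord n → Coord n}
        (hu : ContDiffOn ℝ ∞ u (e.target ×ˢ Set.univ)) (hw : ContDiffOn ℝ ∞ w (e.target ×ˢ Set.univ)) :
        ContDiffOn ℝ ∞ (fun y ↦ fderiv ℝ (metricForm e) y.1 (u y) (w y)) (e.target ×ˢ Set.univ) :=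
      (contDiffOn_fderiv_apply hD e.open_target hx hu ht).clm_apply hw
    exact contDiffOn_const.mul ((((h hu hw).clm_apply hz).add
      ((h hw hu).clm_apply hz)).sub ((h hz hu).clm_apply hw))
  exact (hg.clm_apply hK).congr fun y hy ↦ (inverse_metricForm_apply he hy.1 _).symm

lemma contDiffOn_acceleration (hF : F.IsSmooth) (he : e ∈ atlas (Coord n) M) :
    ContDiffOn ℝ ∞ (fun z : Coord n × Coord n ↦ acceleration F e z.1 z.2)
      (e.target ×ˢ {v | v ≠ 0}) := by
  have h : ContDiffOn ℝ ∞ (fun z : Coord n × Coord n ↦ christoffelVec e z.1 z.2 z.2)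
      (e.target ×ˢ {v | v ≠ 0}) :=
    ContDiffOn.comp (g := fun y : Coord n × Coord n × Coord n ↦ christoffelVec e y.1 y.2.1 y.2.2)
      (f := fun z : Coord n × Coord n ↦ (z.1, z.2, z.2)) (contDiffOn_christoffelVec he)
      (contDiff_fst.prodMk (contDiff_snd.prodMk contDiff_snd)).contDiffOn
      fun z hz ↦ Set.mk_mem_prod hz.1 (Set.mem_univ _)
  exact (contDiffOn_forceUp hF he).sub h

variable {X : Type*} [TopologicalSpace X] {s : Set X} {x v z : X → Coord n}

lemma continuousOn_metricForm_comp (he : e ∈ atlas (Coord n) M) (hx : ContinuousOn x s)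
    (hv : ContinuousOn v s) (hz : ContinuousOn z s) (hxt : ∀ t ∈ s, x t ∈ e.target) :
    ContinuousOn (fun t ↦ metricForm e (x t) (v t) (z t)) s :=
  (((contDiffOn_metricForm he).continuousOn.comp hx hxt).clm_apply hv).clm_apply hz

lemma continuousOn_normalityForm₁ (hF : F.IsSmooth) (he : e ∈ atlas (Coord n) M)
    (hx : ContinuousOn x s) (hv : ContinuousOn v s) (hz : ContinuousOn z s)
    (hxt : ∀ t ∈ s, x t ∈ e.target) (hv0 : ∀ t ∈ s, v t ≠ 0) :
    ContinuousOn (fun t ↦ normalityForm₁ F e (x t) (v t) (z t)) s := by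
  have hm : ∀ t ∈ s, (x t, v t) ∈ e.target ×ˢ {v : Coord n | v ≠ 0} :=
    fun t ht ↦ Set.mk_mem_prod (hxt t ht) (hv0 t ht)
  have h1 := (contDiffOn_forceForm hF he).continuousOn.comp (hx.prodMk hv) hm
  have h2 := ((contDiffOn_forceForm hF he).continuousOn_fderiv_of_isOpen (isOpen_phase e)
    (by simp)).comp (hx.prodMk hv) hm
  exact (continuousOn_const.mul (h1.clm_apply hz)).add
    ((h2.clm_apply (continuousOn_const.prodMk hz)).clm_apply hv)

lemma continuousOn_normalityFactor (hF : F.IsSmooth) (he : e ∈ atlas (Coord n) M)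
    (hx : ContinuousOn x s) (hv : ContinuousOn v s)
    (hxt : ∀ t ∈ s, x t ∈ e.target) (hv0 : ∀ t ∈ s, v t ≠ 0) :
    ContinuousOn (fun t ↦ normalityFactor F e (x t) (v t)) s :=
  (continuousOn_normalityForm₁ hF he hx hv hv hxt hv0).div
    (continuousOn_metricForm_comp he hx hv hv hxt)
    fun t ht ↦ (metricForm_pos he (hxt t ht) (hv0 t ht)).ne'

lemma continuousOn_variationForm (hF : F.IsSmooth) (he : e ∈ atlas (Coord n) M)
    (hx : ContinuousOn x s) (hv : ContinuousOn v s) (hz : ContinuousOn z s)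
    (hxt : ∀ t ∈ s, x t ∈ e.target) (hv0 : ∀ t ∈ s, v t ≠ 0) :
    ContinuousOn (fun t ↦ variationForm F e (x t) (v t) (z t)) s := by
  have hm : ∀ t ∈ s, (x t, v t) ∈ e.target ×ˢ {v : Coord n | v ≠ 0} :=
    fun t ht ↦ Set.mk_mem_prod (hxt t ht) (hv0 t ht)
  have h3 : ContinuousOn (fun t ↦ acceleration F e (x t) (v t)) s :=
    ContinuousOn.comp (g := fun z : Coord n × Coord n ↦ acceleration F e z.1 z.2)
      (f := fun t ↦ (x t, v t)) (contDiffOn_acceleration hF he).continuousOn (hx.prodMk hv) hm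
  have h {z : X → Coord n × Coord n} (hz : ContinuousOn z s) :
      ContinuousOn (fun t ↦ fderiv ℝ (forceForm F e) (x t, v t) (z t)) s :=
    continuousOn_fderiv_apply (contDiffOn_forceForm hF he) (isOpen_phase e) (hx.prodMk hv) hz hm
  have t1 : ContinuousOn (fun t ↦ fderiv ℝ (forceForm F e) (x t, v t) (z t, 0) (v t)) s :=
    (h (hz.prodMk continuousOn_const)).clm_apply hv
  have t2 : ContinuousOn (fun t ↦ fderiv ℝ (forceForm F e) (x t, v t) (v t, 0) (z t)) s :=
    (h (hv.prodMk continuousOn_const)).clm_apply hz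
  have t3 : ContinuousOn (fun t ↦ fderiv ℝ (forceForm F e) (x t, v t)
      (0, acceleration F e (x t) (v t)) (z t)) s :=
    (h (continuousOn_const.prodMk h3)).clm_apply hz
  exact (t1.add t2).add t3

lemma continuousOn_normalityForm₂ (hF : F.IsSmooth) (he : e ∈ atlas (Coord n) M)
    (hx : ContinuousOn x s) (hv : ContinuousOn v s) (hz : ContinuousOn z s)
    (hxt : ∀ t ∈ s, x t ∈ e.target) (hv0 : ∀ t ∈ s, v t ≠ 0) :
    ContinuousOn (fun t ↦ normalityForm₂ F e (x t) (v t) (z t)) s := by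
  have hm : ∀ t ∈ s, (x t, v t) ∈ e.target ×ˢ {v : Coord n | v ≠ 0} :=
    fun t ht ↦ Set.mk_mem_prod (hxt t ht) (hv0 t ht)
  have h1 : ContinuousOn (fun t ↦ forceForm F e (x t, v t)) s :=
    ContinuousOn.comp (g := forceForm F e) (f := fun t ↦ (x t, v t))
      (contDiffOn_forceForm hF he).continuousOn (hx.prodMk hv) hm
  have h2 : ContinuousOn (fun t ↦ forceForm F e (x t, v t) (z t)) s := h1.clm_apply hz
  have h4 : ContinuousOn (fun t ↦ christoffelVec e (x t) (v t) (z t)) s :=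
    ContinuousOn.comp (g := fun y : Coord n × Coord n × Coord n ↦ christoffelVec e y.1 y.2.1 y.2.2)
      (f := fun t ↦ (x t, v t, z t)) (contDiffOn_christoffelVec he).continuousOn
      (hx.prodMk (hv.prodMk hz)) fun t ht ↦ Set.mk_mem_prod (hxt t ht) (Set.mem_univ _)
  exact ((continuousOn_variationForm hF he hx hv hz hxt hv0).sub
    (continuousOn_normalityForm₁ hF he hx hv h4 hxt hv0)).sub
    ((continuousOn_normalityFactor hF he hx hv hxt hv0).mul h2)

end Regularity

section Algebra

variable {n : ℕ} {M : Type*} [TopologicalSpace M] [ChartedSpace (Coord n) M]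
  [Bundle.RiemannianBundle (fun p : M ↦ TangentSpace (𝓡 n) p)]
  {e : OpenPartialHomeomorph M (Coord n)} {F : ForceField n M}

/-- `normalityForm₁` as a linear functional. -/
def normalityLin₁ (F : ForceField n M) (e : OpenPartialHomeomorph M (Coord n)) (x v : Coord n) :
    Coord n →ₗ[ℝ] ℝ where
  toFun := normalityForm₁ F e x v
  map_add' u w := by
    simp only [normalityForm₁, map_add, fderiv_forceForm_add_snd, _root_.add_apply]; ring
  map_smul' c u := by
    simp only [normalityForm₁, map_smul, fderiv_forceForm_smul_snd, _root_.smul_apply, smul_eq_mul,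
      RingHom.id_apply]; ring

variable [IsManifold (𝓡 n) ∞ M]

/-- Apply the hypothesis to the part of z orthogonal to v. Each weak normality equation thereby
becomes a coefficient, λ or μ, of the linear equation for φ. -/
lemma eq_mul_metricForm (he : e ∈ atlas (Coord n) M) {x v : Coord n} (hx : x ∈ e.target)
    (hv : v ≠ 0) (A : Coord n →ₗ[ℝ] ℝ) (h : ∀ z, metricForm e x v z = 0 → A z = 0) (z : Coord n) :
    A z = A v / metricForm e x v v * metricForm e x v z := by
  have hs : metricForm e x v v ≠ 0 := (metricForm_pos he hx hv).ne'
  have h1 := h (z - (metricForm e x v z / metricForm e x v v) • v) (by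
    rw [map_sub, map_smul, smul_eq_mul, div_mul_cancel₀ _ hs, sub_self])
  rw [map_sub, map_smul, smul_eq_mul, sub_eq_zero] at h1
  rw [h1]; ring

lemma normalityForm₁_eq (he : e ∈ atlas (Coord n) M) {x v : Coord n} (hx : x ∈ e.target)
    (hv : v ≠ 0) (h : ∀ z, metricForm e x v z = 0 → normalityForm₁ F e x v z = 0) (z : Coord n) :
    normalityForm₁ F e x v z = normalityFactor F e x v * metricForm e x v z :=
  eq_mul_metricForm he hx hv (normalityLin₁ F e x v) h z

/-- Under the first weak normality equation the second derivative of the pairing is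
`normalityForm₂ τ + λ φ'`. -/
lemma variation_eq_of_normality₁ (he : e ∈ atlas (Coord n) M) {x v : Coord n} (hx : x ∈ e.target)
    (hv : v ≠ 0) (h : ∀ z, metricForm e x v z = 0 → normalityForm₁ F e x v z = 0)
    (τ τ' : Coord n) :
    variationForm F e x v τ + normalityForm₁ F e x v τ' =
      normalityForm₂ F e x v τ + normalityFactor F e x v * pairingRate F e x v τ τ' := by
  rw [normalityForm₂, pairingRate, normalityForm₁_eq he hx hv h, normalityForm₁_eq he hx hv h,
    map_add]
  ring

lemma normalityForm₂_eq_mul [IsContMDiffRiemannianBundle (𝓡 n) ∞ (Coord n)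
      (fun p : M ↦ TangentSpace (𝓡 n) p)] (he : e ∈ atlas (Coord n) M) {x v : Coord n}
    (hx : x ∈ e.target) (hv : v ≠ 0)
    (h : ∀ z, metricForm e x v z = 0 → normalityForm₂ F e x v z = 0) (z : Coord n) :
    normalityForm₂ F e x v z =
      normalityForm₂ F e x v v / metricForm e x v v * metricForm e x v z := by
  simp only [← normalityLin₂_apply he hx] at h ⊢
  exact eq_mul_metricForm he hx hv _ h z

end Algebra

/-- A solution of a second order linear equation with vanishing Cauchy data vanishes. -/
lemma eq_zero_of_linear_ode {J : Set ℝ} (hJ : J.OrdConnected) {φ ψ a b : ℝ → ℝ}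
    (hφ : ∀ t ∈ J, HasDerivWithinAt φ (ψ t) J t)
    (hψ : ∀ t ∈ J, HasDerivWithinAt ψ (a t * φ t + b t * ψ t) J t)
    (ha : ContinuousOn a J) (hb : ContinuousOn b J) {t₀ : ℝ} (ht₀ : t₀ ∈ J) (hφ0 : φ t₀ = 0)
    (hψ0 : ψ t₀ = 0) {t : ℝ} (ht : t ∈ J) : φ t = 0 ∧ ψ t = 0 := by
  set K := Set.uIcc t₀ t with hK
  have hKJ : K ⊆ J := hJ.uIcc_subset ht₀ ht
  obtain ⟨A, hA⟩ := isCompact_uIcc.exists_bound_of_continuousOn (ha.mono hKJ)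
  obtain ⟨B, hB⟩ := isCompact_uIcc.exists_bound_of_continuousOn (hb.mono hKJ)
  -- For N = φ² + ψ², the bounds 2|φψ| ≤ N and 2ψ² ≤ 2N give |N'| ≤ C N.
  set C := 1 + A + 2 * B with hC
  set N : ℝ → ℝ := fun s ↦ φ s ^ 2 + ψ s ^ 2 with hN
  have hNd : ∀ s ∈ K, ∀ c : ℝ, HasDerivWithinAt (fun s ↦ N s * Real.exp (c * s))
      ((2 * φ s * ψ s + 2 * ψ s * (a s * φ s + b s * ψ s)) * Real.exp (c * s)
        + N s * (Real.exp (c * s) * c)) K s := by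
    intro s hs c
    have h1 := (((hφ s (hKJ hs)).pow 2).add ((hψ s (hKJ hs)).pow 2)).mono hKJ
    have h2 : HasDerivWithinAt (fun s ↦ Real.exp (c * s)) (Real.exp (c * s) * c) K s := by
      simpa using (((hasDerivAt_id s).const_mul c).exp).hasDerivWithinAt
    refine (h1.mul h2).congr_deriv ?_
    simp [hN]
  have hbound : ∀ s ∈ K,
      |2 * φ s * ψ s + 2 * ψ s * (a s * φ s + b s * ψ s)| ≤ C * N s := by
    intro s hs
    have hAs : |a s| ≤ A := hA s hs
    have hBs : |b s| ≤ B := hB s hs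
    have h1 : |2 * φ s * ψ s| ≤ N s := by
      rw [abs_le]
      constructor <;> simp only [hN] <;>
        nlinarith [sq_nonneg (φ s + ψ s), sq_nonneg (φ s - ψ s)]
    have h2 : |2 * ψ s * (a s * φ s + b s * ψ s)| ≤ (A + 2 * B) * N s := by
      have e1 : 2 * ψ s * (a s * φ s + b s * ψ s) = a s * (2 * φ s * ψ s) + b s * (2 * ψ s ^ 2) := by
        ring
      rw [e1]
      refine (abs_add_le _ _).trans ?_
      rw [abs_mul (a s), abs_mul (b s)]
      have h3 : |2 * ψ s ^ 2| ≤ 2 * N s := by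
        rw [abs_of_nonneg (by positivity)]; simp only [hN]; nlinarith [sq_nonneg (φ s)]
      have hA0 := (abs_nonneg _).trans hAs
      have hB0 := (abs_nonneg _).trans hBs
      calc |a s| * |2 * φ s * ψ s| + |b s| * |2 * ψ s ^ 2| ≤ A * N s + B * (2 * N s) := by gcongr
        _ = (A + 2 * B) * N s := by ring
    calc _ ≤ _ := abs_add_le _ _
      _ ≤ N s + (A + 2 * B) * N s := add_le_add h1 h2
      _ = C * N s := by rw [hC]; ring
  have hNt₀ : N t₀ = 0 := by simp [hN, hφ0, hψ0]
  have hconv : Convex ℝ K := convex_uIcc _ _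
  have hNt : N t ≤ 0 := by
    -- Forward in time N e^{-Cs} decreases from 0; backward in time N e^{Cs} increases to 0. Both
    -- directions are needed to propagate the zero Cauchy data along a trajectory.
    rcases le_total t₀ t with h | h
    · have hanti : AntitoneOn (fun s ↦ N s * Real.exp (-C * s)) K := by
        refine antitoneOn_of_hasDerivWithinAt_nonpos hconv
          (fun s hs ↦ (hNd s hs (-C)).continuousWithinAt)
          (fun s hs ↦ (hNd s (interior_subset hs) (-C)).mono interior_subset) fun s hs ↦ ?_
        have := (abs_le.1 (hbound s (interior_subset hs))).2
        nlinarith [Real.exp_pos (-C * s)]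
      have := hanti Set.left_mem_uIcc Set.right_mem_uIcc h
      simp only [hNt₀, zero_mul] at this
      exact nonpos_of_mul_nonpos_left this (Real.exp_pos _)
    · have hmono : MonotoneOn (fun s ↦ N s * Real.exp (C * s)) K := by
        refine monotoneOn_of_hasDerivWithinAt_nonneg hconv
          (fun s hs ↦ (hNd s hs C).continuousWithinAt)
          (fun s hs ↦ (hNd s (interior_subset hs) C).mono interior_subset) fun s hs ↦ ?_
        have := (abs_le.1 (hbound s (interior_subset hs))).1
        nlinarith [Real.exp_pos (C * s)]
      have := hmono Set.right_mem_uIcc Set.left_mem_uIcc h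
      simp only [hNt₀, zero_mul] at this
      exact nonpos_of_mul_nonpos_left this (Real.exp_pos _)
  simp only [hN] at hNt
  constructor <;> nlinarith [sq_nonneg (φ t), sq_nonneg (ψ t)]

end Newtonian

/-! ### Curves and tangent vectors in charts -/

namespace Newtonian

lemma HasFDerivWithinAt.hasDerivWithinAt_one {H : Type*} [NormedAddCommGroup H] [NormedSpace ℝ H]
    {h : ℝ → H} {A : ℝ →L[ℝ] H} {J : Set ℝ} {t : ℝ} (hA : HasFDerivWithinAt h A J t) :
    HasDerivWithinAt h (A 1) J t :=
  hA.hasDerivWithinAt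

section Curves

variable {n : ℕ} {M : Type*} [TopologicalSpace M] [ChartedSpace (Coord n) M]
  [IsManifold (𝓡 n) ∞ M]

/-- Every tangent vector is the velocity of a smooth curve. -/
lemma exists_curve (q : M) (ξ : TangentSpace (𝓡 n) q) :
    ∃ (c : ℝ → M) (δ : ℝ), 0 < δ ∧ ContMDiffOn 𝓘(ℝ, ℝ) (𝓡 n) ∞ c (Set.Ioo (-δ) δ) ∧ c 0 = q ∧
      ∀ {H : Type} [NormedAddCommGroup H] [NormedSpace ℝ H] {h : M → H},
        MDifferentiableAt (𝓡 n) 𝓘(ℝ, H) h q →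
        HasDerivAt (fun s ↦ h (c s)) (mfderiv (𝓡 n) 𝓘(ℝ, H) h q ξ) 0 := by
  set κ := chartAt (Coord n) q with hκ
  have hκa : κ ∈ atlas (Coord n) M := chart_mem_atlas _ _
  have hq : q ∈ κ.source := mem_chart_source _ _
  set η : Coord n := mfderiv (𝓡 n) (𝓡 n) κ q ξ with hη
  -- A straight line in the chart. The same curve must serve several maps h later, hence the clause
  -- quantified over h.
  set l : ℝ → Coord n := fun s ↦ κ q + s • η with hl
  have hl0 : l 0 = κ q := by simp [hl]
  have hlc : ContDiff ℝ ∞ l := contDiff_const.add (contDiff_id.smul contDiff_const)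
  have hnhds : l ⁻¹' κ.target ∈ 𝓝 (0 : ℝ) :=
    hlc.continuous.continuousAt.preimage_mem_nhds
      (hl0 ▸ κ.open_target.mem_nhds (κ.map_source hq))
  obtain ⟨δ, hδ, hball⟩ := Metric.mem_nhds_iff.1 hnhds
  rw [Real.ball_eq_Ioo, zero_sub, zero_add] at hball
  refine ⟨fun s ↦ κ.symm (l s), δ, hδ, ?_, by simp [hl0, κ.left_inv hq], ?_⟩
  · exact (contMDiffOn_symm_of_mem_maximalAtlas (IsManifold.subset_maximalAtlas hκa)).comp
      hlc.contMDiff.contMDiffOn hball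
  · intro H _ _ h hh
    have hl1 : HasDerivAt l η 0 := by
      simpa [hl] using ((hasDerivAt_id (0 : ℝ)).smul_const η).const_add (κ q)
    have hsymm : MDifferentiableAt (𝓡 n) (𝓡 n) κ.symm (κ q) :=
      (mdifferentiable_of_mem_atlas hκa).mdifferentiableAt_symm (κ.map_source hq)
    have hh' : MDifferentiableAt (𝓡 n) 𝓘(ℝ, H) h (κ.symm (κ q)) := by rwa [κ.left_inv hq]
    have hcomp : MDifferentiableAt (𝓡 n) 𝓘(ℝ, H) (h ∘ κ.symm) (κ q) := hh'.comp _ hsymm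
    have hd : DifferentiableAt ℝ (h ∘ κ.symm) (κ q) := hcomp.differentiableAt
    have h1 : HasDerivAt ((h ∘ κ.symm) ∘ l) (fderiv ℝ (h ∘ κ.symm) (κ q) η) 0 :=
      HasFDerivAt.comp_hasDerivAt (0 : ℝ) (by rw [hl0]; exact hd.hasFDerivAt) hl1
    have h2 : mfderiv (𝓡 n) 𝓘(ℝ, H) (h ∘ κ.symm) (κ q) η =
        mfderiv (𝓡 n) 𝓘(ℝ, H) h (κ.symm (κ q)) (mfderiv (𝓡 n) (𝓡 n) κ.symm (κ q) η) := by
      rw [mfderiv_comp _ hh' hsymm]; rfl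
    rw [mfderiv_eq_fderiv] at h2
    have h3 : mfderiv (𝓡 n) (𝓡 n) κ.symm (κ q) η = ξ :=
      DFunLike.congr_fun ((mdifferentiable_of_mem_atlas hκa).symm_comp_deriv hq) ξ
    have h4 : ∀ p, p = q → (mfderiv (𝓡 n) 𝓘(ℝ, H) h p : Coord n →L[ℝ] H) ξ =
        mfderiv (𝓡 n) 𝓘(ℝ, H) h q ξ := by rintro _ rfl; rfl
    refine h1.congr_deriv (h2.trans ?_)
    rw [h3]
    exact h4 _ (κ.left_inv hq)

lemma hasDerivWithinAt_chart {e : OpenPartialHomeomorph M (Coord n)} (he : e ∈ atlas (Coord n) M)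
    {γ : ℝ → M} {J : Set ℝ} {t : ℝ} (hγ : MDifferentiableWithinAt 𝓘(ℝ, ℝ) (𝓡 n) γ J t)
    (hs : γ t ∈ e.source) :
    HasDerivWithinAt (fun s ↦ e (γ s)) (mfderiv (𝓡 n) (𝓡 n) e (γ t) (velocity n γ J t) : Coord n)
      J t := by
  have h1 := (mdifferentiable_of_mem_atlas he).mdifferentiableAt hs
  have h2 : HasMFDerivWithinAt 𝓘(ℝ, ℝ) (𝓡 n) (e ∘ γ) J t
      ((mfderiv (𝓡 n) (𝓡 n) e (γ t)).comp (mfderivWithin 𝓘(ℝ, ℝ) (𝓡 n) γ J t)) :=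
    h1.hasMFDerivAt.comp_hasMFDerivWithinAt t hγ.hasMFDerivWithinAt
  have h3 : HasFDerivWithinAt (fun s ↦ e (γ s)) (((mfderiv (𝓡 n) (𝓡 n) e (γ t)).comp
      (mfderivWithin 𝓘(ℝ, ℝ) (𝓡 n) γ J t) : ℝ →L[ℝ] Coord n)) J t := h2.hasFDerivWithinAt
  exact HasFDerivWithinAt.hasDerivWithinAt_one h3

lemma inner_eq_metricForm [Bundle.RiemannianBundle (fun p : M ↦ TangentSpace (𝓡 n) p)]
    {e : OpenPartialHomeomorph M (Coord n)} (he : e ∈ atlas (Coord n) M) {p : M}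
    (hp : p ∈ e.source) (u w : TangentSpace (𝓡 n) p) :
    inner ℝ u w = metricForm e (e p) (mfderiv (𝓡 n) (𝓡 n) e p u)
      (mfderiv (𝓡 n) (𝓡 n) e p w) := by
  obtain ⟨x, hx, rfl⟩ : ∃ x ∈ e.target, e.symm x = p := ⟨e p, e.map_source hp, e.left_inv hp⟩
  have h := metricForm_apply e x (mfderiv (𝓡 n) (𝓡 n) e (e.symm x) u)
    (mfderiv (𝓡 n) (𝓡 n) e (e.symm x) w)
  rw [ofCoords_mfderiv he hx, ofCoords_mfderiv he hx] at h
  rw [e.right_inv hx]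
  exact h.symm

end Curves

lemma HasFDerivWithinAt.hasDerivWithinAt_snd {H : Type*} [NormedAddCommGroup H] [NormedSpace ℝ H]
    {h : ℝ × ℝ → H} {A : ℝ × ℝ →L[ℝ] H} {I J : Set ℝ} {s t : ℝ}
    (hA : HasFDerivWithinAt h A (I ×ˢ J) (s, t)) (hs : s ∈ I) :
    HasDerivWithinAt (fun r ↦ h (s, r)) (A (0, 1)) J t :=
  hA.comp_hasDerivWithinAt t ((hasDerivWithinAt_const t J s).prodMk (hasDerivWithinAt_id t J))
    fun _ hr ↦ Set.mk_mem_prod hs hr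

lemma HasFDerivWithinAt.hasDerivWithinAt_fst {H : Type*} [NormedAddCommGroup H] [NormedSpace ℝ H]
    {h : ℝ × ℝ → H} {A : ℝ × ℝ →L[ℝ] H} {I J : Set ℝ} {s t : ℝ}
    (hA : HasFDerivWithinAt h A (I ×ˢ J) (s, t)) (ht : t ∈ J) :
    HasDerivWithinAt (fun r ↦ h (r, t)) (A (1, 0)) I s :=
  hA.comp_hasDerivWithinAt s ((hasDerivWithinAt_id s I).prodMk (hasDerivWithinAt_const s I t))
    fun _ hr ↦ Set.mk_mem_prod hr ht

end Newtonian

/-! ### Blow-ups as two-parameter families of trajectories -/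

namespace Newtonian

lemma uniqueDiffOn_strip {T t₀ δ : ℝ} :
    UniqueDiffOn ℝ (Set.Ico 0 T ∩ Set.Ioo (t₀ - δ) (t₀ + δ)) :=
  (uniqueDiffOn_Ico 0 T).inter isOpen_Ioo

/-- Supplies the condition under which mixed partial derivatives commute up to the initial time. -/
lemma strip_subset_closure_interior {T t₀ δ : ℝ} :
    Set.Ioo (-δ) δ ×ˢ (Set.Ico 0 T ∩ Set.Ioo (t₀ - δ) (t₀ + δ)) ⊆
      closure (interior (Set.Ioo (-δ) δ ×ˢ (Set.Ico 0 T ∩ Set.Ioo (t₀ - δ) (t₀ + δ)))) := by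
  rw [interior_prod_eq, closure_prod_eq, isOpen_Ioo.interior_eq, interior_inter,
    isOpen_Ioo.interior_eq, interior_Ico]
  refine Set.prod_mono subset_closure fun t ht ↦ ?_
  have hT : (0 : ℝ) ≠ T := (ht.1.1.trans_lt ht.1.2).ne
  rw [Set.inter_comm]
  refine isOpen_Ioo.inter_closure ⟨ht.2, ?_⟩
  rw [closure_Ioo hT]
  exact ⟨ht.1.1, ht.1.2.le⟩

section Trajectories

variable {n : ℕ} {M : Type*} [TopologicalSpace M] [ChartedSpace (Coord n) M]
  [IsManifold (𝓡 n) ∞ M] [Bundle.RiemannianBundle (fun p : M ↦ TangentSpace (𝓡 n) p)]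
  {e : OpenPartialHomeomorph M (Coord n)} {F : ForceField n M}

lemma sum_christoffel_eq (e : OpenPartialHomeomorph M (Coord n)) (x u w : Coord n) (k : Fin n) :
    ∑ i, ∑ j, christoffel e k i j x * u i * w j = christoffelVec e x u w k := by
  simp [christoffelVec]

lemma IsTrajectoryOn.hasDerivWithinAt_chart {γ : ℝ → M} {J : Set ℝ} (h : IsTrajectoryOn F γ J)
    (he : e ∈ atlas (Coord n) M) {t : ℝ} (ht : t ∈ J) (hs : γ t ∈ e.source) :
    HasDerivWithinAt (fun s ↦ e (γ s)) (mfderiv (𝓡 n) (𝓡 n) e (γ t) (velocity n γ J t) : Coord n)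
      J t :=
  Newtonian.hasDerivWithinAt_chart he ((h.1 t ht).mdifferentiableWithinAt (by simp)) hs

/-- The trajectory equation in a chart, on a relatively open part of the time interval. -/
lemma IsTrajectoryOn.derivWithin_velocity {γ : ℝ → M} {J U : Set ℝ} (h : IsTrajectoryOn F γ J)
    (hJ : UniqueDiffOn ℝ J) (hU : IsOpen U) (he : e ∈ atlas (Coord n) M)
    (hs : ∀ t ∈ J ∩ U, γ t ∈ e.source) {v : ℝ → Coord n}
    (hv : ∀ t ∈ J ∩ U, v t = mfderiv (𝓡 n) (𝓡 n) e (γ t) (velocity n γ J t)) {t : ℝ}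
    (ht : t ∈ J ∩ U) :
    derivWithin v (J ∩ U) t = acceleration F e (e (γ t)) (v t) := by
  have hx' : ∀ t ∈ J ∩ U, derivWithin (fun s ↦ e (γ s)) J t = v t := fun t ht ↦ by
    rw [(h.hasDerivWithinAt_chart he ht.1 (hs t ht)).derivWithin (hJ t ht.1), hv t ht]
  rw [derivWithin_congr (fun s hs ↦ (hx' s hs).symm) (hx' t ht).symm,
    derivWithin_inter (hU.mem_nhds ht.2)]
  ext k
  have := h.2 e he t ht.1 (hs t ht) k
  simp only [hx' t ht, sum_christoffel_eq] at this
  rw [acceleration, PiLp.sub_apply, ← this]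
  ring

end Trajectories

section Variation

variable {d : ℕ} {M : Type*} [TopologicalSpace M] [ChartedSpace (Coord (d + 1)) M]
  [IsManifold (𝓡 (d + 1)) ∞ M]
  [Bundle.RiemannianBundle (fun p : M ↦ TangentSpace (𝓡 (d + 1)) p)]
  {F : ForceField (d + 1) M} {p₀ : M} {ν₀ T : ℝ} {f : UnitSphere d p₀ → ℝ → M}

lemma IsBlowUp.contMDiff (hf : IsBlowUp F p₀ ν₀ T f) {t : ℝ} (ht : t ∈ Set.Ico 0 T) :
    ContMDiff (𝓡 d) (𝓡 (d + 1)) ∞ (fun q ↦ f q t) := by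
  rw [← contMDiffOn_univ]
  exact hf.smooth.comp (contMDiff_id.prodMk contMDiff_const).contMDiffOn
    fun q _ ↦ Set.mk_mem_prod trivial ht

lemma IsBlowUp.apply_zero (hf : IsBlowUp F p₀ ν₀ T f) (q : UnitSphere d p₀) : f q 0 = p₀ :=
  congrArg Bundle.TotalSpace.proj (hf.initial q)

/-- The initial velocity of the trajectories of a blow-up in a chart. -/
lemma IsBlowUp.mfderiv_velocity_zero (hf : IsBlowUp F p₀ ν₀ T f)
    (e : OpenPartialHomeomorph M (Coord (d + 1))) (q : UnitSphere d p₀) :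
    (mfderiv (𝓡 (d + 1)) (𝓡 (d + 1)) e (f q 0)
      (velocity (d + 1) (f q) (Set.Ico 0 T) 0) : Coord (d + 1)) =
      mfderiv (𝓡 (d + 1)) (𝓡 (d + 1)) e p₀ (ν₀ • (q : TangentSpace (𝓡 (d + 1)) p₀)) :=
  congrArg (fun X : TangentBundle (𝓡 (d + 1)) M ↦
    (mfderiv (𝓡 (d + 1)) (𝓡 (d + 1)) e X.proj X.snd : Coord (d + 1))) (hf.initial q)

variable [IsContMDiffRiemannianBundle (𝓡 (d + 1)) ∞ (Coord (d + 1))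
      (fun p : M ↦ TangentSpace (𝓡 (d + 1)) p)]
  {e : OpenPartialHomeomorph M (Coord (d + 1))}

set_option maxHeartbeats 1000000 in
/-- In a chart, near any time, the pairing `g(v, τ)` of the velocity with the variation `τ` defined
by a tangent vector of the sphere is a twice differentiable function of time. -/
theorem IsBlowUp.exists_variation (hF : F.IsSmooth) (hf : IsBlowUp F p₀ ν₀ T f)
    (q : UnitSphere d p₀) (ξ : TangentSpace (𝓡 d) q) (he : e ∈ atlas (Coord (d + 1)) M) {t₀ : ℝ}
    (ht₀ : t₀ ∈ Set.Ico 0 T) (hs : f q t₀ ∈ e.source) {x v τ : ℝ → Coord (d + 1)}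
    (hx : ∀ t, x t = e (f q t))
    (hv : ∀ t, v t = mfderiv (𝓡 (d + 1)) (𝓡 (d + 1)) e (f q t)
      (velocity (d + 1) (f q) (Set.Ico 0 T) t))
    (hτ : ∀ t, τ t = mfderiv (𝓡 (d + 1)) (𝓡 (d + 1)) e (f q t)
      (mfderiv (𝓡 d) (𝓡 (d + 1)) (fun q' ↦ f q' t) q ξ)) :
    ∃ δ > 0, ∃ (J : Set ℝ) (τ' : ℝ → Coord (d + 1)),
      J = Set.Ico 0 T ∩ Set.Ioo (t₀ - δ) (t₀ + δ) ∧
      (∀ t ∈ J, f q t ∈ e.source) ∧ (∀ t ∈ J, v t ≠ 0) ∧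
      ContinuousOn x J ∧ ContinuousOn v J ∧ ContinuousOn τ J ∧ ContinuousOn τ' J ∧
      (∀ t ∈ J, HasDerivWithinAt τ (τ' t) J t) ∧
      (∀ t ∈ J, HasDerivWithinAt (fun t ↦ metricForm e (x t) (v t) (τ t))
        (pairingRate F e (x t) (v t) (τ t) (τ' t)) J t) ∧
      (∀ t ∈ J, HasDerivWithinAt (fun t ↦ pairingRate F e (x t) (v t) (τ t) (τ' t))
        (variationForm F e (x t) (v t) (τ t) + normalityForm₁ F e (x t) (v t) (τ' t)) J t) ∧
      (0 ∈ J → τ' 0 = mfderiv (𝓡 (d + 1)) (𝓡 (d + 1)) e p₀ (ν₀ •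
        (mfderiv (𝓡 d) 𝓘(ℝ, TangentSpace (𝓡 (d + 1)) p₀)
          (fun q' : UnitSphere d p₀ ↦ (q' : TangentSpace (𝓡 (d + 1)) p₀)) q ξ :
          TangentSpace (𝓡 (d + 1)) p₀))) := by
  obtain ⟨c, δ₀, hδ₀, hc, hc0, hcd⟩ := exists_curve (n := d) q ξ
  set I : Set ℝ := Set.Ico 0 T with hI
  have hIu : UniqueDiffOn ℝ I := uniqueDiffOn_Ico 0 T
  -- Along a curve c on the sphere with velocity ξ the blow-up becomes a map of two real variables:
  -- its t-derivative at s = 0 is the velocity, its s-derivative the variation τ.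
  set G : ℝ × ℝ → M := fun p ↦ f (c p.1) p.2 with hG
  have hGs : ContMDiffOn 𝓘(ℝ, ℝ × ℝ) (𝓡 (d + 1)) ∞ G (Set.Ioo (-δ₀) δ₀ ×ˢ I) := by
    refine hf.smooth.comp (g := fun z : UnitSphere d p₀ × ℝ ↦ f z.1 z.2)
      (f := fun p : ℝ × ℝ ↦ (c p.1, p.2)) (ContMDiffOn.prodMk ?_ ?_)
      fun p hp ↦ Set.mk_mem_prod trivial hp.2
    · exact hc.comp contDiff_fst.contMDiff.contMDiffOn fun p hp ↦ hp.1
    · exact contDiff_snd.contMDiff.contMDiffOn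
  have h0δ₀ : (0 : ℝ) ∈ Set.Ioo (-δ₀) δ₀ := ⟨by linarith, hδ₀⟩
  -- One chart covers the family only near (0, t₀); this fixes δ.
  have hnear : ∀ᶠ p in 𝓝[Set.Ioo (-δ₀) δ₀ ×ˢ I] ((0, t₀) : ℝ × ℝ), G p ∈ e.source :=
    (hGs.continuousOn (0, t₀) (Set.mk_mem_prod h0δ₀ ht₀)).eventually
      (e.open_source.mem_nhds (by simpa [hG, hc0] using hs))
  obtain ⟨ε, hε, hball⟩ := Metric.mem_nhdsWithin_iff.1 hnear
  set δ := min ε δ₀ with hδdef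
  have hδ : 0 < δ := lt_min hε hδ₀
  set J : Set ℝ := I ∩ Set.Ioo (t₀ - δ) (t₀ + δ) with hJ
  have hJu : UniqueDiffOn ℝ J := uniqueDiffOn_strip
  set S : Set ℝ := Set.Ioo (-δ) δ with hS
  have h0S : (0 : ℝ) ∈ S := ⟨by linarith, hδ⟩
  have hSδ₀ : S ⊆ Set.Ioo (-δ₀) δ₀ :=
    Set.Ioo_subset_Ioo (neg_le_neg (min_le_right _ _)) (min_le_right _ _)
  set Ω : Set (ℝ × ℝ) := S ×ˢ J with hΩdef
  have hΩ : UniqueDiffOn ℝ Ω := isOpen_Ioo.uniqueDiffOn.prod hJu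
  have hcl : Ω ⊆ closure (interior Ω) := strip_subset_closure_interior
  have hΩs : Ω ⊆ Set.Ioo (-δ₀) δ₀ ×ˢ I := Set.prod_mono hSδ₀ Set.inter_subset_left
  have hGe : ∀ p ∈ Ω, G p ∈ e.source := by
    rintro ⟨s, t⟩ hp
    refine hball ⟨?_, hΩs hp⟩
    rw [← ball_prod_same, Real.ball_eq_Ioo, Real.ball_eq_Ioo, zero_sub, zero_add]
    have h : δ ≤ ε := min_le_left _ _
    exact ⟨⟨by linarith [hp.1.1], by linarith [hp.1.2]⟩,
      ⟨by linarith [hp.2.2.1], by linarith [hp.2.2.2]⟩⟩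
  set Y : ℝ × ℝ → Coord (d + 1) := fun p ↦ e (G p) with hYdef
  have hY : ContDiffOn ℝ ∞ Y Ω := by
    rw [← contMDiffOn_iff_contDiffOn]
    exact (contMDiffOn_of_mem_maximalAtlas (IsManifold.subset_maximalAtlas he)).comp
      (hGs.mono hΩs) hGe
  have hYt : ∀ p ∈ Ω, Y p ∈ e.target := fun p hp ↦ e.map_source (hGe p hp)
  have dY : ∀ p ∈ Ω, HasFDerivWithinAt Y (fderivWithin ℝ Y Ω p) Ω p :=
    fun p hp ↦ hasFDerivWithinAt_of_contDiffOn hY hp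
  set V : ℝ × ℝ → Coord (d + 1) := fun p ↦ fderivWithin ℝ Y Ω p (0, 1) with hVdef
  set W : ℝ × ℝ → Coord (d + 1) := fun p ↦ fderivWithin ℝ Y Ω p (1, 0) with hWdef
  set W' : ℝ × ℝ → Coord (d + 1) := fun p ↦ fderivWithin ℝ V Ω p (1, 0) with hW'def
  have hVs : ContDiffOn ℝ ∞ V Ω := contDiffOn_partial hΩ hY _
  have hWs : ContDiffOn ℝ ∞ W Ω := contDiffOn_partial hΩ hY _
  have hW's : ContDiffOn ℝ ∞ W' Ω := contDiffOn_partial hΩ hVs _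
  have hVeq : ∀ s ∈ S, ∀ t ∈ J, V (s, t) = mfderiv (𝓡 (d + 1)) (𝓡 (d + 1)) e (f (c s) t)
      (velocity (d + 1) (f (c s)) I t) := by
    intro s hs t ht
    have h1 := HasFDerivWithinAt.hasDerivWithinAt_snd (dY (s, t) (Set.mk_mem_prod hs ht)) hs
    have h2 := ((hf.trajectory (c s)).hasDerivWithinAt_chart he ht.1
      (hGe (s, t) (Set.mk_mem_prod hs ht))).mono (Set.inter_subset_left : J ⊆ I)
    exact (hJu t ht).eq_deriv _ h1 h2
  have hV0 : ∀ p ∈ Ω, V p ≠ 0 := by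
    rintro ⟨s, t⟩ hp h0
    rw [hVeq s hp.1 t hp.2] at h0
    refine hf.velocity_ne_zero (c s) t hp.2.1 ?_
    have := (mdifferentiable_of_mem_atlas he).mfderiv_injective (hGe (s, t) hp)
    exact this (h0.trans (map_zero _).symm)
  have hacc : ∀ p ∈ Ω, fderivWithin ℝ V Ω p (0, 1) = acceleration F e (Y p) (V p) := by
    rintro ⟨s, t⟩ hp
    have h1 := HasFDerivWithinAt.hasDerivWithinAt_snd (hasFDerivWithinAt_of_contDiffOn hVs hp) hp.1
    rw [← h1.derivWithin (hJu t hp.2)]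
    exact (hf.trajectory (c s)).derivWithin_velocity hIu isOpen_Ioo he
      (fun t ht ↦ hGe (s, t) (Set.mk_mem_prod hp.1 ht)) (fun t ht ↦ hVeq s hp.1 t ht) hp.2
  have hWeq : ∀ t ∈ J, W (0, t) = τ t := by
    intro t ht
    have hp : ((0 : ℝ), t) ∈ Ω := Set.mk_mem_prod h0S ht
    have h1 := HasFDerivWithinAt.hasDerivWithinAt_fst (dY _ hp) ht
    have hsrc : f q t ∈ e.source := by simpa [hG, hc0] using hGe _ hp
    have hft : MDifferentiableAt (𝓡 d) (𝓡 (d + 1)) (fun q' ↦ f q' t) q :=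
      (hf.contMDiff ht.1).mdifferentiableAt (by simp)
    have het := (mdifferentiable_of_mem_atlas he).mdifferentiableAt hsrc
    have h2 := (hcd (h := e ∘ fun q' ↦ f q' t) (het.comp q hft)).hasDerivWithinAt (s := S)
    have h3 : W (0, t) = mfderiv (𝓡 d) (𝓡 (d + 1)) (e ∘ fun q' ↦ f q' t) q ξ :=
      (isOpen_Ioo.uniqueDiffOn 0 h0S).eq_deriv _ h1 h2
    rw [h3, hτ t, mfderiv_comp q het hft]
    rfl
  have hx0 : ∀ t, Y (0, t) = x t := fun t ↦ by simp only [hYdef, hG, hc0, hx t]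
  have hv0 : ∀ t ∈ J, V (0, t) = v t := fun t ht ↦ by
    rw [hVeq 0 h0S t ht, hv t]
    have : ∀ q', q' = q → (mfderiv (𝓡 (d + 1)) (𝓡 (d + 1)) e (f q' t)
      (velocity (d + 1) (f q') I t) : Coord (d + 1)) = mfderiv (𝓡 (d + 1)) (𝓡 (d + 1)) e (f q t)
      (velocity (d + 1) (f q) I t) := by rintro _ rfl; rfl
    exact this _ hc0
  have hslice : ∀ t ∈ J, ((0 : ℝ), t) ∈ Ω := fun t ht ↦ Set.mk_mem_prod h0S ht
  have hι : ContinuousOn (fun t : ℝ ↦ ((0 : ℝ), t)) J :=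
    (continuous_const.prodMk continuous_id).continuousOn
  refine ⟨δ, hδ, J, fun t ↦ W' (0, t), rfl, ?_, ?_, ?_, ?_, ?_, ?_, ?_, ?_, ?_, ?_⟩
  · intro t ht
    simpa [hG, hc0] using hGe _ (hslice t ht)
  · intro t ht
    rw [← hv0 t ht]; exact hV0 _ (hslice t ht)
  · exact (hY.continuousOn.comp hι hslice).congr fun t _ ↦ (hx0 t).symm
  · exact (hVs.continuousOn.comp hι hslice).congr fun t ht ↦ (hv0 t ht).symm
  · exact (hWs.continuousOn.comp hι hslice).congr fun t ht ↦ (hWeq t ht).symm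
  · exact hW's.continuousOn.comp hι hslice
  · intro t ht
    have h1 := HasFDerivWithinAt.hasDerivWithinAt_snd
      (hasFDerivWithinAt_of_contDiffOn hWs (hslice t ht)) h0S
    -- The rate τ' is taken as ∂_s V; symmetry identifies it with the time derivative of τ = ∂_s Y.
    rw [fderivWithin_partial_comm hΩ hcl hY (hslice t ht) (1, 0) (0, 1)] at h1
    exact h1.congr (fun t ht ↦ (hWeq t ht).symm) (hWeq t ht).symm
  · intro t ht
    obtain ⟨⟨A, hA, hA'⟩, -⟩ := hasFDerivWithinAt_pairing hF he hΩ hcl hY hYt (fun _ ↦ rfl)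
      (fun _ ↦ rfl) (fun _ ↦ rfl) hV0 hacc (hslice t ht)
    have h1 := HasFDerivWithinAt.hasDerivWithinAt_snd hA h0S
    rw [hA'] at h1
    change HasDerivWithinAt (fun r ↦ metricForm e (Y (0, r)) (V (0, r)) (W (0, r)))
      (pairingRate F e (Y (0, t)) (V (0, t)) (W (0, t)) (W' (0, t))) J t at h1
    rw [hx0, hv0 t ht, hWeq t ht] at h1
    exact h1.congr (fun t ht ↦ by rw [hx0, hv0 t ht, hWeq t ht])
      (by rw [hx0, hv0 t ht, hWeq t ht])
  · intro t ht
    obtain ⟨-, A, hA, hA'⟩ := hasFDerivWithinAt_pairing hF he hΩ hcl hY hYt (fun _ ↦ rfl)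
      (fun _ ↦ rfl) (fun _ ↦ rfl) hV0 hacc (hslice t ht)
    have h1 := HasFDerivWithinAt.hasDerivWithinAt_snd hA h0S
    rw [hA'] at h1
    change HasDerivWithinAt
      (fun r ↦ pairingRate F e (Y (0, r)) (V (0, r)) (W (0, r)) (W' (0, r)))
      (variationForm F e (Y (0, t)) (V (0, t)) (W (0, t)) +
        normalityForm₁ F e (Y (0, t)) (V (0, t)) (W' (0, t))) J t at h1
    rw [hx0, hv0 t ht, hWeq t ht] at h1
    exact h1.congr (fun t ht ↦ by rw [hx0, hv0 t ht, hWeq t ht])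
      (by rw [hx0, hv0 t ht, hWeq t ht])
  -- At t = 0 the velocity in the chart is a fixed linear image of the point c(s) of the sphere, so
  -- ∂_s V is that linear map applied to ξ as a vector of the ambient tangent space.
  · intro h0
    have h1 := HasFDerivWithinAt.hasDerivWithinAt_fst
      (hasFDerivWithinAt_of_contDiffOn hVs (hslice 0 h0)) h0
    have h2 : MDifferentiableAt (𝓡 d) 𝓘(ℝ, TangentSpace (𝓡 (d + 1)) p₀)
        (fun q' : UnitSphere d p₀ ↦ (q' : TangentSpace (𝓡 (d + 1)) p₀)) q :=
      (contMDiff_coe_sphere (m := ∞)).mdifferentiableAt (by simp)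
    set L : TangentSpace (𝓡 (d + 1)) p₀ →L[ℝ] Coord (d + 1) :=
      ν₀ • mfderiv (𝓡 (d + 1)) (𝓡 (d + 1)) e p₀ with hL
    have h3 := (L.hasFDerivAt.comp_hasDerivAt (0 : ℝ) (hcd h2)).hasDerivWithinAt (s := S)
    have h4 : ∀ s ∈ S, V (s, 0) = L (c s : TangentSpace (𝓡 (d + 1)) p₀) := by
      intro s hs
      rw [hVeq s hs 0 h0, hf.mfderiv_velocity_zero, map_smul]
      rfl
    have h5 := (isOpen_Ioo.uniqueDiffOn 0 h0S).eq_deriv _ (h1.congr (fun s hs ↦ (h4 s hs).symm)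
      (h4 0 h0S).symm) h3
    exact h5.trans (map_smul (mfderiv (𝓡 (d + 1)) (𝓡 (d + 1)) e p₀) ν₀
      (mfderiv (𝓡 d) 𝓘(ℝ, TangentSpace (𝓡 (d + 1)) p₀)
        (fun q' : UnitSphere d p₀ ↦ (q' : TangentSpace (𝓡 (d + 1)) p₀)) q ξ :
        TangentSpace (𝓡 (d + 1)) p₀)).symm

end Variation

end Newtonian

/-! ### Normality of blow-ups against the weak normality equations -/

namespace Newtonian

variable {d : ℕ} {M : Type*} [TopologicalSpace M] [ChartedSpace (Coord (d + 1)) M]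
  [IsManifold (𝓡 (d + 1)) ∞ M]
  [Bundle.RiemannianBundle (fun p : M ↦ TangentSpace (𝓡 (d + 1)) p)]

/-- A tangent vector of the unit sphere as a vector of the ambient space. -/
def sphereIncl {p₀ : M} (q : UnitSphere d p₀) (ξ : TangentSpace (𝓡 d) q) :
    TangentSpace (𝓡 (d + 1)) p₀ :=
  mfderiv (𝓡 d) 𝓘(ℝ, TangentSpace (𝓡 (d + 1)) p₀)
    (fun q' : UnitSphere d p₀ ↦ (q' : TangentSpace (𝓡 (d + 1)) p₀)) q ξ

lemma inner_sphereIncl {p₀ : M} (q : UnitSphere d p₀) (ξ : TangentSpace (𝓡 d) q) :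
    inner ℝ (q : TangentSpace (𝓡 (d + 1)) p₀) (sphereIncl q ξ) = 0 := by
  have h := range_mvfderiv_subtypeVal (n := d) q
  have h1 : sphereIncl q ξ ∈ (ℝ ∙ (q : TangentSpace (𝓡 (d + 1)) p₀))ᗮ := by
    rw [← h]; exact ⟨ξ, rfl⟩
  exact Submodule.mem_orthogonal_singleton_iff_inner_right.1 h1

/-- The tangent space of the sphere at q is all of q^⊥. For the converse direction this realizes
every vector orthogonal to the initial velocity as an initial rate τ'(0). -/
lemma exists_sphereIncl_eq {p₀ : M} (q : UnitSphere d p₀) {η : TangentSpace (𝓡 (d + 1)) p₀}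
    (hη : inner ℝ (q : TangentSpace (𝓡 (d + 1)) p₀) η = 0) :
    ∃ ξ : TangentSpace (𝓡 d) q, sphereIncl q ξ = η := by
  have h := range_mvfderiv_subtypeVal (n := d) q
  have h1 : η ∈ (ℝ ∙ (q : TangentSpace (𝓡 (d + 1)) p₀))ᗮ :=
    Submodule.mem_orthogonal_singleton_iff_inner_right.2 hη
  rw [← h] at h1
  exact h1

variable {F : ForceField (d + 1) M} {p₀ : M} {ν₀ T : ℝ} {f : UnitSphere d p₀ → ℝ → M}

lemma IsBlowUp.mfderiv_zero (hf : IsBlowUp F p₀ ν₀ T f) (q : UnitSphere d p₀)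
    (ξ : TangentSpace (𝓡 d) q) : mfderiv (𝓡 d) (𝓡 (d + 1)) (fun q' ↦ f q' 0) q ξ = 0 := by
  have h : (fun q' ↦ f q' 0) = fun _ ↦ p₀ := funext hf.apply_zero
  rw [h, mfderiv_const]
  rfl

lemma pairingRate_zero (e : OpenPartialHomeomorph M (Coord (d + 1))) (x v τ' : Coord (d + 1)) :
    pairingRate F e x v 0 τ' = metricForm e x v τ' := by
  have h : christoffelVec e x v 0 = 0 := by ext k; simp [christoffelVec]
  rw [pairingRate, h, map_zero, zero_add, add_zero]

/-- The pairing of the velocity with a variation. -/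
def pairing (T : ℝ) (f : UnitSphere d p₀ → ℝ → M) (q : UnitSphere d p₀)
    (ξ : TangentSpace (𝓡 d) q) (t : ℝ) : ℝ :=
  inner ℝ (velocity (d + 1) (f q) (Set.Ico 0 T) t : TangentSpace (𝓡 (d + 1)) (f q t))
    (mfderiv (𝓡 d) (𝓡 (d + 1)) (fun q' ↦ f q' t) q ξ)

variable [IsContMDiffRiemannianBundle (𝓡 (d + 1)) ∞ (Coord (d + 1))
      (fun p : M ↦ TangentSpace (𝓡 (d + 1)) p)]

/-- The Cauchy data of the pairing vanish at the initial time. -/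
lemma IsBlowUp.pairing_zero (hF : F.IsSmooth) (hf : IsBlowUp F p₀ ν₀ T f) (hT : 0 < T)
    (q : UnitSphere d p₀) (ξ : TangentSpace (𝓡 d) q) :
    pairing T f q ξ 0 = 0 ∧ derivWithin (pairing T f q ξ) (Set.Ico 0 T) 0 = 0 := by
  have h0 : (0 : ℝ) ∈ Set.Ico 0 T := ⟨le_rfl, hT⟩
  have hφ0 : pairing T f q ξ 0 = 0 := by
    rw [pairing, hf.mfderiv_zero, inner_zero_right]
  refine ⟨hφ0, ?_⟩
  have hs : p₀ ∈ (chartAt (Coord (d + 1)) p₀).source := mem_chart_source _ _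
  set e := chartAt (Coord (d + 1)) p₀ with he'
  have he : e ∈ atlas (Coord (d + 1)) M := chart_mem_atlas _ _
  obtain ⟨x, hx⟩ : ∃ x : ℝ → Coord (d + 1), ∀ t, x t = e (f q t) := ⟨_, fun _ ↦ rfl⟩
  obtain ⟨v, hv⟩ : ∃ v : ℝ → Coord (d + 1), ∀ t, v t = mfderiv (𝓡 (d + 1)) (𝓡 (d + 1)) e (f q t)
      (velocity (d + 1) (f q) (Set.Ico 0 T) t) := ⟨_, fun _ ↦ rfl⟩
  obtain ⟨τ, hτ⟩ : ∃ τ : ℝ → Coord (d + 1), ∀ t, τ t = mfderiv (𝓡 (d + 1)) (𝓡 (d + 1)) e (f q t)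
      (mfderiv (𝓡 d) (𝓡 (d + 1)) (fun q' ↦ f q' t) q ξ) := ⟨_, fun _ ↦ rfl⟩
  have hx0 : x 0 = e p₀ := by rw [hx, hf.apply_zero]
  have hv0 := (hv 0).trans (hf.mfderiv_velocity_zero e q)
  have hτ0 : τ 0 = 0 := by rw [hτ, hf.mfderiv_zero]; exact map_zero _
  obtain ⟨δ, hδ, J, τ', hJ, hsrc, -, -, -, -, -, -, hφ, -, hτ'⟩ :=
    hf.exists_variation hF q ξ he h0 (by rwa [hf.apply_zero]) hx hv hτ
  have h0J : (0 : ℝ) ∈ J := by rw [hJ]; exact ⟨h0, by linarith, by linarith⟩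
  have hpair : ∀ t ∈ J, pairing T f q ξ t = metricForm e (x t) (v t) (τ t) := fun t ht ↦ by
    rw [hx, hv, hτ]; exact inner_eq_metricForm he (hsrc t ht) _ _
  have h2 := (hφ 0 h0J).congr hpair (hpair 0 h0J)
  rw [hJ] at h2
  have h3 := (hasDerivWithinAt_inter (Ioo_mem_nhds (by linarith) (by linarith))).1 h2
  rw [h3.derivWithin (uniqueDiffOn_Ico 0 T 0 h0), hτ0, pairingRate_zero, hτ' h0J, hv0, hx0]
  -- With τ(0) = 0 the derivative of the pairing at time 0 is ν₀² g(q, ξ), which is zero.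
  refine (inner_eq_metricForm he hs (ν₀ • (q : TangentSpace (𝓡 (d + 1)) p₀))
    (ν₀ • sphereIncl q ξ)).symm.trans ?_
  rw [inner_smul_left, inner_smul_right, inner_sphereIncl]
  simp

/-- Near any time the Cauchy data of the pairing vanish either identically or nowhere. -/
lemma IsBlowUp.pairing_locally_zero (hF : F.IsSmooth) (hW : SatisfiesWeakNormality F)
    (hf : IsBlowUp F p₀ ν₀ T f) (q : UnitSphere d p₀) (ξ : TangentSpace (𝓡 d) q) {t₀ : ℝ}
    (ht₀ : t₀ ∈ Set.Ico 0 T) :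
    ∀ᶠ t in 𝓝[Set.Ico 0 T] t₀,
      (pairing T f q ξ t₀ = 0 ∧ derivWithin (pairing T f q ξ) (Set.Ico 0 T) t₀ = 0) ↔
      (pairing T f q ξ t = 0 ∧ derivWithin (pairing T f q ξ) (Set.Ico 0 T) t = 0) := by
  have hs : f q t₀ ∈ (chartAt (Coord (d + 1)) (f q t₀)).source := mem_chart_source _ _
  set e := chartAt (Coord (d + 1)) (f q t₀) with he'
  have he : e ∈ atlas (Coord (d + 1)) M := chart_mem_atlas _ _
  obtain ⟨x, hx⟩ : ∃ x : ℝ → Coord (d + 1), ∀ t, x t = e (f q t) := ⟨_, fun _ ↦ rfl⟩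
  obtain ⟨v, hv⟩ : ∃ v : ℝ → Coord (d + 1), ∀ t, v t = mfderiv (𝓡 (d + 1)) (𝓡 (d + 1)) e (f q t)
      (velocity (d + 1) (f q) (Set.Ico 0 T) t) := ⟨_, fun _ ↦ rfl⟩
  obtain ⟨τ, hτ⟩ : ∃ τ : ℝ → Coord (d + 1), ∀ t, τ t = mfderiv (𝓡 (d + 1)) (𝓡 (d + 1)) e (f q t)
      (mfderiv (𝓡 d) (𝓡 (d + 1)) (fun q' ↦ f q' t) q ξ) := ⟨_, fun _ ↦ rfl⟩
  obtain ⟨δ, hδ, J, τ', hJ, hsrc, hv0, hxc, hvc, hτc, hτ'c, -, hφ, hψ, -⟩ :=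
    hf.exists_variation hF q ξ he ht₀ hs hx hv hτ
  have hxt : ∀ t ∈ J, x t ∈ e.target := fun t ht ↦ hx t ▸ e.map_source (hsrc t ht)
  have hpair : ∀ t ∈ J, pairing T f q ξ t = metricForm e (x t) (v t) (τ t) := fun t ht ↦ by
    rw [hx, hv, hτ]; exact inner_eq_metricForm he (hsrc t ht) _ _
  have hφ' : ∀ t ∈ J, HasDerivWithinAt (pairing T f q ξ)
      (pairingRate F e (x t) (v t) (τ t) (τ' t)) J t :=
    fun t ht ↦ (hφ t ht).congr hpair (hpair t ht)
  have hIoo : ∀ t ∈ J, Set.Ioo (t₀ - δ) (t₀ + δ) ∈ 𝓝 t := fun t ht ↦ by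
    rw [hJ] at ht; exact isOpen_Ioo.mem_nhds ht.2
  have hd : ∀ t ∈ J, derivWithin (pairing T f q ξ) (Set.Ico 0 T) t =
      pairingRate F e (x t) (v t) (τ t) (τ' t) := fun t ht ↦ by
    have h1 := hφ' t ht
    rw [hJ] at h1
    have htI : t ∈ Set.Ico 0 T := by rw [hJ] at ht; exact ht.1
    exact ((hasDerivWithinAt_inter (hIoo t ht)).1 h1).derivWithin (uniqueDiffOn_Ico 0 T t htI)
  have hWN := fun t ht ↦ (weakNormality_iff hF he (hxt t ht) (hv0 t ht)).1
    (hW e he (x t) (hxt t ht) (v t) (hv0 t ht))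
  -- The equation φ'' = μφ + λφ', with μ from the second and λ from the first weak normality
  -- equation.
  have hψ' : ∀ t ∈ J, HasDerivWithinAt (fun t ↦ pairingRate F e (x t) (v t) (τ t) (τ' t))
      (normalityForm₂ F e (x t) (v t) (v t) / metricForm e (x t) (v t) (v t) * pairing T f q ξ t
        + normalityFactor F e (x t) (v t) * pairingRate F e (x t) (v t) (τ t) (τ' t)) J t := by
    intro t ht
    refine (hψ t ht).congr_deriv ?_
    rw [variation_eq_of_normality₁ he (hxt t ht) (hv0 t ht) (hWN t ht).1,
      normalityForm₂_eq_mul he (hxt t ht) (hv0 t ht) (hWN t ht).2, hpair t ht]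
  have hJc : J.OrdConnected := by
    rw [hJ]; exact Set.ordConnected_Ico.inter Set.ordConnected_Ioo
  have hμc : ContinuousOn (fun t ↦ normalityForm₂ F e (x t) (v t) (v t) /
      metricForm e (x t) (v t) (v t)) J :=
    (continuousOn_normalityForm₂ hF he hxc hvc hvc hxt hv0).div
      (continuousOn_metricForm_comp he hxc hvc hvc hxt)
      fun t ht ↦ (metricForm_pos he (hxt t ht) (hv0 t ht)).ne'
  have hprop : ∀ s ∈ J, ∀ t ∈ J,
      (pairing T f q ξ s = 0 ∧ derivWithin (pairing T f q ξ) (Set.Ico 0 T) s = 0) →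
      (pairing T f q ξ t = 0 ∧ derivWithin (pairing T f q ξ) (Set.Ico 0 T) t = 0) := by
    intro s hs t ht h
    rw [hd s hs] at h
    rw [hd t ht]
    exact eq_zero_of_linear_ode hJc hφ' hψ' hμc
      (continuousOn_normalityFactor hF he hxc hvc hxt hv0) hs h.1 h.2 ht
  have ht₀J : t₀ ∈ J := by rw [hJ]; exact ⟨ht₀, by linarith, by linarith⟩
  have hJnhds : J ∈ 𝓝[Set.Ico 0 T] t₀ := by
    rw [hJ]
    exact Filter.inter_mem self_mem_nhdsWithin
      (mem_nhdsWithin_of_mem_nhds (Ioo_mem_nhds (by linarith) (by linarith)))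
  filter_upwards [hJnhds] with t ht
  exact ⟨hprop t₀ ht₀J t ht, hprop t ht t₀ ht₀J⟩

/-- Under the weak normality equations every blow-up is normal. -/
theorem IsBlowUp.isNormal (hF : F.IsSmooth) (hW : SatisfiesWeakNormality F)
    (hf : IsBlowUp F p₀ ν₀ T f) : IsNormal T f := by
  intro t ht q ξ
  -- A trajectory may leave every chart, so the local results are chained by connectedness of [0,
  -- T). The Cauchy data are stated without a chart for this purpose.
  have h := (isPreconnected_Ico (a := (0 : ℝ)) (b := T)).induction₂
    (fun s t ↦ (pairing T f q ξ s = 0 ∧ derivWithin (pairing T f q ξ) (Set.Ico 0 T) s = 0) ↔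
      (pairing T f q ξ t = 0 ∧ derivWithin (pairing T f q ξ) (Set.Ico 0 T) t = 0))
    (fun s hs ↦ hf.pairing_locally_zero hF hW q ξ hs) (fun _ _ _ _ _ _ h h' ↦ h.trans h')
    (fun _ _ _ _ h ↦ h.symm) (x := 0) ⟨le_rfl, ht.1.trans ht.2⟩ ⟨ht.1.le, ht.2⟩
  exact (h.1 (hf.pairing_zero hF (ht.1.trans ht.2) q ξ)).1

/-- A normal blow-up of a point forces the weak normality conditions for its initial velocities; the
second one requires the first one along the trajectories. -/
theorem IsBlowUp.normality_initial (hF : F.IsSmooth) {e : OpenPartialHomeomorph M (Coord (d + 1))}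
    (he : e ∈ atlas (Coord (d + 1)) M) {x₀ v₀ z : Coord (d + 1)} (hx₀ : x₀ ∈ e.target)
    {f : UnitSphere d (e.symm x₀) → ℝ → M} (hf : IsBlowUp F (e.symm x₀) ν₀ T f) (hν : ν₀ ≠ 0)
    (hT : 0 < T) (hN : IsNormal T f) (q : UnitSphere d (e.symm x₀))
    (hq : ν₀ • (q : TangentSpace (𝓡 (d + 1)) (e.symm x₀)) = ofCoords e x₀ v₀)
    (hz : metricForm e x₀ v₀ z = 0) :
    normalityForm₁ F e x₀ v₀ z = 0 ∧
      ((∀ x ∈ e.target, ∀ v, v ≠ 0 → ∀ z, metricForm e x v z = 0 → normalityForm₁ F e x v z = 0) →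
        normalityForm₂ F e x₀ v₀ z = 0) := by
  have h0 : (0 : ℝ) ∈ Set.Ico 0 T := ⟨le_rfl, hT⟩
  -- The factor ν₀⁻¹ is chosen so that τ'(0) = ν₀ξ is z.
  obtain ⟨ξ, hξ⟩ := exists_sphereIncl_eq q (η := ν₀⁻¹ • ofCoords e x₀ z) (by
    rw [metricForm_apply, ← hq, inner_smul_left] at hz
    rw [inner_smul_right]
    rcases mul_eq_zero.1 hz with h | h
    · exact absurd h (by simpa using hν)
    · rw [h, mul_zero])
  obtain ⟨x, hx⟩ : ∃ x : ℝ → Coord (d + 1), ∀ t, x t = e (f q t) := ⟨_, fun _ ↦ rfl⟩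
  obtain ⟨v, hv⟩ : ∃ v : ℝ → Coord (d + 1), ∀ t, v t = mfderiv (𝓡 (d + 1)) (𝓡 (d + 1)) e (f q t)
      (velocity (d + 1) (f q) (Set.Ico 0 T) t) := ⟨_, fun _ ↦ rfl⟩
  obtain ⟨τ, hτ⟩ : ∃ τ : ℝ → Coord (d + 1), ∀ t, τ t = mfderiv (𝓡 (d + 1)) (𝓡 (d + 1)) e (f q t)
      (mfderiv (𝓡 d) (𝓡 (d + 1)) (fun q' ↦ f q' t) q ξ) := ⟨_, fun _ ↦ rfl⟩
  have hx0 : x 0 = x₀ := by rw [hx, hf.apply_zero, e.right_inv hx₀]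
  have hv0 : v 0 = v₀ := by
    refine ((hv 0).trans (hf.mfderiv_velocity_zero e q)).trans ?_
    rw [hq]
    exact mfderiv_ofCoords he hx₀ v₀
  have hτ0 : τ 0 = 0 := by rw [hτ, hf.mfderiv_zero]; exact map_zero _
  obtain ⟨δ, hδ, J, τ', hJ, hsrc, hv0', hxc, hvc, hτc, hτ'c, hτd, hφ, hψ, hτ'⟩ :=
    hf.exists_variation hF q ξ he h0 (by rw [hf.apply_zero]; exact e.map_target hx₀) hx hv hτ
  have h0J : (0 : ℝ) ∈ J := by rw [hJ]; exact ⟨h0, by linarith, by linarith⟩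
  have hJu : UniqueDiffOn ℝ J := by rw [hJ]; exact uniqueDiffOn_strip
  have hτ'0 : τ' 0 = z := by
    rw [hτ' h0J]
    have h : ν₀ • sphereIncl q ξ = ofCoords e x₀ z := by rw [hξ, smul_inv_smul₀ hν]
    refine (congrArg (fun w ↦ (mfderiv (𝓡 (d + 1)) (𝓡 (d + 1)) e (e.symm x₀) w : Coord (d + 1)))
      h).trans ?_
    exact mfderiv_ofCoords he hx₀ z
  have hxt : ∀ t ∈ J, x t ∈ e.target := fun t ht ↦ hx t ▸ e.map_source (hsrc t ht)
  -- Normality speaks only of t > 0; at t = 0 the pairing vanishes because τ does.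
  have hφ0 : ∀ t ∈ J, metricForm e (x t) (v t) (τ t) = 0 := by
    intro t ht
    have htI : t ∈ Set.Ico 0 T := by rw [hJ] at ht; exact ht.1
    rcases htI.1.eq_or_lt with h | h
    · rw [← h, hτ0, map_zero]
    · rw [hx, hv, hτ]
      exact (inner_eq_metricForm he (hsrc t ht) _ _).symm.trans (hN t ⟨h, htI.2⟩ q ξ)
  have hψ0 : ∀ t ∈ J, pairingRate F e (x t) (v t) (τ t) (τ' t) = 0 := fun t ht ↦
    (hJu t ht).eq_deriv _ ((hφ t ht).congr (fun t ht ↦ (hφ0 t ht).symm) (hφ0 t ht).symm)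
      (hasDerivWithinAt_const t J (0 : ℝ))
  have hχ0 : ∀ t ∈ J,
      variationForm F e (x t) (v t) (τ t) + normalityForm₁ F e (x t) (v t) (τ' t) = 0 := fun t ht ↦
    (hJu t ht).eq_deriv _ ((hψ t ht).congr (fun t ht ↦ (hψ0 t ht).symm) (hψ0 t ht).symm)
      (hasDerivWithinAt_const t J (0 : ℝ))
  refine ⟨?_, fun h₁ ↦ ?_⟩
  -- At t = 0 the term in τ drops out of φ'' = 0 and only `normalityForm₁` at τ'(0) = z is left.
  · have h := hχ0 0 h0J
    rw [hτ0, hx0, hv0, hτ'0] at h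
    have h' : variationForm F e x₀ v₀ 0 = 0 := by
      rw [variationForm, map_zero, map_zero, Prod.mk_zero_zero, map_zero]
      simp
    rwa [h', zero_add] at h
  · have h₂ : ∀ t ∈ J, normalityForm₂ F e (x t) (v t) (τ t) = 0 := by
      intro t ht
      have h := hχ0 t ht
      rwa [variation_eq_of_normality₁ he (hxt t ht) (hv0' t ht) (h₁ _ (hxt t ht) _ (hv0' t ht)),
        hψ0 t ht, mul_zero, add_zero] at h
    -- Evaluating at t = 0 gives nothing since τ(0) = 0, so τ(t)/t → z is used. The form varies with
    -- t as well; expansion in the basis splits the limit into those of the slopes and of the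
    -- coefficients.
    have hsum : ∀ t ∈ J, ∀ w, normalityForm₂ F e (x t) (v t) w =
        ∑ i, w i * normalityForm₂ F e (x t) (v t) (EuclideanSpace.single i 1) := by
      intro t ht w
      simp only [← normalityLin₂_apply he (hxt t ht)]
      exact linearMap_eq_sum _ w
    have hslope : Filter.Tendsto (slope τ 0) (𝓝[J \ {0}] 0) (𝓝 z) :=
      hτ'0 ▸ hasDerivWithinAt_iff_tendsto_slope.1 (hτd 0 h0J)
    have hlim : Filter.Tendsto (fun t ↦ ∑ i, slope τ 0 t i *
        normalityForm₂ F e (x t) (v t) (EuclideanSpace.single i 1)) (𝓝[J \ {0}] 0)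
        (𝓝 (∑ i, z i * normalityForm₂ F e (x 0) (v 0) (EuclideanSpace.single i 1))) := by
      refine tendsto_finsetSum _ fun i _ ↦ Filter.Tendsto.mul ?_ ?_
      · exact ((EuclideanSpace.proj (𝕜 := ℝ) i).continuous.tendsto z).comp hslope
      · exact ((continuousOn_normalityForm₂ hF he hxc hvc continuousOn_const hxt hv0') 0
          h0J).mono_left (nhdsWithin_mono _ Set.sdiff_subset)
    have hzero : ∀ᶠ t in 𝓝[J \ {0}] 0, ∑ i, slope τ 0 t i *
        normalityForm₂ F e (x t) (v t) (EuclideanSpace.single i 1) = 0 := by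
      filter_upwards [self_mem_nhdsWithin] with t ht
      rw [← hsum t ht.1, ← normalityLin₂_apply he (hxt t ht.1), slope_def_module, hτ0,
        sub_zero (τ t), map_smul,
        normalityLin₂_apply he (hxt t ht.1), h₂ t ht.1, smul_zero]
    have hne : (𝓝[J \ {0}] (0 : ℝ)).NeBot :=
      accPt_principal_iff_nhdsWithin.1 (uniqueDiffWithinAt_iff_accPt.1 (hJu 0 h0J))
    have h := tendsto_nhds_unique (hlim.congr' hzero) tendsto_const_nhds
    rwa [← hsum 0 h0J, hx0, hv0] at h

end Newtonian

namespace Newtonian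

/-- If points admit normal blow-ups, then the weak normality equations hold. -/
theorem AdmitsNormalBlowUp.satisfiesWeakNormality {d : ℕ} {M : Type*} [TopologicalSpace M]
    [ChartedSpace (Coord (d + 1)) M] [IsManifold (𝓡 (d + 1)) ∞ M]
    [Bundle.RiemannianBundle (fun p : M ↦ TangentSpace (𝓡 (d + 1)) p)]
    [IsContMDiffRiemannianBundle (𝓡 (d + 1)) ∞ (Coord (d + 1))
      (fun p : M ↦ TangentSpace (𝓡 (d + 1)) p)] {F : ForceField (d + 1) M} (hF : F.IsSmooth)
    (h : AdmitsNormalBlowUp F) : SatisfiesWeakNormality F := by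
  have key : ∀ e ∈ atlas (Coord (d + 1)) M, ∀ x ∈ e.target, ∀ v, v ≠ 0 → ∀ z,
      metricForm e x v z = 0 → normalityForm₁ F e x v z = 0 ∧
      ((∀ x ∈ e.target, ∀ v, v ≠ 0 → ∀ z, metricForm e x v z = 0 → normalityForm₁ F e x v z = 0) →
        normalityForm₂ F e x v z = 0) := by
    intro e he x hx v hv z hz
    -- The state (x, v) starts the trajectory in direction v/|v| of the blow-up of its base point
    -- with initial speed |v|.
    have hν : 0 < ‖ofCoords e x v‖ := norm_pos_iff.2 (ofCoords_ne_zero he hx hv)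
    obtain ⟨T, hT, f, hf, hN⟩ := h (e.symm x) _ hν
    refine hf.normality_initial hF he hx hν.ne' hT hN
      ⟨‖ofCoords e x v‖⁻¹ • ofCoords e x v, ?_⟩ (smul_inv_smul₀ hν.ne' _) hz
    rw [mem_sphere_zero_iff_norm, norm_smul, norm_inv, norm_norm, inv_mul_cancel₀ hν.ne']
  intro e he x hx v hv
  exact (weakNormality_iff hF he hx hv).2 ⟨fun z hz ↦ (key e he x hx v hv z hz).1,
    fun z hz ↦ (key e he x hx v hv z hz).2 fun x hx v hv z hz ↦ (key e he x hx v hv z hz).1⟩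

end Newtonian

/-! ### Change of charts -/

namespace Newtonian

section Transition

variable {n : ℕ} {M : Type*} [TopologicalSpace M] [ChartedSpace (Coord n) M]
  [IsManifold (𝓡 n) ∞ M]
  {e e' : OpenPartialHomeomorph M (Coord n)} {F : ForceField n M} {x : Coord n}

lemma isOpen_transition (e e' : OpenPartialHomeomorph M (Coord n)) :
    IsOpen (e.target ∩ e.symm ⁻¹' e'.source) :=
  e.symm.isOpen_inter_preimage e'.open_source

lemma contDiffOn_transition (he : e ∈ atlas (Coord n) M) (he' : e' ∈ atlas (Coord n) M) :
    ContDiffOn ℝ ∞ (e' ∘ e.symm) (e.target ∩ e.symm ⁻¹' e'.source) := by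
  rw [← contMDiffOn_iff_contDiffOn]
  exact (contMDiffOn_of_mem_maximalAtlas (IsManifold.subset_maximalAtlas he')).comp
    ((contMDiffOn_symm_of_mem_maximalAtlas (IsManifold.subset_maximalAtlas he)).mono
      Set.inter_subset_left) fun x hx ↦ hx.2

lemma mfderiv_ofCoords_transition (he : e ∈ atlas (Coord n) M) (he' : e' ∈ atlas (Coord n) M)
    (hx : x ∈ e.target) (hx' : e.symm x ∈ e'.source) (u : Coord n) :
    mfderiv (𝓡 n) (𝓡 n) e' (e.symm x) (ofCoords e x u) = fderiv ℝ (e' ∘ e.symm) x u := by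
  have h : mfderiv (𝓡 n) (𝓡 n) (e' ∘ e.symm) x u =
      mfderiv (𝓡 n) (𝓡 n) e' (e.symm x) (ofCoords e x u) := by
    rw [mfderiv_comp x ((mdifferentiable_of_mem_atlas he').mdifferentiableAt hx')
      ((mdifferentiable_of_mem_atlas he).mdifferentiableAt_symm hx)]
    rfl
  rw [mfderiv_eq_fderiv] at h
  exact h.symm

lemma fderiv_transition_surjective (he : e ∈ atlas (Coord n) M) (he' : e' ∈ atlas (Coord n) M)
    (hx : x ∈ e.target) (hx' : e.symm x ∈ e'.source) :
    Function.Surjective (fderiv ℝ (e' ∘ e.symm) x) := by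
  intro w
  obtain ⟨w', hw'⟩ := (mdifferentiable_of_mem_atlas he').mfderiv_surjective hx' w
  refine ⟨mfderiv (𝓡 n) (𝓡 n) e (e.symm x) w', ?_⟩
  have h := mfderiv_ofCoords_transition he he' hx hx' (mfderiv (𝓡 n) (𝓡 n) e (e.symm x) w')
  rw [ofCoords_mfderiv he hx] at h
  exact h.symm.trans hw'

/-- A tangent vector is determined by its base point and its components in a chart. -/
lemma mk_ofCoords_mfderiv (he : e ∈ atlas (Coord n) M) {p : M} (hp : p ∈ e.source)
    (w : TangentSpace (𝓡 n) p) :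
    (⟨e.symm (e p), ofCoords e (e p) (mfderiv (𝓡 n) (𝓡 n) e p w)⟩ : TangentBundle (𝓡 n) M) =
      ⟨p, w⟩ := by
  obtain ⟨x, hx, rfl⟩ : ∃ x ∈ e.target, e.symm x = p := ⟨e p, e.map_source hp, e.left_inv hp⟩
  rw [e.right_inv hx]
  exact congrArg (Bundle.TotalSpace.mk (e.symm x)) (ofCoords_mfderiv he hx w)

lemma forceUp_mfderiv (F : ForceField n M) (he : e ∈ atlas (Coord n) M) {p : M} (hp : p ∈ e.source)
    (w : TangentSpace (𝓡 n) p) :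
    forceUp F e (e p) (mfderiv (𝓡 n) (𝓡 n) e p w) = mfderiv (𝓡 n) (𝓡 n) e p (F p w) :=
  congrArg (fun X : TangentBundle (𝓡 n) M ↦
    (mfderiv (𝓡 n) (𝓡 n) e X.proj (F X.proj X.snd) : Coord n)) (mk_ofCoords_mfderiv he hp w)

lemma forceUp_transition (F : ForceField n M) (he : e ∈ atlas (Coord n) M)
    (he' : e' ∈ atlas (Coord n) M) (hx : x ∈ e.target) (hx' : e.symm x ∈ e'.source) (v : Coord n) :
    forceUp F e' ((e' ∘ e.symm) x) (fderiv ℝ (e' ∘ e.symm) x v) =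
      fderiv ℝ (e' ∘ e.symm) x (forceUp F e x v) := by
  rw [← mfderiv_ofCoords_transition he he' hx hx', ← mfderiv_ofCoords_transition he he' hx hx',
    ofCoords_forceUp F he hx]
  exact forceUp_mfderiv F he' hx' _

variable [Bundle.RiemannianBundle (fun p : M ↦ TangentSpace (𝓡 n) p)]

lemma metricForm_transition (he : e ∈ atlas (Coord n) M) (he' : e' ∈ atlas (Coord n) M)
    (hx : x ∈ e.target) (hx' : e.symm x ∈ e'.source) (u w : Coord n) :
    metricForm e' ((e' ∘ e.symm) x) (fderiv ℝ (e' ∘ e.symm) x u) (fderiv ℝ (e' ∘ e.symm) x w) =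
      metricForm e x u w := by
  rw [← mfderiv_ofCoords_transition he he' hx hx', ← mfderiv_ofCoords_transition he he' hx hx']
  exact (inner_eq_metricForm he' hx' _ _).symm

lemma forceForm_transition (F : ForceField n M) (he : e ∈ atlas (Coord n) M)
    (he' : e' ∈ atlas (Coord n) M) (hx : x ∈ e.target) (hx' : e.symm x ∈ e'.source)
    (v z : Coord n) :
    forceForm F e' ((e' ∘ e.symm) x, fderiv ℝ (e' ∘ e.symm) x v) (fderiv ℝ (e' ∘ e.symm) x z) =
      forceForm F e (x, v) z := by
  change metricForm e' _ (forceUp F e' ((e' ∘ e.symm) x) (fderiv ℝ (e' ∘ e.symm) x v)) _ = _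
  rw [forceUp_transition F he he' hx hx', metricForm_transition he he' hx hx']
  rfl

variable [IsContMDiffRiemannianBundle (𝓡 n) ∞ (Coord n) (fun p : M ↦ TangentSpace (𝓡 n) p)]

/-- Differentiation of the invariance `metricForm_transition`. The terms with the second derivative
of the coordinate change produce the inhomogeneous term in the transformation law of the
acceleration. -/
lemma fderiv_metricForm_transition (he : e ∈ atlas (Coord n) M) (he' : e' ∈ atlas (Coord n) M)
    (hx : x ∈ e.target) (hx' : e.symm x ∈ e'.source) (h u w : Coord n) :
    fderiv ℝ (metricForm e) x h u w =
      fderiv ℝ (metricForm e') ((e' ∘ e.symm) x) (fderiv ℝ (e' ∘ e.symm) x h)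
        (fderiv ℝ (e' ∘ e.symm) x u) (fderiv ℝ (e' ∘ e.symm) x w)
      + metricForm e' ((e' ∘ e.symm) x) (fderiv ℝ (fderiv ℝ (e' ∘ e.symm)) x h u)
        (fderiv ℝ (e' ∘ e.symm) x w)
      + metricForm e' ((e' ∘ e.symm) x) (fderiv ℝ (e' ∘ e.symm) x u)
        (fderiv ℝ (fderiv ℝ (e' ∘ e.symm)) x h w) := by
  have hxU : x ∈ e.target ∩ e.symm ⁻¹' e'.source := ⟨hx, hx'⟩
  have hU := (isOpen_transition e e').mem_nhds hxU
  have h1 : ContDiffAt ℝ ∞ (e' ∘ e.symm) x := (contDiffOn_transition he he').contDiffAt hU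
  have h2 : ContDiffAt ℝ ∞ (fderiv ℝ (e' ∘ e.symm)) x := h1.fderiv_right (by simp)
  have d1 := (h1.differentiableAt (by simp)).hasFDerivAt
  have d2 := (h2.differentiableAt (by simp)).hasFDerivAt
  obtain ⟨A, hA, hA'⟩ := hasFDerivWithinAt_metricForm_comp he' (e'.map_source hx')
    (Y := e' ∘ e.symm) (U := fun x ↦ fderiv ℝ (e' ∘ e.symm) x u)
    (W := fun x ↦ fderiv ℝ (e' ∘ e.symm) x w) (d1.hasFDerivWithinAt (s := Set.univ))
    (d2.clm_apply (hasFDerivAt_const u x)).hasFDerivWithinAt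
    (d2.clm_apply (hasFDerivAt_const w x)).hasFDerivWithinAt
  have h3 : HasFDerivAt (fun x ↦ metricForm e x u w) A x :=
    (hasFDerivWithinAt_univ.1 hA).congr_of_eventuallyEq
      (Filter.eventually_of_mem hU fun y hy ↦ (metricForm_transition he he' hy.1 hy.2 u w).symm)
  have h4 := h3.unique (hasFDerivAt_metricForm_apply he hx u w)
  have h5 := DFunLike.congr_fun h4 h
  rw [hA'] at h5
  simpa using h5.symm

/-- The transformation law of the coordinate acceleration under a change of charts. -/
lemma acceleration_transition (F : ForceField n M) (he : e ∈ atlas (Coord n) M)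
    (he' : e' ∈ atlas (Coord n) M) (hx : x ∈ e.target) (hx' : e.symm x ∈ e'.source) (v : Coord n) :
    acceleration F e' ((e' ∘ e.symm) x) (fderiv ℝ (e' ∘ e.symm) x v) =
      fderiv ℝ (fderiv ℝ (e' ∘ e.symm)) x v v + fderiv ℝ (e' ∘ e.symm) x (acceleration F e x v) := by
  refine metricForm_ext he' (e'.map_source hx') fun z' ↦ ?_
  obtain ⟨z, rfl⟩ := fderiv_transition_surjective he he' hx hx' z'
  -- Paired with the image of z, the unwanted terms containing this second derivative at (v, z) and
  -- at (z, v) cancel; only the one at (v, v) survives.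
  have hsymm : fderiv ℝ (fderiv ℝ (e' ∘ e.symm)) x v z = fderiv ℝ (fderiv ℝ (e' ∘ e.symm)) x z v :=
    (((contDiffOn_transition he he').contDiffAt
      ((isOpen_transition e e').mem_nhds ⟨hx, hx'⟩)).isSymmSndFDerivAt
      (by simp only [minSmoothness_of_isRCLikeNormedField]; exact ENat.LEInfty.out)) v z
  rw [map_add, _root_.add_apply]
  have h1 := metricForm_acceleration (F := F) he' (e'.map_source hx')
    (fderiv ℝ (e' ∘ e.symm) x v) (fderiv ℝ (e' ∘ e.symm) x z)
  have h2 := metricForm_acceleration (F := F) he hx v z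
  rw [fderiv_metricForm_transition he he' hx hx', fderiv_metricForm_transition he he' hx hx',
    hsymm, ← forceForm_transition F he he' hx hx',
    ← metricForm_transition he he' hx hx' (acceleration F e x v)] at h2
  have h3 := metricForm_comm e' ((e' ∘ e.symm) x) (fderiv ℝ (fderiv ℝ (e' ∘ e.symm)) x z v)
    (fderiv ℝ (e' ∘ e.symm) x v)
  simp only [Function.comp_apply] at *
  linarith

end Transition

end Newtonian

/-! ### Short-time flow of a second order equation -/

namespace SmoothFlow

/-- A smooth map on an open set agrees near a compact subset with a globally smooth and Lipschitz
map. -/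
lemma exists_lipschitz_eq_nhdsSet {E G : Type*} [NormedAddCommGroup E] [NormedSpace ℝ E]
    [FiniteDimensional ℝ E] [NormedAddCommGroup G] [NormedSpace ℝ G] {U K : Set E} (hU : IsOpen U)
    {g : E → G} (hg : ContDiffOn ℝ ∞ g U) (hK : IsCompact K) (hKU : K ⊆ U) :
    ∃ f : E → G, ContDiff ℝ ∞ f ∧ (∃ L, LipschitzWith L f) ∧ ∀ᶠ z in 𝓝ˢ K, f z = g z := by
  have : ProperSpace E := FiniteDimensional.proper_real E
  obtain ⟨K', hK', hKK', hK'U⟩ := exists_compact_between hK hU hKU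
  obtain ⟨χ, hχ0, hχ1, -⟩ := exists_contMDiffMap_zero_one_nhds_of_isClosed 𝓘(ℝ, E) (n := ⊤)
    (isOpen_interior (s := K')).isClosed_compl hK.isClosed
    (Set.disjoint_compl_left_iff_subset.2 hKK')
  have hχ : ContDiff ℝ ∞ χ := χ.contMDiff.contDiff
  -- Nothing is known of g outside U, but the cut-off vanishes near every point outside the interior
  -- of K'.
  have hzero : ∀ z ∉ interior K', (fun z ↦ χ z • g z) =ᶠ[𝓝 z] fun _ ↦ 0 := by
    intro z hz
    filter_upwards [hχ0.filter_mono (nhds_le_nhdsSet hz)] with y hy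
    rw [hy, zero_smul]
  have hsmooth : ContDiff ℝ ∞ (fun z ↦ χ z • g z) := by
    rw [contDiff_iff_contDiffAt]
    intro z
    by_cases hz : z ∈ interior K'
    · exact hχ.contDiffAt.smul (hg.contDiffAt (hU.mem_nhds (hK'U (interior_subset hz))))
    · exact contDiffAt_const.congr_of_eventuallyEq (hzero z hz)
  refine ⟨fun z ↦ χ z • g z, hsmooth, hsmooth.lipschitzWith_of_hasCompactSupport ?_ (by simp), ?_⟩
  · exact HasCompactSupport.intro hK' fun z hz ↦
      (hzero z fun h ↦ hz (interior_subset h)).self_of_nhds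
  · filter_upwards [hχ1] with z hz
    rw [hz, one_smul]

/-- The flow of a smooth second order equation near a compact set of initial data: for short times,
the positions issuing from one point separate the initial velocities. -/
theorem exists_second_order_flow {E : Type*} [NormedAddCommGroup E] [NormedSpace ℝ E]
    [FiniteDimensional ℝ E] {U K : Set (E × E)} (hU : IsOpen U) {a : E × E → E}
    (ha : ContDiffOn ℝ ∞ a U) (hK : IsCompact K) (hKU : K ⊆ U) :
    ∃ T > 0, ∃ Φ : (E × E) × ℝ → E × E, (∀ z, Φ (z, 0) = z) ∧
      ContDiffOn ℝ ∞ Φ (Set.univ ×ˢ Set.Ioo (-T) T) ∧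
      (∀ z ∈ K, ∀ t ∈ Set.Ioo (-T) T, Φ (z, t) ∈ U ∧
        HasDerivAt (fun s ↦ (Φ (z, s)).1) (Φ (z, t)).2 t ∧
        HasDerivAt (fun s ↦ (Φ (z, s)).2) (a (Φ (z, t))) t) ∧
      ∀ z ∈ K, ∀ z' ∈ K, z.1 = z'.1 → ∀ t ∈ Set.Ico 0 T,
        t / 2 * ‖z.2 - z'.2‖ ≤ ‖(Φ (z, t)).1 - (Φ (z', t)).1‖ := by
  have : CompleteSpace E := FiniteDimensional.complete ℝ E
  obtain ⟨f, hf, ⟨L, hL⟩, hfg⟩ := exists_lipschitz_eq_nhdsSet hU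
    (g := fun z : E × E ↦ (z.2, a z)) (contDiff_snd.contDiffOn.prodMk ha) hK hKU
  obtain ⟨ε, hε, C, hC, Φ, hΦ0, hΦs, hΦd, hΦC⟩ := exists_flow hf hL
  obtain ⟨N, hNo, hKN, hN⟩ := eventually_nhdsSet_iff_exists.1
    (hfg.and (show ∀ᶠ z in 𝓝ˢ K, z ∈ U from hU.mem_nhdsSet.2 hKU))
  -- The tube lemma yields one time interval on which all orbits from K stay where the cut-off field
  -- is the original one.
  have hopen : IsOpen ((Set.univ ×ˢ Set.Ioo (-ε) ε) ∩ Φ ⁻¹' N) :=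
    hΦs.continuousOn.isOpen_inter_preimage (isOpen_univ.prod isOpen_Ioo) hNo
  obtain ⟨u, v, -, hv, hKu, h0v, huv⟩ := generalized_tube_lemma hK (isCompact_singleton (x := (0 : ℝ)))
    hopen (by
      rintro ⟨z, t⟩ ⟨hz, rfl⟩
      exact ⟨Set.mk_mem_prod trivial ⟨by linarith, hε⟩, by simpa [hΦ0] using hKN hz⟩)
  obtain ⟨δ, hδ, hball⟩ := Metric.isOpen_iff.1 hv 0 (h0v rfl)
  rw [Real.ball_eq_Ioo, zero_sub, zero_add] at hball
  -- The last bound makes the error C t² ‖w‖ below at most half of the main term t ‖w‖.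
  set T := min (min ε δ) (1 / (2 * C)) with hT
  have hTε : T ≤ ε := (min_le_left _ _).trans (min_le_left _ _)
  have hTδ : T ≤ δ := (min_le_left _ _).trans (min_le_right _ _)
  have hTC : T ≤ 1 / (2 * C) := min_le_right _ _
  have hmem : ∀ z ∈ K, ∀ t ∈ Set.Ioo (-T) T, Φ (z, t) ∈ N := fun z hz t ht ↦
    (huv (Set.mk_mem_prod (hKu hz)
      (hball ⟨by linarith [ht.1], by linarith [ht.2]⟩) : ((z, t) : (E × E) × ℝ) ∈ u ×ˢ v)).2
  have hsub : Set.Ioo (-T) T ⊆ Set.Ioo (-ε) ε := Set.Ioo_subset_Ioo (neg_le_neg hTε) hTε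
  have hd : ∀ z ∈ K, ∀ t ∈ Set.Ioo (-T) T,
      HasDerivAt (fun s ↦ Φ (z, s)) ((Φ (z, t)).2, a (Φ (z, t))) t := by
    intro z hz t ht
    have h := hΦd z t (hsub ht)
    rwa [(hN _ (hmem z hz t ht)).1] at h
  have hd1 : ∀ z ∈ K, ∀ t ∈ Set.Ioo (-T) T,
      HasDerivAt (fun s ↦ (Φ (z, s)).1) (Φ (z, t)).2 t := fun z hz t ht ↦ (hd z hz t ht).fst
  refine ⟨T, lt_min (lt_min hε hδ) (by positivity), Φ, hΦ0,
    hΦs.mono (Set.prod_mono_right hsub), fun z hz t ht ↦ ⟨(hN _ (hmem z hz t ht)).2, hd1 z hz t ht,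
      (hd z hz t ht).snd⟩, ?_⟩
  intro z hz z' hz' hzz' t ht
  set w := z.2 - z'.2 with hw
  have hnorm : ‖z - z'‖ = ‖w‖ := by
    rw [Prod.norm_def, Prod.fst_sub, hzz', sub_self, norm_zero, Prod.snd_sub]
    exact max_eq_right (norm_nonneg _)
  have hIcc : ∀ s ∈ Set.Icc 0 t, s ∈ Set.Ioo (-T) T := fun s hs ↦
    ⟨by linarith [hs.1, hs.2, ht.1, ht.2], by linarith [hs.2, ht.2]⟩
  -- The difference of positions minus s • w has derivative the difference of velocities minus w,
  -- which the flow estimate bounds by C s ‖w‖.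
  have hest := norm_image_sub_le_of_norm_deriv_le_segment' (a := 0) (b := t) (C := C * t * ‖w‖)
    (f := fun s ↦ (Φ (z, s)).1 - (Φ (z', s)).1 - s • w)
    (f' := fun s ↦ (Φ (z, s)).2 - (Φ (z', s)).2 - w)
    (fun s hs ↦ by
      have h3 : HasDerivAt (fun s : ℝ ↦ s • w) w s := by
        simpa using (hasDerivAt_id s).smul_const w
      exact (((hd1 z hz s (hIcc s hs)).sub (hd1 z' hz' s (hIcc s hs))).sub h3).hasDerivWithinAt)
    (fun s hs ↦ by
      have h1 := hΦC z z' s (hsub (hIcc s ⟨hs.1, hs.2.le⟩))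
      rw [hnorm, abs_of_nonneg hs.1] at h1
      have h2 : ‖(Φ (z, s)).2 - (Φ (z', s)).2 - w‖ ≤ ‖Φ (z, s) - Φ (z', s) - (z - z')‖ :=
        norm_snd_le (Φ (z, s) - Φ (z', s) - (z - z'))
      refine h2.trans (h1.trans ?_)
      have := hs.2.le
      gcongr) t ⟨ht.1, le_rfl⟩
  simp only [hΦ0, hzz', sub_self, zero_smul, sub_zero] at hest
  have h4 : ‖t • w‖ ≤ ‖(Φ (z, t)).1 - (Φ (z', t)).1‖ + ‖(Φ (z, t)).1 - (Φ (z', t)).1 - t • w‖ := by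
    have := norm_sub_le ((Φ (z, t)).1 - (Φ (z', t)).1) ((Φ (z, t)).1 - (Φ (z', t)).1 - t • w)
    rwa [sub_sub_cancel] at this
  rw [norm_smul, Real.norm_of_nonneg ht.1] at h4
  have h5 : C * t ≤ 1 / 2 := by
    have h6 : t ≤ 1 / (2 * C) := ht.2.le.trans hTC
    rw [le_div_iff₀ (by positivity)] at h6
    linarith
  have h7 : C * t * ‖w‖ * t ≤ 1 / 2 * ‖w‖ * t := by
    have := ht.1
    gcongr
  linarith

end SmoothFlow

/-! ### Existence of blow-ups -/

namespace Newtonian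

section Trajectories

variable {n : ℕ} {M : Type*} [TopologicalSpace M] [ChartedSpace (Coord n) M]
  [IsManifold (𝓡 n) ∞ M] [Bundle.RiemannianBundle (fun p : M ↦ TangentSpace (𝓡 n) p)]
  [IsContMDiffRiemannianBundle (𝓡 n) ∞ (Coord n) (fun p : M ↦ TangentSpace (𝓡 n) p)]
  {e : OpenPartialHomeomorph M (Coord n)} {F : ForceField n M}

/-- A solution of the dynamical system in one chart is a trajectory. -/
lemma isTrajectoryOn_of_chart (he : e ∈ atlas (Coord n) M) {J : Set ℝ} (hJ : UniqueDiffOn ℝ J)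
    {x v : ℝ → Coord n} (hxs : ContDiffOn ℝ ∞ x J) (hxt : ∀ t ∈ J, x t ∈ e.target)
    (hx : ∀ t ∈ J, HasDerivWithinAt x (v t) J t)
    (hv : ∀ t ∈ J, HasDerivWithinAt v (acceleration F e (x t) (v t)) J t) :
    IsTrajectoryOn F (fun t ↦ e.symm (x t)) J := by
  refine ⟨((contMDiffOn_symm_of_mem_maximalAtlas (IsManifold.subset_maximalAtlas he)).comp
    hxs.contMDiffOn hxt).of_le ENat.LEInfty.out, fun e' he' t ht hs k ↦ ?_⟩
  have hy : ∀ s ∈ J, e.symm (x s) ∈ e'.source → HasDerivWithinAt (fun s ↦ e' (e.symm (x s)))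
      (fderiv ℝ (e' ∘ e.symm) (x s) (v s)) J s := fun s hs hs' ↦
    (((contDiffOn_transition he he').contDiffAt ((isOpen_transition e e').mem_nhds
      ⟨hxt s hs, hs'⟩)).differentiableAt (by simp)).hasFDerivAt.comp_hasDerivWithinAt s (hx s hs)
  have hy' : derivWithin (fun s ↦ e' (e.symm (x s))) J =ᶠ[𝓝[J] t]
      fun s ↦ fderiv ℝ (e' ∘ e.symm) (x s) (v s) := by
    filter_upwards [self_mem_nhdsWithin, (hx t ht).continuousWithinAt.preimage_mem_nhdsWithin
      ((isOpen_transition e e').mem_nhds ⟨hxt t ht, hs⟩)] with s hsJ hsU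
    exact (hy s hsJ hsU.2).derivWithin (hJ s hsJ)
  have hdd : HasFDerivAt (fderiv ℝ (e' ∘ e.symm)) (fderiv ℝ (fderiv ℝ (e' ∘ e.symm)) (x t)) (x t) :=
    ((((contDiffOn_transition he he').contDiffAt ((isOpen_transition e e').mem_nhds
      ⟨hxt t ht, hs⟩)).fderiv_right (m := ∞) (by simp)).differentiableAt (by simp)).hasFDerivAt
  have hy'' : HasDerivWithinAt (fun s ↦ fderiv ℝ (e' ∘ e.symm) (x s) (v s))
      (fderiv ℝ (fderiv ℝ (e' ∘ e.symm)) (x t) (v t) (v t) +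
        fderiv ℝ (e' ∘ e.symm) (x t) (acceleration F e (x t) (v t))) J t :=
    (hdd.comp_hasDerivWithinAt t (hx t ht)).clm_apply (hv t ht)
  have hat : derivWithin (fun s ↦ e' (e.symm (x s))) J t =
      fderiv ℝ (e' ∘ e.symm) (x t) (v t) := (hy t ht hs).derivWithin (hJ t ht)
  have h2 := (hy''.congr_of_eventuallyEq hy' hat).derivWithin (hJ t ht)
  rw [← acceleration_transition F he he' (hxt t ht) hs, acceleration] at h2
  simp only [hat, h2, sum_christoffel_eq, PiLp.sub_apply]
  exact sub_add_cancel _ _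

end Trajectories

/-- A derivative dominates another one if the increments do. -/
lemma norm_le_of_hasDerivAt {E G : Type*} [NormedAddCommGroup E] [NormedSpace ℝ E]
    [NormedAddCommGroup G] [NormedSpace ℝ G] {a : ℝ → E} {b : ℝ → G} {a' : E} {b' : G} {C : ℝ}
    (ha : HasDerivAt a a' 0) (hb : HasDerivAt b b' 0)
    (h : ∀ s, C * ‖b s - b 0‖ ≤ ‖a s - a 0‖) : C * ‖b'‖ ≤ ‖a'‖ := by
  have h1 := (hasDerivAt_iff_tendsto_slope.1 ha).norm
  have h2 := (hasDerivAt_iff_tendsto_slope.1 hb).norm.const_mul C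
  refine le_of_tendsto_of_tendsto h2 h1 (Filter.Eventually.of_forall fun s ↦ ?_)
  simp only [slope_def_module, norm_smul]
  rw [mul_left_comm]
  exact mul_le_mul_of_nonneg_left (h s) (norm_nonneg _)

/-- Every point has a blow-up with any positive initial speed. -/
theorem exists_isBlowUp {d : ℕ} {M : Type*} [TopologicalSpace M] [T2Space M]
    [ChartedSpace (Coord (d + 1)) M] [IsManifold (𝓡 (d + 1)) ∞ M]
    [Bundle.RiemannianBundle (fun p : M ↦ TangentSpace (𝓡 (d + 1)) p)]
    [IsContMDiffRiemannianBundle (𝓡 (d + 1)) ∞ (Coord (d + 1))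
      (fun p : M ↦ TangentSpace (𝓡 (d + 1)) p)] {F : ForceField (d + 1) M} (hF : F.IsSmooth)
    (p₀ : M) {ν₀ : ℝ} (hν : 0 < ν₀) :
    ∃ T > 0, ∃ f : UnitSphere d p₀ → ℝ → M, IsBlowUp F p₀ ν₀ T f := by
  have hp₀ : p₀ ∈ (chartAt (Coord (d + 1)) p₀).source := mem_chart_source _ _
  have he : chartAt (Coord (d + 1)) p₀ ∈ atlas (Coord (d + 1)) M := chart_mem_atlas _ _
  set e := chartAt (Coord (d + 1)) p₀
  have hee := mdifferentiable_of_mem_atlas he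
  -- L sends a direction q to the chart components of the initial velocity ν₀ q; it is injective.
  obtain ⟨L, hL⟩ : ∃ L : TangentSpace (𝓡 (d + 1)) p₀ →L[ℝ] Coord (d + 1),
      L = ν₀ • (mfderiv (𝓡 (d + 1)) (𝓡 (d + 1)) e p₀ :
        TangentSpace (𝓡 (d + 1)) p₀ →L[ℝ] Coord (d + 1)) := ⟨_, rfl⟩
  have hLapp : ∀ w, L w = mfderiv (𝓡 (d + 1)) (𝓡 (d + 1)) e p₀ (ν₀ • w) := fun w ↦ by
    rw [hL, map_smul]; rfl
  have hL0 : ∀ w, L w = 0 → w = 0 := fun w hw ↦ by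
    rw [hLapp] at hw
    have h := hee.mfderiv_injective hp₀ (hw.trans (map_zero _).symm)
    exact (smul_eq_zero.1 h).resolve_left hν.ne'
  have hfin : FiniteDimensional ℝ (TangentSpace (𝓡 (d + 1)) p₀) :=
    FiniteDimensional.of_fact_finrank_eq_succ d
  have hproper : ProperSpace (TangentSpace (𝓡 (d + 1)) p₀) := FiniteDimensional.proper_real _
  have hcoe : ContMDiff (𝓡 d) 𝓘(ℝ, TangentSpace (𝓡 (d + 1)) p₀) ∞
      (fun q : UnitSphere d p₀ ↦ (q : TangentSpace (𝓡 (d + 1)) p₀)) := contMDiff_coe_sphere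
  set z₀ : UnitSphere d p₀ → Coord (d + 1) × Coord (d + 1) := fun q ↦ (e p₀, L q) with hz₀
  have hz₀c : Continuous z₀ := continuous_const.prodMk (L.continuous.comp continuous_subtype_val)
  have hz₀s : ContMDiff (𝓡 d) 𝓘(ℝ, Coord (d + 1) × Coord (d + 1)) ∞ z₀ :=
    contMDiff_const.prodMk_space (L.contMDiff.comp hcoe)
  have hL0' : ∀ q : UnitSphere d p₀, L q ≠ 0 := fun q h ↦ by
    have h1 := mem_sphere_zero_iff_norm.1 q.2
    rw [hL0 _ h, norm_zero] at h1
    exact zero_ne_one h1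
  obtain ⟨T, hT, Φ, hΦ0, hΦs, hΦ, hΦsep⟩ := SmoothFlow.exists_second_order_flow (isOpen_phase e)
    (contDiffOn_acceleration hF he) (isCompact_range hz₀c) (by
      rintro _ ⟨q, rfl⟩
      exact Set.mk_mem_prod (e.map_source hp₀) (hL0' q))
  have hIco : ∀ t ∈ Set.Ico 0 T, t ∈ Set.Ioo (-T) T := fun t ht ↦ ⟨by linarith [ht.1], ht.2⟩
  set x : UnitSphere d p₀ → ℝ → Coord (d + 1) := fun q t ↦ (Φ (z₀ q, t)).1 with hx
  set v : UnitSphere d p₀ → ℝ → Coord (d + 1) := fun q t ↦ (Φ (z₀ q, t)).2 with hv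
  have hphase : ∀ q, ∀ t ∈ Set.Ico 0 T, x q t ∈ e.target ∧ v q t ≠ 0 := fun q t ht ↦
    (hΦ (z₀ q) ⟨q, rfl⟩ t (hIco t ht)).1
  have hxd : ∀ q, ∀ t ∈ Set.Ico 0 T, HasDerivAt (x q) (v q t) t := fun q t ht ↦
    (hΦ (z₀ q) ⟨q, rfl⟩ t (hIco t ht)).2.1
  have hvd : ∀ q, ∀ t ∈ Set.Ico 0 T, HasDerivAt (v q) (acceleration F e (x q t) (v q t)) t :=
    fun q t ht ↦ (hΦ (z₀ q) ⟨q, rfl⟩ t (hIco t ht)).2.2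
  have hsep : ∀ q q' : UnitSphere d p₀, ∀ t ∈ Set.Ico 0 T, t / 2 * ‖L q - L q'‖ ≤ ‖x q t - x q' t‖ :=
    fun q q' t ht ↦ hΦsep (z₀ q) ⟨q, rfl⟩ (z₀ q') ⟨q', rfl⟩ rfl t ht
  have hxs : ContMDiffOn ((𝓡 d).prod 𝓘(ℝ, ℝ)) 𝓘(ℝ, Coord (d + 1)) ∞
      (fun z : UnitSphere d p₀ × ℝ ↦ x z.1 z.2) (Set.univ ×ˢ Set.Ico 0 T) :=
    contDiff_fst.contMDiff.comp_contMDiffOn (hΦs.contMDiffOn.comp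
      ((hz₀s.comp contMDiff_fst).prodMk_space contMDiff_snd).contMDiffOn
      fun z hz ↦ Set.mk_mem_prod trivial (hIco _ hz.2))
  have hsymm : ContMDiffOn (𝓡 (d + 1)) (𝓡 (d + 1)) ∞ e.symm e.target :=
    contMDiffOn_symm_of_mem_maximalAtlas (IsManifold.subset_maximalAtlas he)
  have hJ : UniqueDiffOn ℝ (Set.Ico 0 T) := uniqueDiffOn_Ico 0 T
  have hsmooth : ContMDiffOn ((𝓡 d).prod 𝓘(ℝ, ℝ)) (𝓡 (d + 1)) ∞
      (fun z : UnitSphere d p₀ × ℝ ↦ e.symm (x z.1 z.2)) (Set.univ ×ˢ Set.Ico 0 T) :=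
    hsymm.comp hxs fun z hz ↦ (hphase z.1 z.2 hz.2).1
  have hslice : ∀ t ∈ Set.Ico 0 T, ContMDiff (𝓡 d) (𝓡 (d + 1)) ∞ (fun q ↦ x q t) := fun t ht ↦ by
    rw [← contMDiffOn_univ]
    exact hxs.comp (contMDiff_id.prodMk contMDiff_const).contMDiffOn
      fun q _ ↦ Set.mk_mem_prod trivial ht
  have hslice' : ∀ t ∈ Set.Ico 0 T, ContMDiff (𝓡 d) (𝓡 (d + 1)) ∞ (fun q ↦ e.symm (x q t)) :=
    fun t ht ↦ by
      rw [← contMDiffOn_univ]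
      exact hsmooth.comp (contMDiff_id.prodMk contMDiff_const).contMDiffOn
        fun q _ ↦ Set.mk_mem_prod trivial ht
  have htraj : ∀ q, IsTrajectoryOn F (fun t ↦ e.symm (x q t)) (Set.Ico 0 T) := fun q ↦ by
    refine isTrajectoryOn_of_chart he hJ ?_ (fun t ht ↦ (hphase q t ht).1)
      (fun t ht ↦ (hxd q t ht).hasDerivWithinAt) (fun t ht ↦ (hvd q t ht).hasDerivWithinAt)
    exact contDiff_fst.comp_contDiffOn (hΦs.comp
      (contDiff_const.prodMk contDiff_id).contDiffOn
      fun t ht ↦ Set.mk_mem_prod trivial (hIco t ht))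
  have hvel : ∀ q, ∀ t ∈ Set.Ico 0 T, (mfderiv (𝓡 (d + 1)) (𝓡 (d + 1)) e (e.symm (x q t))
      (velocity (d + 1) (fun t ↦ e.symm (x q t)) (Set.Ico 0 T) t) : Coord (d + 1)) = v q t := by
    intro q t ht
    have h1 := (htraj q).hasDerivWithinAt_chart he ht (e.map_target (hphase q t ht).1)
    exact (hJ t ht).eq_deriv _ (h1.congr (fun s hs ↦ (e.right_inv (hphase q s hs).1).symm)
      (e.right_inv (hphase q t ht).1).symm) (hxd q t ht).hasDerivWithinAt
  -- Separation of initial velocities: coinciding positions at a time t > 0 force L q = L q'.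
  have hinj : ∀ t ∈ Set.Ioo 0 T, Function.Injective (fun q ↦ e.symm (x q t)) := by
    intro t ht q q' h
    have ht' := Set.Ioo_subset_Ico_self ht
    have h1 : x q t = x q' t := e.symm.injOn (hphase q t ht').1 (hphase q' t ht').1 h
    have h2 := hsep q q' t ht'
    rw [h1, sub_self, norm_zero] at h2
    have h3 : ‖L q - L q'‖ = 0 := by
      refine le_antisymm ?_ (norm_nonneg _)
      have := ht.1
      exact nonpos_of_mul_nonpos_right h2 (by positivity)
    rw [norm_eq_zero, ← map_sub] at h3
    exact Subtype.ext (sub_eq_zero.1 (hL0 _ h3))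
  refine ⟨T, hT, fun q t ↦ e.symm (x q t), hsmooth, htraj, fun q ↦ ?_, fun q t ht h ↦ ?_,
    fun t ht ↦ ?_, fun t ht q ↦ ?_⟩
  · have h0 : (0 : ℝ) ∈ Set.Ico 0 T := ⟨le_rfl, hT⟩
    have hx0 : x q 0 = e p₀ := by simp [hx, hΦ0, hz₀]
    have hv0 : v q 0 = L q := by simp [hv, hΦ0, hz₀]
    rw [← mk_ofCoords_mfderiv he (e.map_target (hphase q 0 h0).1)
      (velocity (d + 1) (fun t ↦ e.symm (x q t)) (Set.Ico 0 T) 0), ← mk_ofCoords_mfderiv he hp₀]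
    -- Base point and vector are compared through coordinates, where the types do not depend on the
    -- point.
    have key : ∀ y y' w w' : Coord (d + 1), y = y' → w = w' →
        (⟨e.symm y, ofCoords e y w⟩ : TangentBundle (𝓡 (d + 1)) M) =
          ⟨e.symm y', ofCoords e y' w'⟩ := by
      rintro y _ w _ rfl rfl; rfl
    exact key _ _ _ _ ((e.right_inv (hphase q 0 h0).1).trans hx0)
      ((hvel q 0 h0).trans (hv0.trans (hLapp _)))
  · have h1 := hvel q t ht
    rw [h] at h1
    exact (hphase q t ht).2 (h1.symm.trans (map_zero _))
  · exact ((hslice' t (Set.Ioo_subset_Ico_self ht)).continuous.isClosedEmbedding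
      (hinj t ht)).isEmbedding
  · have ht' := Set.Ioo_subset_Ico_self ht
    refine (injective_iff_map_eq_zero _).2 fun ξ hξ ↦ ?_
    obtain ⟨c, -, -, -, hc0, hcd⟩ := exists_curve (n := d) q ξ
    have hxm : MDifferentiableAt (𝓡 d) (𝓡 (d + 1)) (fun q ↦ x q t) q :=
      (hslice t ht').mdifferentiableAt (by simp)
    have hLm : MDifferentiableAt (𝓡 d) 𝓘(ℝ, Coord (d + 1))
        (fun q : UnitSphere d p₀ ↦ L (q : TangentSpace (𝓡 (d + 1)) p₀)) q :=
      (L.contMDiff.comp hcoe).mdifferentiableAt (n := ∞) (by simp)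
    have hcm : MDifferentiableAt (𝓡 d) 𝓘(ℝ, TangentSpace (𝓡 (d + 1)) p₀)
        (fun q : UnitSphere d p₀ ↦ (q : TangentSpace (𝓡 (d + 1)) p₀)) q :=
      hcoe.mdifferentiableAt (by simp)
    have h1 : mfderiv (𝓡 d) (𝓡 (d + 1)) (fun q ↦ x q t) q ξ = 0 := by
      have h2 : (fun q ↦ x q t) = e ∘ fun q ↦ e.symm (x q t) :=
        funext fun q ↦ (e.right_inv (hphase q t ht').1).symm
      rw [h2, mfderiv_comp q (hee.mdifferentiableAt (e.map_target (hphase q t ht').1))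
        ((hslice' t ht').mdifferentiableAt (by simp))]
      exact (congrArg (mfderiv (𝓡 (d + 1)) (𝓡 (d + 1)) e (e.symm (x q t))) hξ).trans (map_zero _)
    -- Infinitesimal form of the separation estimate: (t/2) ‖L ξ‖ is at most the norm of the
    -- differential of the position on ξ, so the kernel is trivial.
    have h3 := L.hasFDerivAt.comp_hasDerivAt (0 : ℝ) (hcd hcm)
    have h4 := norm_le_of_hasDerivAt (hcd hxm) h3 (fun s ↦ hsep (c s) (c 0) t ht')
    have h5 : L (sphereIncl q ξ) = 0 := by
      have h6 : t / 2 * ‖L (sphereIncl q ξ)‖ ≤ 0 := by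
        refine h4.trans (le_of_eq ((norm_eq_zero (E := Coord (d + 1))).2 h1))
      have := ht.1
      exact norm_le_zero_iff.1 (nonpos_of_mul_nonpos_right h6 (by positivity))
    have h7 : sphereIncl q ξ = sphereIncl q 0 := (hL0 _ h5).trans (map_zero _).symm
    exact injective_mvfderiv_subtypeVal_sphere (n := d) q h7

end Newtonian

end

theorem theorem4p2 {d : ℕ} {M : Type*} [TopologicalSpace M] [T2Space M]
    [ChartedSpace (Coord (d + 1)) M] [IsManifold (𝓡 (d + 1)) ∞ M]
    [Bundle.RiemannianBundle (fun p : M ↦ TangentSpace (𝓡 (d + 1)) p)]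
    [IsContMDiffRiemannianBundle (𝓡 (d + 1)) ∞ (Coord (d + 1))
      (fun p : M ↦ TangentSpace (𝓡 (d + 1)) p)]
    (F : Newtonian.ForceField (d + 1) M) (hF : F.IsSmooth) :
    (Newtonian.AdmitsNormalBlowUp F ↔ Newtonian.SatisfiesWeakNormality F) ∧
      (Newtonian.SatisfiesWeakNormality F → Newtonian.EveryBlowUpNormal F) := by
  refine ⟨⟨fun h ↦ h.satisfiesWeakNormality hF, fun hW p₀ ν₀ hν ↦ ?_⟩,
    fun hW _ _ _ _ _ hf ↦ hf.isNormal hF hW⟩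
  -- Existence does not depend on the weak normality equations; they only make the blow-up normal.
  obtain ⟨T, hT, f, hf⟩ := Newtonian.exists_isBlowUp hF p₀ hν
  exact ⟨T, hT, f, hf, hf.isNormal hF hW⟩
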